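/- Let $A$ and $B$ be unital AF-algebras, i.e. separable unital $\mathrm{C}^*$-algebras each of which is the closure of the union of an increasing sequence of finite-dimensional $*$-subalgebras, and let $\alpha<\omega_1$ be a countable ordinal. If $$(K_0(A),K_0(A)_+,[1_A])\equiv_{\omega\cdot\alpha}(K_0(B),K_0(B)_+,[1_B]),$$ then $A\equiv_\alpha B$. Here: * $V(A)$ is the abelian monoid of Murray–von Neumann classes of projections in matrix algebras $M_n(A)$, $n\in\mathbb N$ (where $p\sim q$ iff $p=vv^*$ and $q=v^*v$ for some rectangular matrix $v$ over $A$), with $[p]+[q]=[\mathrm{diag}(p,q)]$; $K_0(A)$ is its Grothendieck group and $K_0(A)_+$ is the image of $V(A)$ in $K_0(A)$. The triple $(K_0(A),K_0(A)_+,[1_A])$ is a structure in the language $\{+,\le,u\}$ of pointed ordered groups, with $a\le b$ iff $b-a\in K_0(A)_+$ and $u=[1_A]$. * For discrete structures, $M\equiv_\beta N$ means that $M$ and $N$ satisfy the same $\mathcal L_{\omega_1\omega}$-sentences of quantifier rank at most $\beta$. Here $\mathcal L_{\omega_1\omega}$ extends first-order logic by countable conjunctions and disjunctions of formulas in a common finite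 set of variables. Atomic formulas have rank $0$, negation preserves the rank, countable conjunctions and disjunctions have as rank the supremum of the ranks, and $\exists$, $\forall$ increase the rank by $1$. * For unital $\mathrm{C}^*$-algebras, $A\equiv_\alpha B$ means that $\phi^A=\phi^B$ for every sentence $\phi$ of quantifier rank at most $\alpha$ of the continuous logic $\mathcal L_{\omega_1\omega}$ in the language of unital $\mathrm{C}^*$-algebras. Terms are built from variables, $0$, $1$, $+$, $\cdot$, ${}^*$ and multiplication by complex scalars. Each variable ranges over a ball $D_m=\{y:\|y\|\le m\}$, $m\in\mathbb N$. Formulas are built from the atomic formulas $d(t,s)=\|t-s\|$, for terms $t,s$, by continuous connectives $f\colon\mathbb R^k\to\mathbb R$, quantifiers $\inf_{y\in D_m}$ and $\sup_{y\in D_m}$, and infima and suprema of countable families $(\phi_i)_{i\in\mathbb N}$ of formulas in a common finite set of variables which admit a common modulus of continuity and a common compact interval containing their values, over the balls that the variables range over. Here every formula carries a modulus of continuity and an interval computed from its construction, not from a particular algebra. Atomic formulas have rank $0$, connectives and countable infima and suprema give the supremum of the ranks of their constituents, and quantifiers increase the rank by $1$. -/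

import Mathlib

open scoped NNReal Ordinal Matrix

noncomputable section

/-! ### Discrete infinitary logic -/

namespace InfLogic

/-- The `L_{ω₁ω}`-formulas over a language `L` with free variables among `x_0, …, x_{n-1}`.
Countable conjunctions and disjunctions are taken over families of formulas with the same finite
set of free variables; quantifiers bind the last variable. -/
inductive Formula (L : FirstOrder.Language.{0, 0}) : ℕ → Type
  | equal {n : ℕ} (t s : L.Term (Fin n)) : Formula L n
  | rel {n l : ℕ} (R : L.Relations l) (ts : Fin l → L.Term (Fin n)) : Formula L n
  | neg {n : ℕ} (φ : Formula L n) : Formula L n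
  | conj {n : ℕ} (φ : ℕ → Formula L n) : Formula L n
  | disj {n : ℕ} (φ : ℕ → Formula L n) : Formula L n
  | ex {n : ℕ} (φ : Formula L (n + 1)) : Formula L n
  | all {n : ℕ} (φ : Formula L (n + 1)) : Formula L n

namespace Formula

variable {L : FirstOrder.Language.{0, 0}}

/-- Quantifier rank. -/
def qr : {n : ℕ} → Formula L n → Ordinal.{0}
  | _, equal _ _ => 0
  | _, rel _ _ => 0
  | _, neg φ => φ.qr
  | _, conj φ => ⨆ i, (φ i).qr
  | _, disj φ => ⨆ i, (φ i).qr
  | _, ex φ => φ.qr + 1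
  | _, all φ => φ.qr + 1

/-- Tarskian satisfaction of a formula in an `L`-structure. -/
def Holds (M : Type*) [L.Structure M] : {n : ℕ} → Formula L n → (Fin n → M) → Prop
  | _, equal t s, v => t.realize v = s.realize v
  | _, rel R ts, v => FirstOrder.Language.Structure.RelMap R (fun i => (ts i).realize v)
  | _, neg φ, v => ¬ φ.Holds M v
  | _, conj φ, v => ∀ i, (φ i).Holds M v
  | _, disj φ, v => ∃ i, (φ i).Holds M v
  | _, ex φ, v => ∃ y : M, φ.Holds M (Fin.snoc v y)
  | _, all φ, v => ∀ y : M, φ.Holds M (Fin.snoc v y)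

end Formula

/-- `M ≡_α N`: the two `L`-structures agree on all `L_{ω₁ω}`-sentences of quantifier rank at
most `α`. -/
def Equiv (L : FirstOrder.Language.{0, 0}) (α : Ordinal.{0}) (M N : Type*) [L.Structure M]
    [L.Structure N] : Prop :=
  ∀ φ : Formula L 0, φ.qr ≤ α → (φ.Holds M Fin.elim0 ↔ φ.Holds N Fin.elim0)

end InfLogic

/-! ### The ordered `K₀`-group -/

namespace KZero

/-- Murray–von Neumann equivalence of square matrices, possibly of different sizes, over a
`*`-ring: `p = v v*` and `q = v* v` for some rectangular matrix `v`. -/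
def MvN {A : Type*} [Ring A] [StarRing A] {ι κ : Type*} [Fintype ι] [Fintype κ]
    (p : Matrix ι ι A) (q : Matrix κ κ A) : Prop :=
  ∃ v : Matrix ι κ A, v * vᴴ = p ∧ vᴴ * v = q

section MvN

variable {A : Type*} [Ring A] [StarRing A] {ι κ μ ν : Type*} [Fintype ι] [Fintype κ]
  [Fintype μ] [Fintype ν]

theorem MvN.refl {p : Matrix ι ι A} (hp : IsStarProjection p) : MvN p p := by
  have h1 : p * p = p := hp.isIdempotentElem
  have h2 : pᴴ = p := hp.isSelfAdjoint
  exact ⟨p, by rw [h2, h1], by rw [h2, h1]⟩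

theorem MvN.symm {p : Matrix ι ι A} {q : Matrix κ κ A} (h : MvN p q) : MvN q p := by
  obtain ⟨v, h1, h2⟩ := h
  exact ⟨vᴴ, by rw [Matrix.conjTranspose_conjTranspose, h2],
    by rw [Matrix.conjTranspose_conjTranspose, h1]⟩

theorem MvN.trans {p : Matrix ι ι A} {q : Matrix κ κ A} {r : Matrix μ μ A}
    (hp : IsStarProjection p) (hr : IsStarProjection r) (h : MvN p q) (h' : MvN q r) :
    MvN p r := by
  obtain ⟨v, h1, h2⟩ := h
  obtain ⟨w, h3, h4⟩ := h'
  have hp2 : p * p = p := hp.isIdempotentElem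
  have hr2 : r * r = r := hr.isIdempotentElem
  refine ⟨v * w, ?_, ?_⟩
  · calc v * w * (v * w)ᴴ = v * (w * wᴴ) * vᴴ := by
          rw [Matrix.conjTranspose_mul]; simp only [Matrix.mul_assoc]
      _ = (v * vᴴ) * (v * vᴴ) := by rw [h3, ← h2]; simp only [Matrix.mul_assoc]
      _ = p := by rw [h1, hp2]
  · calc (v * w)ᴴ * (v * w) = wᴴ * (vᴴ * v) * w := by
          rw [Matrix.conjTranspose_mul]; simp only [Matrix.mul_assoc]
      _ = (wᴴ * w) * (wᴴ * w) := by rw [h2, ← h3]; simp only [Matrix.mul_assoc]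
      _ = r := by rw [h4, hr2]

theorem MvN.blocks {p : Matrix ι ι A} {q : Matrix κ κ A} {p' : Matrix μ μ A}
    {q' : Matrix ν ν A} (h : MvN p p') (h' : MvN q q') :
    MvN (Matrix.fromBlocks p 0 0 q) (Matrix.fromBlocks p' 0 0 q') := by
  obtain ⟨v, h1, h2⟩ := h
  obtain ⟨w, h3, h4⟩ := h'
  refine ⟨Matrix.fromBlocks v 0 0 w, ?_, ?_⟩ <;>
    simp [Matrix.fromBlocks_conjTranspose, Matrix.fromBlocks_multiply, h1, h2, h3, h4]

theorem MvN.submatrix_right {p : Matrix ι ι A} {q : Matrix κ κ A} (h : MvN p q) (e : ν ≃ κ) :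
    MvN p (q.submatrix e e) := by
  obtain ⟨v, h1, h2⟩ := h
  refine ⟨v.submatrix id e, ?_, ?_⟩
  · rw [Matrix.conjTranspose_submatrix, Matrix.submatrix_mul_equiv, h1, Matrix.submatrix_id_id]
  · have := Matrix.submatrix_mul vᴴ v e id e Function.bijective_id
    rw [Matrix.conjTranspose_submatrix, ← this, h2]

theorem isStarProjection_submatrix {p : Matrix ι ι A} (hp : IsStarProjection p) (e : κ ≃ ι) :
    IsStarProjection (p.submatrix e e) := by
  have h1 : p * p = p := hp.isIdempotentElem
  have h2 : pᴴ = p := hp.isSelfAdjoint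
  refine ⟨?_, ?_⟩
  · change p.submatrix e e * p.submatrix e e = _
    rw [Matrix.submatrix_mul_equiv, h1]
  · change (p.submatrix e e)ᴴ = _
    rw [Matrix.conjTranspose_submatrix, h2]

theorem isStarProjection_blocks {p : Matrix ι ι A} {q : Matrix κ κ A} (hp : IsStarProjection p)
    (hq : IsStarProjection q) : IsStarProjection (Matrix.fromBlocks p 0 0 q) := by
  have h1 : p * p = p := hp.isIdempotentElem
  have h2 : pᴴ = p := hp.isSelfAdjoint
  have h3 : q * q = q := hq.isIdempotentElem
  have h4 : qᴴ = q := hq.isSelfAdjoint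
  refine ⟨?_, ?_⟩
  · change Matrix.fromBlocks p 0 0 q * Matrix.fromBlocks p 0 0 q = _
    simp [Matrix.fromBlocks_multiply, h1, h3]
  · change (Matrix.fromBlocks p 0 0 q)ᴴ = _
    simp [Matrix.fromBlocks_conjTranspose, h2, h4]

end MvN

/-- Projections in the matrix algebras `M_n(A)`, `n ∈ ℕ`. -/
structure Proj (A : Type*) [Ring A] [StarRing A] where
  size : ℕ
  mat : Matrix (Fin size) (Fin size) A
  isProj : IsStarProjection mat

variable (A : Type*) [Ring A] [StarRing A]

/-- Murray–von Neumann equivalence on `⊔_n Proj(M_n(A))`. -/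
instance Proj.setoid : Setoid (Proj A) where
  r p q := MvN p.mat q.mat
  iseqv := ⟨fun p => MvN.refl p.isProj, fun h => h.symm,
    fun {p _ r} h h' => h.trans p.isProj r.isProj h'⟩

variable {A} in
/-- The block diagonal sum `diag(p, q)`. -/
def Proj.dsum (p q : Proj A) : Proj A where
  size := p.size + q.size
  mat := (Matrix.fromBlocks p.mat 0 0 q.mat).submatrix finSumFinEquiv.symm finSumFinEquiv.symm
  isProj := isStarProjection_submatrix (isStarProjection_blocks p.isProj q.isProj) _

/-- The empty matrix: the zero projection. -/
def Proj.zero : Proj A where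
  size := 0
  mat := 0
  isProj := ⟨by simp [IsIdempotentElem], by simp [IsSelfAdjoint]⟩

/-- The unit of `A` as a `1 × 1` matrix. -/
def Proj.one : Proj A where
  size := 1
  mat := 1
  isProj := ⟨by simp [IsIdempotentElem], by simp [IsSelfAdjoint]⟩

/-- The Murray–von Neumann semigroup `V(A)`. -/
def V : Type _ := Quotient (Proj.setoid A)

variable {A} in
theorem Proj.mvn_dsum (p q : Proj A) :
    MvN (Matrix.fromBlocks p.mat 0 0 q.mat) (p.dsum q).mat :=
  (MvN.refl (isStarProjection_blocks p.isProj q.isProj)).submatrix_right _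

variable {A} in
theorem Proj.dsum_congr {p p' q q' : Proj A} (h : p ≈ p') (h' : q ≈ q') :
    p.dsum q ≈ p'.dsum q' := by
  have hb : MvN (Matrix.fromBlocks p.mat 0 0 q.mat) (Matrix.fromBlocks p'.mat 0 0 q'.mat) :=
    MvN.blocks h h'
  have h1 : MvN (Matrix.fromBlocks p.mat 0 0 q.mat) (p'.dsum q').mat := hb.submatrix_right _
  exact (p.mvn_dsum q).symm.trans (p.dsum q).isProj (p'.dsum q').isProj h1

variable {A} in
theorem Proj.dsum_assoc (p q r : Proj A) : (p.dsum q).dsum r ≈ p.dsum (q.dsum r) := by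
  have hp := MvN.refl p.isProj
  have hr := MvN.refl r.isProj
  have hP := isStarProjection_blocks (isStarProjection_blocks p.isProj q.isProj) r.isProj
  have h1 : MvN (Matrix.fromBlocks (Matrix.fromBlocks p.mat 0 0 q.mat) 0 0 r.mat)
      ((p.dsum q).dsum r).mat := ((p.mvn_dsum q).blocks hr).submatrix_right _
  have h2 : MvN (Matrix.fromBlocks p.mat 0 0 (Matrix.fromBlocks q.mat 0 0 r.mat))
      (p.dsum (q.dsum r)).mat := (hp.blocks (q.mvn_dsum r)).submatrix_right _
  have h3 := (MvN.refl hP).submatrix_right (Equiv.sumAssoc _ _ _).symm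
  have h4 : (Matrix.fromBlocks (Matrix.fromBlocks p.mat 0 0 q.mat) 0 0 r.mat).submatrix
      (Equiv.sumAssoc _ _ _).symm (Equiv.sumAssoc _ _ _).symm =
      Matrix.fromBlocks p.mat 0 0 (Matrix.fromBlocks q.mat 0 0 r.mat) := by
    ext i j
    rcases i with i | i | i <;> rcases j with j | j | j <;> rfl
  rw [h4] at h3
  exact (h1.symm.trans ((p.dsum q).dsum r).isProj
    (isStarProjection_blocks p.isProj (isStarProjection_blocks q.isProj r.isProj)) h3).trans
    ((p.dsum q).dsum r).isProj (p.dsum (q.dsum r)).isProj h2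

variable {A} in
theorem Proj.dsum_comm (p q : Proj A) : p.dsum q ≈ q.dsum p := by
  have h3 := (MvN.refl (isStarProjection_blocks p.isProj q.isProj)).submatrix_right
    (Equiv.sumComm (Fin q.size) (Fin p.size))
  have h4 : (Matrix.fromBlocks p.mat 0 0 q.mat).submatrix
      (Equiv.sumComm (Fin q.size) (Fin p.size)) (Equiv.sumComm (Fin q.size) (Fin p.size)) =
      Matrix.fromBlocks q.mat 0 0 p.mat := by
    ext i j
    rcases i with i | i <;> rcases j with j | j <;> rfl
  rw [h4] at h3
  exact (p.mvn_dsum q).symm.trans (p.dsum q).isProj (q.dsum p).isProj (h3.submatrix_right _)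

variable {A} in
theorem Proj.zero_dsum (p : Proj A) : (Proj.zero A).dsum p ≈ p := by
  have : IsEmpty (Fin (Proj.zero A).size) := inferInstanceAs (IsEmpty (Fin 0))
  have h3 := (MvN.refl (isStarProjection_blocks (Proj.zero A).isProj p.isProj)).submatrix_right
    (Equiv.emptySum (Fin (Proj.zero A).size) (Fin p.size)).symm
  exact ((Proj.zero A).mvn_dsum p).symm.trans ((Proj.zero A).dsum p).isProj p.isProj h3

instance V.instZero : Zero (V A) := ⟨Quotient.mk _ (Proj.zero A)⟩

instance V.instAdd : Add (V A) :=
  ⟨Quotient.map₂ Proj.dsum fun _ _ h _ _ h' => Proj.dsum_congr h h'⟩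

/-- `V(A)` is a commutative monoid under `[p] + [q] = [diag(p, q)]`. -/
instance V.instAddCommMonoid : AddCommMonoid (V A) where
  add_assoc := by
    rintro ⟨p⟩ ⟨q⟩ ⟨r⟩
    exact Quotient.sound (p.dsum_assoc q r)
  add_comm := by
    rintro ⟨p⟩ ⟨q⟩
    exact Quotient.sound (p.dsum_comm q)
  zero_add := by
    rintro ⟨p⟩
    exact Quotient.sound p.zero_dsum
  add_zero := by
    rintro ⟨p⟩
    exact Quotient.sound (Setoid.trans (p.dsum_comm (Proj.zero A)) p.zero_dsum)
  nsmul := nsmulRec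

/-- `K₀(A)`, the Grothendieck group of `V(A)`. -/
abbrev K0 : Type _ := Algebra.GrothendieckAddGroup (V A)

/-- The positive cone `K₀(A)₊`: the image of `V(A)` in `K₀(A)`. -/
def posCone : Set (K0 A) := Set.range (Algebra.GrothendieckAddGroup.of (M := V A))

/-- The class `[1_A]` in `K₀(A)`. -/
def unitClass : K0 A :=
  Algebra.GrothendieckAddGroup.of (M := V A) (Quotient.mk (Proj.setoid A) (Proj.one A))

/-- Function symbols of the language of pointed ordered groups: the constant `u` and `+`. -/
inductive Fun : ℕ → Type
  | unit : Fun 0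
  | add : Fun 2

/-- Relation symbols of the language of pointed ordered groups: `≤`. -/
inductive Rel : ℕ → Type
  | le : Rel 2

/-- The language `{+, ≤, u}` of pointed ordered groups. -/
def language : FirstOrder.Language.{0, 0} := ⟨Fun, Rel⟩

/-- `(K₀(A), K₀(A)₊, [1_A])` as a structure: `a ≤ b` means `b - a ∈ K₀(A)₊`, and `u` is
`[1_A]`. -/
instance K0.structure : language.Structure (K0 A) where
  funMap {_} f := match f with
    | Fun.unit => fun _ => unitClass A
    | Fun.add => fun x => x 0 + x 1
  RelMap {_} R := match R with
    | Rel.le => fun x => x 1 - x 0 ∈ posCone A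

end KZero

/-! ### Infinitary continuous logic for unital C*-algebras -/

namespace MetricLogic

/-- Terms in the language of unital C*-algebras, with variables among `x_0, …, x_{n-1}`. -/
inductive CTerm (n : ℕ) : Type
  | var (i : Fin n) : CTerm n
  | zero : CTerm n
  | one : CTerm n
  | add (t s : CTerm n) : CTerm n
  | mul (t s : CTerm n) : CTerm n
  | star (t : CTerm n) : CTerm n
  | smul (c : ℂ) (t : CTerm n) : CTerm n

namespace CTerm

variable {n : ℕ}

/-- Interpretation of a term. -/
def eval {A : Type*} [CStarAlgebra A] (v : Fin n → A) : CTerm n → A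
  | var i => v i
  | zero => 0
  | one => 1
  | add t s => t.eval v + s.eval v
  | mul t s => t.eval v * s.eval v
  | star t => Star.star (t.eval v)
  | smul c t => c • t.eval v

/-- The norm bound of a term when each variable `x_i` ranges over the ball `D_{N i}`. -/
def bound (N : Fin n → ℕ) : CTerm n → ℝ≥0
  | var i => N i
  | zero => 0
  | one => 1
  | add t s => t.bound N + s.bound N
  | mul t s => t.bound N * s.bound N
  | star t => t.bound N
  | smul c t => ‖c‖₊ * t.bound N

/-- The modulus of continuity of a term when each variable `x_i` ranges over the ball
`D_{N i}`; `d i` bounds the distance between the two values of `x_i`. -/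
def modulus (N : Fin n → ℕ) : CTerm n → (Fin n → ℝ≥0) → ℝ≥0
  | var i, d => d i
  | zero, _ => 0
  | one, _ => 0
  | add t s, d => t.modulus N d + s.modulus N d
  | mul t s, d => t.bound N * s.modulus N d + t.modulus N d * s.bound N
  | star t, d => t.modulus N d
  | smul c t, d => ‖c‖₊ * t.modulus N d

end CTerm

/-- Raw infinitary continuous formulas with free variables among `x_0, …, x_{n-1}`: atomic
formulas `d(t, s)`, continuous connectives, countable infima and suprema, and the quantifiers
`inf` and `sup` of the last variable over the domain `D_m` (the ball of radius `m`). Which raw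
formulas are `L_{ω₁ω}`-formulas is decided by `MFormula.Controlled`. -/
inductive MFormula : ℕ → Type
  | dist {n : ℕ} (t s : CTerm n) : MFormula n
  | conn {n k : ℕ} (f : C(Fin k → ℝ, ℝ)) (φ : Fin k → MFormula n) : MFormula n
  | conj {n : ℕ} (φ : ℕ → MFormula n) : MFormula n
  | disj {n : ℕ} (φ : ℕ → MFormula n) : MFormula n
  | inf {n : ℕ} (m : ℕ) (φ : MFormula (n + 1)) : MFormula n
  | sup {n : ℕ} (m : ℕ) (φ : MFormula (n + 1)) : MFormula n

/-- An `n`-variable modulus of continuity together with a compact interval `[lo, hi]`. -/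
structure Control (n : ℕ) where
  mod : (Fin n → ℝ≥0) → ℝ≥0
  mod_zero : mod 0 = 0
  mod_mono : Monotone mod
  mod_add_le : ∀ d e, mod (d + e) ≤ mod d + mod e
  mod_continuous : Continuous mod
  lo : ℝ
  hi : ℝ

namespace MFormula

/-- `φ.Controlled N Δ`: the raw formula `φ`, with its free variables `x_i` ranging over the balls
`D_{N i}`, is an `L_{ω₁ω}`-formula whose modulus of continuity is at most `Δ.mod` and whose
interval is contained in `[Δ.lo, Δ.hi]`. A countable infimum or supremum is only allowed for
families that have a common modulus of continuity and a common interval. -/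
def Controlled : {n : ℕ} → MFormula n → (Fin n → ℕ) → Control n → Prop
  | _, dist t s, N, Δ =>
      (∀ d, t.modulus N d + s.modulus N d ≤ Δ.mod d) ∧
        Δ.lo ≤ 0 ∧ ((t.bound N + s.bound N : ℝ≥0) : ℝ) ≤ Δ.hi
  | n, conn (k := k) f φ, N, Δ =>
      ∃ Γ : Fin k → Control n, (∀ j, (φ j).Controlled N (Γ j)) ∧
        ∀ u : Fin k → ℝ, (∀ j, u j ∈ Set.Icc (Γ j).lo (Γ j).hi) →
          f u ∈ Set.Icc Δ.lo Δ.hi ∧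
          ∀ w : Fin k → ℝ, (∀ j, w j ∈ Set.Icc (Γ j).lo (Γ j).hi) →
            ∀ d, (∀ j, |u j - w j| ≤ (Γ j).mod d) → |f u - f w| ≤ Δ.mod d
  | _, conj φ, N, Δ => ∀ i, (φ i).Controlled N Δ
  | _, disj φ, N, Δ => ∀ i, (φ i).Controlled N Δ
  | n, inf m φ, N, Δ =>
      ∃ Γ : Control (n + 1), φ.Controlled (Fin.snoc N m) Γ ∧
        (∀ d : Fin n → ℝ≥0, Γ.mod (Fin.snoc d 0) ≤ Δ.mod d) ∧ Δ.lo ≤ Γ.lo ∧ Γ.hi ≤ Δ.hi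
  | n, sup m φ, N, Δ =>
      ∃ Γ : Control (n + 1), φ.Controlled (Fin.snoc N m) Γ ∧
        (∀ d : Fin n → ℝ≥0, Γ.mod (Fin.snoc d 0) ≤ Δ.mod d) ∧ Δ.lo ≤ Γ.lo ∧ Γ.hi ≤ Δ.hi

/-- Quantifier rank. -/
def qr : {n : ℕ} → MFormula n → Ordinal.{0}
  | _, dist _ _ => 0
  | _, conn _ φ => ⨆ j, (φ j).qr
  | _, conj φ => ⨆ i, (φ i).qr
  | _, disj φ => ⨆ i, (φ i).qr
  | _, inf _ φ => φ.qr + 1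
  | _, sup _ φ => φ.qr + 1

/-- The value of a formula in a unital C*-algebra. (For formulas that are `Controlled`, all infima
and suprema are over bounded non-empty sets.) -/
def eval (A : Type*) [CStarAlgebra A] : {n : ℕ} → MFormula n → (Fin n → A) → ℝ
  | _, dist t s, v => ‖t.eval v - s.eval v‖
  | _, conn f φ, v => f fun j => (φ j).eval A v
  | _, conj φ, v => ⨅ i, (φ i).eval A v
  | _, disj φ, v => ⨆ i, (φ i).eval A v
  | _, inf m φ, v => ⨅ y : {y : A // ‖y‖ ≤ m}, φ.eval A (Fin.snoc v y.1)
  | _, sup m φ, v => ⨆ y : {y : A // ‖y‖ ≤ m}, φ.eval A (Fin.snoc v y.1)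

/-- A raw formula without free variables is an `L_{ω₁ω}`-sentence if it has some modulus and
interval. -/
def IsSentence (φ : MFormula 0) : Prop := ∃ Δ : Control 0, φ.Controlled Fin.elim0 Δ

end MFormula

/-- `A ≡_α B` in infinitary continuous logic: every `L_{ω₁ω}`-sentence of quantifier rank at most
`α` has the same value in `A` and in `B`. -/
def Equiv (α : Ordinal.{0}) (A B : Type*) [CStarAlgebra A] [CStarAlgebra B] : Prop :=
  ∀ φ : MFormula 0, φ.IsSentence → φ.qr ≤ α → φ.eval A Fin.elim0 = φ.eval B Fin.elim0

end MetricLogic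

/-- A unital C*-algebra is (separable) AF if it is separable and the closure of the union of an
increasing sequence of finite-dimensional `*`-subalgebras (which need not contain its unit). -/
def IsAFAlgebra (A : Type*) [CStarAlgebra A] : Prop :=
  TopologicalSpace.SeparableSpace A ∧
    ∃ F : ℕ → NonUnitalStarSubalgebra ℂ A, Monotone F ∧ (∀ n, FiniteDimensional ℂ (F n)) ∧
      closure (⋃ n, (F n : Set A)) = Set.univ

end

/-! The back-and-forth game between `A` and `B` is played through the game between their
`K₀`-groups. A position is a pair of unital `*`-homomorphisms `φ : F → A`, `ψ : F → B` from one
finite-dimensional algebra `F`, not necessarily injective. It has rank `β` if the classes of the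
images of the minimal projections of `F`, one for each block, are values of the same terms at tuples
of `K₀(A)` and `K₀(B)` that agree on formulas of rank at most `ω * β`. By induction on `χ`
(`Controlled.respects`), a formula `χ` has the same value at `φ(x)` and `ψ(x)` for each tuple `x` of
`F` whose image lies in the balls of `χ`, in every position of rank `χ.qr`. The theorem is the case
`F = ℂ` with the empty tuple.

Atomic formulas: `K₀` sees which blocks of `F` are killed, so `φ` and `ψ` have the same kernel and
hence `‖φ z‖ = ‖ψ z‖` (`IsPosition.norm_eq`).

Quantifiers: given `y` in `A`, `exists_approx` yields a larger `F'` and `φ' : F' → A` that nearly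
extends `φ` on `x`, nearly contains `y` and has the same classes on `F`. The minimal projections of
`F'` are then played in the `K₀`-game. Their number is finite but not bounded in advance, and `ω *
(β + 1) = ω * β + ω` pays for it. The answers in `K₀(B)` are positive and satisfy the same relation
with `u`, so they come from some `ψ₀ : F' → B`. On `F` it agrees with `ψ` up to a unitary, so a
conjugate of `ψ₀` extends `ψ` exactly (`IsPosition.extend`). Uniform continuity of formulas absorbs
the approximation (`Respects.exists_match`).

The C*-algebraic input is the classification of homomorphisms from finite-dimensional algebras
(`exists_hom_of_sum_eq`, `exists_unitary_of_ecls_eq`) and the description of `V(A)` as a direct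
limit along the chain (`exists_map_sub_eq`, `exists_map_incl_eq`). The limit makes `V(A)` countable
and cancellative, so it embeds in a countable `K₀(A)`. -/

noncomputable section

/-! ### Back-and-forth in discrete infinitary logic -/

namespace InfLogic

variable {L : FirstOrder.Language.{0, 0}}

/-- Two tuples satisfy the same formulas of quantifier rank at most `β`. -/
def TupleEquiv (β : Ordinal.{0}) {M N : Type*} [L.Structure M] [L.Structure N] {n : ℕ}
    (v : Fin n → M) (w : Fin n → N) : Prop :=
  ∀ φ : Formula L n, φ.qr ≤ β → (φ.Holds M v ↔ φ.Holds N w)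

theorem TupleEquiv.mono {β γ : Ordinal.{0}} {M N : Type*} [L.Structure M] [L.Structure N]
    {n : ℕ} {v : Fin n → M} {w : Fin n → N} (h : TupleEquiv (L := L) β v w) (hγ : γ ≤ β) :
    TupleEquiv (L := L) γ v w :=
  fun φ hφ => h φ (hφ.trans hγ)

theorem TupleEquiv.symm {β : Ordinal.{0}} {M N : Type*} [L.Structure M] [L.Structure N]
    {n : ℕ} {v : Fin n → M} {w : Fin n → N} (h : TupleEquiv (L := L) β v w) :
    TupleEquiv (L := L) β w v :=
  fun φ hφ => (h φ hφ).symm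

/-- If every `d` failed, each would be refuted by a formula true of `c`. As `N` is countable, the
conjunction of these is one formula; its existential closure has rank at most `γ + 1` and passes to
`w`, where its witness satisfies the formula that refutes it. -/
theorem TupleEquiv.exists_snoc {γ : Ordinal.{0}} {M N : Type*} [L.Structure M] [L.Structure N]
    [Countable N] [Nonempty N] {n : ℕ} {v : Fin n → M} {w : Fin n → N}
    (h : TupleEquiv (L := L) (γ + 1) v w) (c : M) :
    ∃ d : N, TupleEquiv (L := L) γ (Fin.snoc v c : Fin (n + 1) → M)
      (Fin.snoc w d : Fin (n + 1) → N) := by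
  by_contra! hcon
  have key : ∀ d : N, ∃ φ : Formula L (n + 1), φ.qr ≤ γ ∧ φ.Holds M (Fin.snoc v c) ∧
      ¬ φ.Holds N (Fin.snoc w d) := by
    intro d
    have hd := hcon d
    simp only [TupleEquiv, not_forall] at hd
    obtain ⟨φ, hφ, hne⟩ := hd
    -- Negation preserves rank, so the distinguishing formula can be taken true on the side of `M`.
    by_cases hM : φ.Holds M (Fin.snoc v c)
    · exact ⟨φ, hφ, hM, fun hN => hne (iff_of_true hM hN)⟩
    · refine ⟨.neg φ, hφ, hM, fun hN => hne (iff_of_false hM hN)⟩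
  choose F hF hM hN using key
  obtain ⟨e, he⟩ := exists_surjective_nat N
  have hex := (h (.ex (.conj fun i => F (e i)))
    (by
      simp only [Formula.qr]
      gcongr
      exact Ordinal.iSup_le fun i => hF _)).1 ⟨c, fun i => hM _⟩
  obtain ⟨d, hd⟩ := hex
  obtain ⟨i, rfl⟩ := he d
  exact hN _ (hd i)

theorem TupleEquiv.exists_append {M N : Type*} [L.Structure M] [L.Structure N]
    [Countable N] [Nonempty N] {n : ℕ} {v : Fin n → M} {w : Fin n → N} {k : ℕ} :
    ∀ {γ : Ordinal.{0}}, TupleEquiv (L := L) (γ + k) v w → ∀ c : Fin k → M,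
    ∃ d : Fin k → N, TupleEquiv (L := L) γ (Fin.append v c) (Fin.append w d) := by
  induction k with
  | zero =>
    intro γ h c
    refine ⟨Fin.elim0, ?_⟩
    have hc : c = Fin.elim0 := Subsingleton.elim _ _
    subst hc
    rw [Fin.append_elim0, Fin.append_elim0]
    simpa using h
  | succ k ih =>
    intro γ h c
    obtain ⟨d, hd⟩ := ih (γ := γ + 1) (by
      refine h.mono ?_
      -- Ordinal addition is not commutative; only the finite part `1 + k` may be reordered, by
      -- computing in `ℕ`.
      rw [add_assoc]
      gcongr
      rw [← Nat.cast_one, ← Nat.cast_add, add_comm]) (Fin.init c)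
    obtain ⟨d', hd'⟩ := hd.exists_snoc (c (Fin.last k))
    refine ⟨Fin.snoc d d', ?_⟩
    rw [← Fin.append_snoc, ← Fin.append_snoc] at hd'
    rwa [Fin.snoc_init_self] at hd'

end InfLogic
end

/-! ### Boundedness and uniform continuity of controlled formulas -/

noncomputable section

namespace MetricLogic

variable {A : Type*} [CStarAlgebra A]

/-- Only an inequality, because the zero algebra is allowed and its unit has norm `0`. -/
theorem nnnorm_one_le_one : ‖(1 : A)‖₊ ≤ 1 := by
  rcases subsingleton_or_nontrivial A with h | h
  · rw [Subsingleton.elim (1 : A) 0]; simp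
  · simp

theorem CTerm.nnnorm_eval_le {n : ℕ} {N : Fin n → ℕ} {v : Fin n → A} (hv : ∀ i, ‖v i‖₊ ≤ N i)
    (t : CTerm n) : ‖t.eval v‖₊ ≤ t.bound N := by
  induction t with
  | var i => exact hv i
  | zero => simp [eval]
  | one => exact nnnorm_one_le_one
  | add t s ht hs => exact (nnnorm_add_le _ _).trans (add_le_add ht hs)
  | mul t s ht hs => exact (nnnorm_mul_le _ _).trans (mul_le_mul' ht hs)
  | star t ht => simpa [eval, bound] using ht
  | smul c t ht =>
    simp only [eval, bound, nnnorm_smul]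
    exact mul_le_mul' le_rfl ht

theorem CTerm.nnnorm_eval_sub_le {n : ℕ} {N : Fin n → ℕ} {v w : Fin n → A}
    (hv : ∀ i, ‖v i‖₊ ≤ N i) (hw : ∀ i, ‖w i‖₊ ≤ N i) {d : Fin n → ℝ≥0}
    (hd : ∀ i, ‖v i - w i‖₊ ≤ d i) (t : CTerm n) :
    ‖t.eval v - t.eval w‖₊ ≤ t.modulus N d := by
  induction t with
  | var i => exact hd i
  | zero => simp [eval]
  | one => simp [eval]
  | add t s ht hs =>
    simp only [eval, modulus]
    rw [add_sub_add_comm]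
    exact (nnnorm_add_le _ _).trans (add_le_add ht hs)
  | mul t s ht hs =>
    simp only [eval, modulus]
    have : t.eval v * s.eval v - t.eval w * s.eval w =
      t.eval v * (s.eval v - s.eval w) + (t.eval v - t.eval w) * s.eval w := by noncomm_ring
    rw [this]
    refine (nnnorm_add_le _ _).trans (add_le_add ?_ ?_)
    · exact (nnnorm_mul_le _ _).trans (mul_le_mul' (t.nnnorm_eval_le hv) hs)
    · exact (nnnorm_mul_le _ _).trans (mul_le_mul' ht (s.nnnorm_eval_le hw))
  | star t ht => simpa [eval, modulus, ← star_sub] using ht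
  | smul c t ht =>
    simp only [eval, modulus, ← smul_sub, nnnorm_smul]
    exact mul_le_mul' le_rfl ht

theorem abs_ciInf_sub_ciInf_le {ι : Type*} [Nonempty ι] {f g : ι → ℝ} {c : ℝ}
    (hf : BddBelow (Set.range f)) (hg : BddBelow (Set.range g)) (h : ∀ i, |f i - g i| ≤ c) :
    |(⨅ i, f i) - ⨅ i, g i| ≤ c := by
  rw [abs_sub_le_iff]
  constructor
  · rw [sub_le_iff_le_add, ← sub_le_iff_le_add']
    refine le_ciInf fun i => ?_
    have := (abs_sub_le_iff.1 (h i)).1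
    have := ciInf_le hf i
    linarith
  · rw [sub_le_iff_le_add, ← sub_le_iff_le_add']
    refine le_ciInf fun i => ?_
    have := (abs_sub_le_iff.1 (h i)).2
    have := ciInf_le hg i
    linarith

theorem abs_ciSup_sub_ciSup_le {ι : Type*} [Nonempty ι] {f g : ι → ℝ} {c : ℝ}
    (hf : BddAbove (Set.range f)) (hg : BddAbove (Set.range g)) (h : ∀ i, |f i - g i| ≤ c) :
    |(⨆ i, f i) - ⨆ i, g i| ≤ c := by
  rw [abs_sub_le_iff]
  constructor
  · rw [sub_le_iff_le_add]
    refine ciSup_le fun i => ?_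
    have := (abs_sub_le_iff.1 (h i)).1
    have := le_ciSup hg i
    linarith
  · rw [sub_le_iff_le_add]
    refine ciSup_le fun i => ?_
    have := (abs_sub_le_iff.1 (h i)).2
    have := le_ciSup hf i
    linarith

theorem ciInf_mem_Icc {ι : Type*} [Nonempty ι] {f : ι → ℝ} {a b : ℝ}
    (h : ∀ i, f i ∈ Set.Icc a b) : ⨅ i, f i ∈ Set.Icc a b := by
  obtain ⟨i⟩ := ‹Nonempty ι›
  exact ⟨le_ciInf fun j => (h j).1,
    (ciInf_le ⟨a, Set.forall_mem_range.2 fun j => (h j).1⟩ i).trans (h i).2⟩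

theorem ciSup_mem_Icc {ι : Type*} [Nonempty ι] {f : ι → ℝ} {a b : ℝ}
    (h : ∀ i, f i ∈ Set.Icc a b) : ⨆ i, f i ∈ Set.Icc a b := by
  obtain ⟨i⟩ := ‹Nonempty ι›
  exact ⟨(h i).1.trans (le_ciSup ⟨b, Set.forall_mem_range.2 fun j => (h j).2⟩ i),
    ciSup_le fun j => (h j).2⟩

theorem nnnorm_snoc_le {n : ℕ} {N : Fin n → ℕ} {m : ℕ} {v : Fin n → A} (hv : ∀ i, ‖v i‖₊ ≤ N i)
    {y : A} (hy : ‖y‖ ≤ m) (i : Fin (n + 1)) :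
    ‖(Fin.snoc v y : Fin (n + 1) → A) i‖₊ ≤ ((Fin.snoc N m : Fin (n + 1) → ℕ) i : ℝ≥0) := by
  refine Fin.lastCases ?_ (fun j => ?_) i
  · rw [Fin.snoc_last, Fin.snoc_last]
    exact_mod_cast hy
  · simpa using hv j

theorem nnnorm_snoc_sub_le {n : ℕ} {v w : Fin n → A} {d : Fin n → ℝ≥0}
    (h : ∀ i, ‖v i - w i‖₊ ≤ d i) {y z : A} {r : ℝ≥0} (hy : ‖y - z‖₊ ≤ r) (i : Fin (n + 1)) :
    ‖(Fin.snoc v y : Fin (n + 1) → A) i - (Fin.snoc w z : Fin (n + 1) → A) i‖₊ ≤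
      (Fin.snoc d r : Fin (n + 1) → ℝ≥0) i := by
  refine Fin.lastCases ?_ (fun j => ?_) i
  · simpa using hy
  · simpa using h j

instance ball_nonempty (m : ℕ) : Nonempty {y : A // ‖y‖ ≤ m} := ⟨0, by simp⟩

namespace MFormula

/-- Guarantees that the real `⨅` and `⨆` in `eval` are over bounded families and never take their
default value. -/
theorem Controlled.eval_mem {n : ℕ} {φ : MFormula n} : ∀ {N : Fin n → ℕ} {Δ : Control n},
    φ.Controlled N Δ → ∀ {v : Fin n → A}, (∀ i, ‖v i‖₊ ≤ N i) →
    φ.eval A v ∈ Set.Icc Δ.lo Δ.hi := by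
  induction φ with
  | dist t s =>
    intro N Δ h v hv
    obtain ⟨-, h1, h2⟩ := h
    refine ⟨h1.trans (norm_nonneg _), le_trans ?_ h2⟩
    have h3 := (nnnorm_sub_le (t.eval v) (s.eval v)).trans
      (add_le_add (t.nnnorm_eval_le hv) (s.nnnorm_eval_le hv))
    exact_mod_cast h3
  | conn f φ ih =>
    intro N Δ h v hv
    obtain ⟨Γ, h1, h2⟩ := h
    exact (h2 _ fun j => ih j (h1 j) hv).1
  | conj φ ih => exact fun h v hv => ciInf_mem_Icc fun i => ih i (h i) hv
  | disj φ ih => exact fun h v hv => ciSup_mem_Icc fun i => ih i (h i) hv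
  | inf m φ ih =>
    intro N Δ h v hv
    obtain ⟨Γ, h1, -, h2, h3⟩ := h
    exact Set.Icc_subset_Icc h2 h3 (ciInf_mem_Icc fun y => ih h1 (nnnorm_snoc_le hv y.2))
  | sup m φ ih =>
    intro N Δ h v hv
    obtain ⟨Γ, h1, -, h2, h3⟩ := h
    exact Set.Icc_subset_Icc h2 h3 (ciSup_mem_Icc fun y => ih h1 (nnnorm_snoc_le hv y.2))

theorem Controlled.bddBelow_range {n : ℕ} {ι : Type*} {φ : ι → MFormula n} {N : Fin n → ℕ}
    {Δ : Control n} (h : ∀ i, (φ i).Controlled N Δ) {v : ι → Fin n → A}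
    (hv : ∀ i j, ‖v i j‖₊ ≤ N j) : BddBelow (Set.range fun i => (φ i).eval A (v i)) :=
  ⟨Δ.lo, Set.forall_mem_range.2 fun i => ((h i).eval_mem (hv i)).1⟩

theorem Controlled.bddAbove_range {n : ℕ} {ι : Type*} {φ : ι → MFormula n} {N : Fin n → ℕ}
    {Δ : Control n} (h : ∀ i, (φ i).Controlled N Δ) {v : ι → Fin n → A}
    (hv : ∀ i j, ‖v i j‖₊ ≤ N j) : BddAbove (Set.range fun i => (φ i).eval A (v i)) :=
  ⟨Δ.hi, Set.forall_mem_range.2 fun i => ((h i).eval_mem (hv i)).2⟩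

/-- In the quantifier cases the same element is substituted for the bound variable on both sides,
which is why the modulus is evaluated at `Fin.snoc d 0`. -/
theorem Controlled.abs_eval_sub_le {n : ℕ} {φ : MFormula n} : ∀ {N : Fin n → ℕ} {Δ : Control n},
    φ.Controlled N Δ → ∀ {v w : Fin n → A}, (∀ i, ‖v i‖₊ ≤ N i) → (∀ i, ‖w i‖₊ ≤ N i) →
    ∀ {d : Fin n → ℝ≥0}, (∀ i, ‖v i - w i‖₊ ≤ d i) →
    |φ.eval A v - φ.eval A w| ≤ Δ.mod d := by
  induction φ with
  | dist t s =>
    intro N Δ h v w hv hw d hd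
    refine le_trans ?_ (NNReal.coe_le_coe.2 (h.1 d))
    refine (abs_norm_sub_norm_le _ _).trans ?_
    rw [sub_sub_sub_comm]
    refine (norm_sub_le _ _).trans ?_
    rw [NNReal.coe_add]
    exact add_le_add (NNReal.coe_le_coe.2 (t.nnnorm_eval_sub_le hv hw hd))
      (NNReal.coe_le_coe.2 (s.nnnorm_eval_sub_le hv hw hd))
  | conn f φ ih =>
    intro N Δ h v w hv hw d hd
    obtain ⟨Γ, h1, h2⟩ := h
    exact (h2 _ fun j => (h1 j).eval_mem hv).2 _ (fun j => (h1 j).eval_mem hw) d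
      fun j => ih j (h1 j) hv hw hd
  | conj φ ih =>
    exact fun h v w hv hw d hd => abs_ciInf_sub_ciInf_le
      (Controlled.bddBelow_range h fun _ => hv) (Controlled.bddBelow_range h fun _ => hw)
      fun i => ih i (h i) hv hw hd
  | disj φ ih =>
    exact fun h v w hv hw d hd => abs_ciSup_sub_ciSup_le
      (Controlled.bddAbove_range h fun _ => hv) (Controlled.bddAbove_range h fun _ => hw)
      fun i => ih i (h i) hv hw hd
  | inf m φ ih =>
    intro N Δ h v w hv hw d hd
    obtain ⟨Γ, h1, h2, -, -⟩ := h
    refine le_trans ?_ (NNReal.coe_le_coe.2 (h2 d))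
    refine abs_ciInf_sub_ciInf_le
      (Controlled.bddBelow_range (fun _ => h1) fun y => nnnorm_snoc_le hv y.2)
      (Controlled.bddBelow_range (fun _ => h1) fun y => nnnorm_snoc_le hw y.2) fun y => ?_
    exact ih h1 (nnnorm_snoc_le hv y.2) (nnnorm_snoc_le hw y.2)
      (nnnorm_snoc_sub_le hd (by simp))
  | sup m φ ih =>
    intro N Δ h v w hv hw d hd
    obtain ⟨Γ, h1, h2, -, -⟩ := h
    refine le_trans ?_ (NNReal.coe_le_coe.2 (h2 d))
    refine abs_ciSup_sub_ciSup_le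
      (Controlled.bddAbove_range (fun _ => h1) fun y => nnnorm_snoc_le hv y.2)
      (Controlled.bddAbove_range (fun _ => h1) fun y => nnnorm_snoc_le hw y.2) fun y => ?_
    exact ih h1 (nnnorm_snoc_le hv y.2) (nnnorm_snoc_le hw y.2)
      (nnnorm_snoc_sub_le hd (by simp))

/-- Evaluation of a controlled formula is uniformly continuous on the balls. -/
theorem Controlled.exists_delta {n : ℕ} {φ : MFormula n} {N : Fin n → ℕ} {Δ : Control n}
    (h : φ.Controlled N Δ) {ε : ℝ} (hε : 0 < ε) : ∃ δ : ℝ, 0 < δ ∧ ∀ v w : Fin n → A,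
    (∀ i, ‖v i‖₊ ≤ N i) → (∀ i, ‖w i‖₊ ≤ N i) → (∀ i, ‖v i - w i‖ ≤ δ) →
    |φ.eval A v - φ.eval A w| < ε := by
  -- Along constant vectors the modulus is a continuous function of one variable vanishing at `0`.
  have hc : Continuous fun r : ℝ≥0 => (Δ.mod (fun _ => r) : ℝ) :=
    NNReal.continuous_coe.comp (Δ.mod_continuous.comp (by fun_prop))
  have h0 : (Δ.mod (fun _ => (0 : ℝ≥0)) : ℝ) < ε := by
    have : Δ.mod (fun _ => (0 : ℝ≥0)) = 0 := Δ.mod_zero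
    rw [this]; simpa using hε
  have := (hc.tendsto 0).eventually (gt_mem_nhds h0)
  obtain ⟨r, hr, hlt⟩ := Metric.eventually_nhds_iff.1 this
  obtain ⟨s, hs⟩ : ∃ s : ℝ≥0, (s : ℝ) = r / 2 := ⟨⟨r / 2, by positivity⟩, rfl⟩
  refine ⟨r / 2, by positivity, fun v w hv hw hd => ?_⟩
  refine lt_of_le_of_lt (h.abs_eval_sub_le hv hw (d := fun _ => s) fun i => ?_) (hlt ?_)
  · rw [← NNReal.coe_le_coe, hs]
    exact hd i
  · rw [NNReal.dist_eq, hs, NNReal.coe_zero, sub_zero, abs_of_pos (by positivity)]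
    linarith

end MFormula
end MetricLogic
end

/-! ### Classes of projections and functoriality of `V` -/

noncomputable section

namespace KZero

section Classes

variable {C : Type*} [Ring C] [StarRing C] {ι κ μ : Type*} [Fintype ι] [Fintype κ] [Fintype μ]

theorem isStarProjection_matrix_iff {p : Matrix ι ι C} :
    IsStarProjection p ↔ p * p = p ∧ pᴴ = p :=
  isStarProjection_iff _

/-- The class of a projection in `V(C)`. -/
def V.mk (p : Proj C) : V C := Quotient.mk (Proj.setoid C) p

theorem V.mk_eq_iff {p q : Proj C} : V.mk p = V.mk q ↔ MvN p.mat q.mat :=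
  ⟨fun h => Quotient.exact h, fun h => Quotient.sound h⟩

theorem V.mk_dsum (p q : Proj C) : V.mk (p.dsum q) = V.mk p + V.mk q := rfl

theorem V.mk_zero : V.mk (Proj.zero C) = 0 := rfl

theorem V.exists_mk (x : V C) : ∃ p, V.mk p = x := Quotient.exists_rep x

/-- The class in `V(C)` of a projection matrix indexed by an arbitrary finite type (and `0` for
matrices that are not projections). -/
def vcls (p : Matrix ι ι C) : V C :=
  open Classical in
  if h : IsStarProjection p then
    V.mk ⟨Fintype.card ι, p.submatrix (Fintype.equivFin ι).symm (Fintype.equivFin ι).symm,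
      isStarProjection_submatrix h _⟩
  else 0

theorem vcls_of_isStarProjection {p : Matrix ι ι C} (hp : IsStarProjection p) :
    vcls p = V.mk ⟨Fintype.card ι,
      p.submatrix (Fintype.equivFin ι).symm (Fintype.equivFin ι).symm,
      isStarProjection_submatrix hp _⟩ :=
  dif_pos hp

theorem vcls_eq_iff {p : Matrix ι ι C} {q : Matrix κ κ C} (hp : IsStarProjection p)
    (hq : IsStarProjection q) : vcls p = vcls q ↔ MvN p q := by
  have h1 := (MvN.refl hp).submatrix_right (Fintype.equivFin ι).symm
  have h2 := (MvN.refl hq).submatrix_right (Fintype.equivFin κ).symm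
  have hp' := isStarProjection_submatrix hp (Fintype.equivFin ι).symm
  have hq' := isStarProjection_submatrix hq (Fintype.equivFin κ).symm
  rw [vcls_of_isStarProjection hp, vcls_of_isStarProjection hq, V.mk_eq_iff]
  constructor
  · intro h3
    exact (h1.trans hp hq' h3).trans hp hq h2.symm
  · intro h
    exact (h1.symm.trans hp' hq h).trans hp' hq' h2

theorem vcls_mat (p : Proj C) : vcls p.mat = V.mk p := by
  rw [vcls_of_isStarProjection p.isProj, V.mk_eq_iff]
  exact ((MvN.refl p.isProj).submatrix_right _).symm

theorem exists_vcls (x : V C) :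
    ∃ (n : ℕ) (p : Matrix (Fin n) (Fin n) C), IsStarProjection p ∧ vcls p = x := by
  obtain ⟨p, rfl⟩ := x.exists_mk
  exact ⟨p.size, p.mat, p.isProj, vcls_mat p⟩

theorem vcls_blocks {p : Matrix ι ι C} {q : Matrix κ κ C} (hp : IsStarProjection p)
    (hq : IsStarProjection q) :
    vcls (Matrix.fromBlocks p 0 0 q) = vcls p + vcls q := by
  have h1 := (MvN.refl hp).submatrix_right (Fintype.equivFin ι).symm
  have h2 := (MvN.refl hq).submatrix_right (Fintype.equivFin κ).symm
  have h3 := h1.blocks h2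
  rw [vcls_of_isStarProjection hp, vcls_of_isStarProjection hq, ← V.mk_dsum, ← vcls_mat,
    vcls_eq_iff (isStarProjection_blocks hp hq) (Proj.isProj _)]
  exact h3.submatrix_right _

theorem vcls_zero : vcls (0 : Matrix ι ι C) = 0 := by
  rw [← V.mk_zero, ← vcls_mat, vcls_eq_iff (.zero _) (Proj.isProj _)]
  exact ⟨0, by simp, by ext i; exact i.elim0⟩

theorem isStarProjection_add {p q : Matrix ι ι C} (hp : IsStarProjection p)
    (hq : IsStarProjection q) (h : p * q = 0) : IsStarProjection (p + q) := by
  rw [isStarProjection_matrix_iff] at *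
  have h' : q * p = 0 := by
    have := congrArg Matrix.conjTranspose h
    rwa [Matrix.conjTranspose_mul, hp.2, hq.2, Matrix.conjTranspose_zero] at this
  constructor
  · rw [add_mul, mul_add, mul_add, hp.1, hq.1, h, h', add_zero, zero_add]
  · rw [Matrix.conjTranspose_add, hp.2, hq.2]

theorem vcls_add {p q : Matrix ι ι C} (hp : IsStarProjection p)
    (hq : IsStarProjection q) (h : p * q = 0) : vcls (p + q) = vcls p + vcls q := by
  rw [← vcls_blocks hp hq, vcls_eq_iff (isStarProjection_add hp hq h)
    (isStarProjection_blocks hp hq)]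
  rw [isStarProjection_matrix_iff] at hp hq
  have h' : q * p = 0 := by
    have := congrArg Matrix.conjTranspose h
    rwa [Matrix.conjTranspose_mul, hp.2, hq.2, Matrix.conjTranspose_zero] at this
  -- The row `(p q)` implements the equivalence: its products with its adjoint are `p + q` and, by
  -- orthogonality, `diag(p, q)`.
  refine ⟨Matrix.fromCols p q, ?_, ?_⟩
  · rw [Matrix.conjTranspose_fromCols_eq_fromRows_conjTranspose, Matrix.fromCols_mul_fromRows,
      hp.2, hq.2, hp.1, hq.1]
  · rw [Matrix.conjTranspose_fromCols_eq_fromRows_conjTranspose, Matrix.fromRows_mul_fromCols,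
      hp.2, hq.2, hp.1, hq.1, h, h']

theorem isStarProjection_mul_conjTranspose {x : Matrix ι κ C} {p : Matrix κ κ C}
    (h : xᴴ * x = p) (hx : x * p = x) : IsStarProjection (x * xᴴ) := by
  rw [isStarProjection_matrix_iff]
  constructor
  · rw [Matrix.mul_assoc, ← Matrix.mul_assoc xᴴ, h, ← Matrix.mul_assoc, hx]
  · simp

theorem vcls_mul_conjTranspose {x : Matrix ι κ C} {p : Matrix κ κ C}
    (hp : IsStarProjection p) (h : xᴴ * x = p) (hx : x * p = x) :
    vcls (x * xᴴ) = vcls p :=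
  (vcls_eq_iff (isStarProjection_mul_conjTranspose h hx) hp).2 ⟨x, rfl, h⟩

/-- The `x j` are partial isometries with pairwise orthogonal ranges, so their range projections add
up in `V`. -/
theorem isStarProjection_sum_and_vcls_sum {J : Type*} (s : Finset J) {σ : J → Type*}
    [∀ j, Fintype (σ j)] {x : ∀ j, Matrix ι (σ j) C} {p : ∀ j, Matrix (σ j) (σ j) C}
    (hp : ∀ j, IsStarProjection (p j)) (h : ∀ j, (x j)ᴴ * x j = p j)
    (hx : ∀ j, x j * p j = x j) (ho : ∀ i j, i ≠ j → (x i)ᴴ * x j = 0) :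
    IsStarProjection (∑ j ∈ s, x j * (x j)ᴴ) ∧
      vcls (∑ j ∈ s, x j * (x j)ᴴ) = ∑ j ∈ s, vcls (p j) := by
  classical
  induction s using Finset.induction_on with
  | empty => simp [vcls_zero]
  | insert a s ha ih =>
    rw [Finset.sum_insert ha, Finset.sum_insert ha]
    have h1 := isStarProjection_mul_conjTranspose (h a) (hx a)
    have h2 : x a * (x a)ᴴ * ∑ j ∈ s, x j * (x j)ᴴ = 0 := by
      rw [Matrix.mul_sum]
      refine Finset.sum_eq_zero fun j hj => ?_
      rw [Matrix.mul_assoc, ← Matrix.mul_assoc (x a)ᴴ, ho a j (by rintro rfl; exact ha hj)]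
      simp
    refine ⟨isStarProjection_add h1 ih.1 h2, ?_⟩
    rw [vcls_add h1 ih.1 h2, ih.2, vcls_mul_conjTranspose (hp a) (h a) (hx a)]

/-- A projection whose class is a sum of classes decomposes accordingly. -/
theorem exists_decomposition {J : Type*} [Fintype J] {σ : J → Type*} [∀ j, Fintype (σ j)]
    {r : Matrix ι ι C} (hr : IsStarProjection r) {p : ∀ j, Matrix (σ j) (σ j) C}
    (hp : ∀ j, IsStarProjection (p j)) (h : vcls r = ∑ j, vcls (p j)) :
    ∃ x : ∀ j, Matrix ι (σ j) C, (∀ j, (x j)ᴴ * x j = p j) ∧ (∀ j, x j * p j = x j) ∧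
      (∀ i j, i ≠ j → (x i)ᴴ * x j = 0) ∧ ∑ j, x j * (x j)ᴴ = r := by
  classical
  -- `k j` includes the `j`-th summand in the direct sum. The `y j = k j * p j` decompose the block
  -- sum `q` of the `p j`, and a partial isometry `v` implementing `r ∼ q` carries this to `r`.
  let k : ∀ j, Matrix (Σ j, σ j) (σ j) C := fun j => Matrix.of fun t i =>
    if t = ⟨j, i⟩ then 1 else 0
  have hk : ∀ j, (k j)ᴴ * k j = 1 := by
    intro j
    ext a b
    simp only [Matrix.mul_apply, Matrix.conjTranspose_apply, Matrix.one_apply]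
    rw [Finset.sum_eq_single ⟨j, a⟩ (by intro t _ ht; simp [k, ht]) (by simp)]
    simp [k]
  have hk0 : ∀ i j, i ≠ j → (k i)ᴴ * k j = 0 := by
    intro i j hij
    ext a b
    simp only [Matrix.mul_apply, Matrix.conjTranspose_apply, Matrix.zero_apply]
    refine Finset.sum_eq_zero fun t _ => ?_
    by_cases ht : t = ⟨i, a⟩
    · have : t ≠ ⟨j, b⟩ := by rintro rfl; exact hij (congrArg Sigma.fst ht).symm
      simp [k, this]
    · simp [k, ht]
  have hpp : ∀ j, p j * p j = p j ∧ (p j)ᴴ = p j := fun j => isStarProjection_matrix_iff.1 (hp j)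
  let y : ∀ j, Matrix (Σ j, σ j) (σ j) C := fun j => k j * p j
  have hy1 : ∀ j, (y j)ᴴ * y j = p j := by
    intro j
    simp only [y, Matrix.conjTranspose_mul]
    rw [Matrix.mul_assoc, ← Matrix.mul_assoc (k j)ᴴ, hk, Matrix.one_mul, (hpp j).2, (hpp j).1]
  have hy2 : ∀ j, y j * p j = y j := by
    intro j
    simp only [y]
    rw [Matrix.mul_assoc, (hpp j).1]
  have hy3 : ∀ i j, i ≠ j → (y i)ᴴ * y j = 0 := by
    intro i j hij
    simp only [y, Matrix.conjTranspose_mul]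
    rw [Matrix.mul_assoc, ← Matrix.mul_assoc (k i)ᴴ, hk0 i j hij]
    simp
  obtain ⟨hq, hqc⟩ := isStarProjection_sum_and_vcls_sum Finset.univ hp hy1 hy2 hy3
  obtain ⟨v, hv1, hv2⟩ := (vcls_eq_iff hr hq).1 (h.trans hqc.symm)
  set q := ∑ j, y j * (y j)ᴴ with hqdef
  have hqy : ∀ j, q * y j = y j := by
    intro j
    rw [hqdef, Matrix.sum_mul, Finset.sum_eq_single j]
    · rw [Matrix.mul_assoc, hy1, hy2]
    · intro i _ hij
      rw [Matrix.mul_assoc, hy3 i j hij, Matrix.mul_zero]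
    · simp
  have hvy : ∀ i j, (v * y i)ᴴ * (v * y j) = (y i)ᴴ * y j := by
    intro i j
    rw [Matrix.conjTranspose_mul, Matrix.mul_assoc, ← Matrix.mul_assoc vᴴ, hv2, hqy]
  refine ⟨fun j => v * y j, fun j => by rw [hvy, hy1], fun j => by rw [Matrix.mul_assoc, hy2],
    fun i j hij => by rw [hvy, hy3 i j hij], ?_⟩
  have : ∀ j, v * y j * (v * y j)ᴴ = v * (y j * (y j)ᴴ) * vᴴ := by
    intro j
    rw [Matrix.conjTranspose_mul]
    simp only [Matrix.mul_assoc]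
  simp only [this]
  rw [← Matrix.sum_mul, ← Matrix.mul_sum, ← hqdef, ← hv2, ← Matrix.mul_assoc, hv1,
    Matrix.mul_assoc, hv1, (isStarProjection_matrix_iff.1 hr).1]

/-- The class of a projection of `C` itself. -/
def ecls (p : C) : V C := vcls (Matrix.of fun (_ _ : Fin 1) => p)

theorem isStarProjection_of {p : C} (hp : IsStarProjection p) :
    IsStarProjection (Matrix.of fun (_ _ : Fin 1) => p) := by
  rw [isStarProjection_matrix_iff]
  rw [isStarProjection_iff'] at hp
  constructor <;> ext i j <;> simp [Matrix.mul_apply, hp]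

theorem ecls_eq_iff {p q : C} (hp : IsStarProjection p) (hq : IsStarProjection q) :
    ecls p = ecls q ↔ ∃ v : C, v * star v = p ∧ star v * v = q := by
  rw [ecls, ecls, vcls_eq_iff (isStarProjection_of hp) (isStarProjection_of hq)]
  constructor
  · rintro ⟨v, h1, h2⟩
    refine ⟨v 0 0, ?_, ?_⟩
    · simpa [Matrix.mul_apply] using congrFun (congrFun h1 0) 0
    · simpa [Matrix.mul_apply] using congrFun (congrFun h2 0) 0
  · rintro ⟨v, h1, h2⟩
    refine ⟨Matrix.of fun _ _ => v, ?_, ?_⟩ <;> ext i j <;> simp [Matrix.mul_apply, h1, h2]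

theorem ecls_one : ecls (1 : C) = V.mk (Proj.one C) := by
  rw [← vcls_mat, ecls]
  congr 1
  ext i j
  rw [Subsingleton.elim i j]
  simp [Proj.one]

theorem ecls_zero : ecls (0 : C) = 0 := vcls_zero

/-- The zero class is that of the empty matrix; a `v` with no columns has `v v* = 0`. -/
theorem eq_zero_of_ecls_eq_zero {p : C} (hp : IsStarProjection p) (h : ecls p = 0) : p = 0 := by
  rw [← vcls_zero (ι := Fin 0), ecls, vcls_eq_iff (isStarProjection_of hp) (.zero _)] at h
  obtain ⟨v, h1, -⟩ := h
  simpa [Matrix.mul_apply] using (congrFun (congrFun h1 0) 0).symm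

end Classes

section Map

variable {C C' C'' : Type*} [Ring C] [StarRing C] [Algebra ℂ C] [Ring C'] [StarRing C']
  [Algebra ℂ C'] [Ring C''] [StarRing C''] [Algebra ℂ C'']
  {ι κ : Type*} [Fintype ι] [Fintype κ]

theorem isStarProjection_map (f : C →⋆ₐ[ℂ] C') {p : Matrix ι ι C} (hp : IsStarProjection p) :
    IsStarProjection (p.map f) := by
  rw [isStarProjection_matrix_iff] at *
  constructor
  · rw [← Matrix.map_mul, hp.1]
  · rw [← Matrix.conjTranspose_map _ (map_star f), hp.2]

theorem MvN.map (f : C →⋆ₐ[ℂ] C') {p : Matrix ι ι C} {q : Matrix κ κ C} (h : MvN p q) :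
    MvN (p.map f) (q.map f) := by
  obtain ⟨v, h1, h2⟩ := h
  refine ⟨v.map f, ?_, ?_⟩
  · rw [← Matrix.conjTranspose_map _ (map_star f), ← Matrix.map_mul, h1]
  · rw [← Matrix.conjTranspose_map _ (map_star f), ← Matrix.map_mul, h2]

/-- The image of a projection under a `*`-homomorphism. -/
def Proj.map (f : C →⋆ₐ[ℂ] C') (p : Proj C) : Proj C' :=
  ⟨p.size, p.mat.map f, isStarProjection_map f p.isProj⟩

/-- `V` is functorial. -/
def V.map (f : C →⋆ₐ[ℂ] C') : V C →+ V C' where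
  toFun := Quotient.map (Proj.map f) fun _ _ h => MvN.map f h
  map_zero' := by
    refine Quotient.sound ⟨0, ?_, ?_⟩ <;> ext i <;> exact i.elim0
  map_add' := by
    rintro ⟨p⟩ ⟨q⟩
    refine congrArg V.mk ?_
    simp only [Proj.dsum, Proj.map, Proj.mk.injEq, heq_eq_eq, true_and]
    rw [← Matrix.submatrix_map, Matrix.fromBlocks_map]
    simp
    rfl

theorem V.map_mk (f : C →⋆ₐ[ℂ] C') (p : Proj C) : V.map f (V.mk p) = V.mk (p.map f) := rfl

theorem V.map_vcls (f : C →⋆ₐ[ℂ] C') {p : Matrix ι ι C} (hp : IsStarProjection p) :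
    V.map f (vcls p) = vcls (p.map f) := by
  rw [vcls_of_isStarProjection hp, vcls_of_isStarProjection (isStarProjection_map f hp),
    V.map_mk]
  rfl

theorem V.map_ecls (f : C →⋆ₐ[ℂ] C') {p : C} (hp : IsStarProjection p) :
    V.map f (ecls p) = ecls (f p) := by
  rw [ecls, V.map_vcls f (isStarProjection_of hp)]
  rfl

theorem V.map_map (g : C' →⋆ₐ[ℂ] C'') (f : C →⋆ₐ[ℂ] C') (x : V C) :
    V.map g (V.map f x) = V.map (g.comp f) x := by
  obtain ⟨n, p, hp, rfl⟩ := exists_vcls x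
  rw [V.map_vcls f hp, V.map_vcls g (isStarProjection_map f hp), V.map_vcls _ hp]
  rfl

theorem V.map_id (x : V C) : V.map (StarAlgHom.id ℂ C) x = x := by
  obtain ⟨n, p, hp, rfl⟩ := exists_vcls x
  rw [V.map_vcls _ hp]
  rfl

end Map

end KZero
end

/-! ### Matrix units and homomorphisms from direct sums of matrix algebras -/

noncomputable section

/-- The combinatorial data of a finite-dimensional C*-algebra: a finite set of blocks, and for
each block a finite index set with a base point. -/
structure BlockShape where
  Blk : Type
  Idx : Blk → Type
  base : ∀ c, Idx c
  [fintypeBlk : Fintype Blk]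
  [decEqBlk : DecidableEq Blk]
  [fintypeIdx : ∀ c, Fintype (Idx c)]
  [decEqIdx : ∀ c, DecidableEq (Idx c)]

namespace BlockShape

attribute [instance] fintypeBlk decEqBlk fintypeIdx decEqIdx

variable (S : BlockShape)

/-- The direct sum of the matrix algebras of a shape. -/
abbrev Alg : Type := ∀ c : S.Blk, Matrix (S.Idx c) (S.Idx c) ℂ

variable {S}

/-- The standard matrix units. -/
def e (c : S.Blk) (a b : S.Idx c) : S.Alg := Pi.single c (Matrix.single a b 1)

theorem e_mul_e (c : S.Blk) (a b d : S.Idx c) : e c a b * e c b d = e c a d := by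
  rw [e, e, ← Pi.single_mul, Matrix.single_mul_single_same, one_mul, e]

theorem e_mul_e_of_ne (c : S.Blk) (a b b' d : S.Idx c) (h : b ≠ b') : e c a b * e c b' d = 0 := by
  rw [e, e, ← Pi.single_mul, Matrix.single_mul_single_of_ne _ _ _ _ h, Pi.single_zero]

theorem e_mul_e_of_blk_ne {c c' : S.Blk} (h : c ≠ c') (a b : S.Idx c) (a' b' : S.Idx c') :
    e c a b * e c' a' b' = 0 := by
  funext k
  by_cases hk : k = c
  · subst hk
    simp [e, h]
  · simp [e, hk]

theorem star_e (c : S.Blk) (a b : S.Idx c) : star (e c a b) = e c b a := by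
  funext k
  by_cases hk : k = c
  · subst hk
    simp [e, Matrix.star_eq_conjTranspose]
  · simp [e, hk]

theorem sum_smul_e (z : S.Alg) : ∑ c, ∑ a, ∑ b, z c a b • e c a b = z := by
  funext k
  ext i j
  rw [Finset.sum_apply, Matrix.sum_apply, Finset.sum_eq_single k]
  · simp only [Finset.sum_apply, Matrix.sum_apply, Pi.smul_apply, Matrix.smul_apply, e,
      Pi.single_eq_same, Matrix.single_apply]
    rw [Finset.sum_eq_single i, Finset.sum_eq_single j] <;> simp +contextual
  · intro c _ hc
    simp [Finset.sum_apply, Matrix.sum_apply, e, hc.symm]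
  · simp

theorem sum_e : ∑ c, ∑ a, e c a a = (1 : S.Alg) := by
  rw [← sum_smul_e (1 : S.Alg)]
  simp [Matrix.one_apply]

theorem isStarProjection_e (c : S.Blk) (a : S.Idx c) : IsStarProjection (e c a a) :=
  isStarProjection_iff'.2 ⟨e_mul_e c a a a, star_e c a a⟩

/-- A system of matrix units of shape `S` in a `*`-ring. -/
structure Units (S : BlockShape) (C : Type*) [Ring C] [StarRing C] where
  E : ∀ c, S.Idx c → S.Idx c → C
  mul_same : ∀ c a b d, E c a b * E c b d = E c a d
  mul_ne : ∀ c a b b' d, b ≠ b' → E c a b * E c b' d = 0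
  mul_blk_ne : ∀ c c', c ≠ c' → ∀ a b a' b', E c a b * E c' a' b' = 0
  star_eq : ∀ c a b, star (E c a b) = E c b a
  sum_eq_one : ∑ c, ∑ a, E c a a = 1

namespace Units

variable {C : Type*} [Ring C] [StarRing C] [Algebra ℂ C] (U : S.Units C)

/-- The linear map determined by a system of matrix units. -/
def lin (z : S.Alg) : C := ∑ c, ∑ a, ∑ b, z c a b • U.E c a b

theorem E_mul_lin (c : S.Blk) (a b : S.Idx c) (z : S.Alg) :
    U.E c a b * U.lin z = ∑ d, z c b d • U.E c a d := by
  simp only [lin, Finset.mul_sum, mul_smul_comm]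
  rw [Finset.sum_eq_single c, Finset.sum_eq_single b]
  · simp only [U.mul_same]
  · intro b' _ hb
    simp [U.mul_ne c a b b' _ hb.symm]
  · simp
  · intro c' _ hc
    simp [U.mul_blk_ne c c' hc.symm]
  · simp

theorem lin_mul (z w : S.Alg) : U.lin (z * w) = U.lin z * U.lin w := by
  conv_rhs => rw [lin]
  simp only [Finset.sum_mul, smul_mul_assoc, E_mul_lin]
  rw [lin]
  refine Finset.sum_congr rfl fun c _ => Finset.sum_congr rfl fun a _ => ?_
  simp only [Finset.smul_sum, smul_smul, Pi.mul_apply, Matrix.mul_apply, Finset.sum_smul]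
  rw [Finset.sum_comm]

theorem lin_add (z w : S.Alg) : U.lin (z + w) = U.lin z + U.lin w := by
  simp [lin, add_smul, Finset.sum_add_distrib]

theorem lin_smul (r : ℂ) (z : S.Alg) : U.lin (r • z) = r • U.lin z := by
  simp [lin, mul_smul, Finset.smul_sum]

theorem lin_one : U.lin 1 = 1 := by
  rw [← U.sum_eq_one]
  simp [lin, Matrix.one_apply]

theorem lin_star [StarModule ℂ C] (z : S.Alg) : U.lin (star z) = star (U.lin z) := by
  simp only [lin, star_sum, star_smul, U.star_eq, Pi.star_apply, Matrix.star_apply]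
  exact Finset.sum_congr rfl fun c _ => Finset.sum_comm

/-- The `*`-homomorphism determined by a system of matrix units. -/
def toHom [StarModule ℂ C] : S.Alg →⋆ₐ[ℂ] C where
  toFun := U.lin
  map_one' := U.lin_one
  map_mul' := U.lin_mul
  map_zero' := by simp [lin]
  map_add' := U.lin_add
  commutes' r := by
    rw [Algebra.algebraMap_eq_smul_one, U.lin_smul, U.lin_one, Algebra.algebraMap_eq_smul_one]
  map_star' := U.lin_star

theorem toHom_e [StarModule ℂ C] (c : S.Blk) (a b : S.Idx c) : U.toHom (e c a b) = U.E c a b := by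
  change U.lin _ = _
  rw [lin, Finset.sum_eq_single c, Finset.sum_eq_single a, Finset.sum_eq_single b]
  · simp [e]
  · intro b' _ hb
    simp [e, hb.symm]
  · simp
  · intro a' _ ha
    simp [e, ha.symm]
  · simp
  · intro c' _ hc
    simp [e, hc]
  · simp

end Units

open KZero

variable {C : Type*} [Ring C] [StarRing C] [Algebra ℂ C]

/-- The existence half of the classification of homomorphisms. The relation splits `1` into
orthogonal projections, `card (Idx c)` of them equivalent to a representative of `h c`; composing
the implementing partial isometries gives matrix units. -/
theorem exists_hom_of_sum_eq [StarModule ℂ C] (h : S.Blk → V C)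
    (hs : ∑ c, Fintype.card (S.Idx c) • h c = ecls 1) :
    ∃ φ : S.Alg →⋆ₐ[ℂ] C, ∀ c, ecls (φ (e c (S.base c) (S.base c))) = h c := by
  choose n p hp hpc using fun c => exists_vcls (h c)
  have h1 : ecls (1 : C) = ∑ s : (Σ c, S.Idx c), vcls (p s.1) := by
    rw [← hs, Fintype.sum_sigma]
    refine Finset.sum_congr rfl fun c _ => ?_
    simp [hpc]
  obtain ⟨x, hx1, hx2, hx3, hx4⟩ := exists_decomposition
    (isStarProjection_of (.one C)) (fun s : (Σ c, S.Idx c) => hp s.1) h1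
  have hpp : ∀ c, p c * p c = p c ∧ (p c)ᴴ = p c := fun c => isStarProjection_matrix_iff.1 (hp c)
  -- Since `1` is viewed as a `1 × 1` matrix, each `x ⟨c, a⟩` has one row, and the products `x x*`
  -- are `1 × 1`: their only entry is the matrix unit.
  let U : S.Units C :=
    { E := fun c a b => (x ⟨c, a⟩ * (x ⟨c, b⟩)ᴴ) 0 0
      mul_same := by
        intro c a b d
        have : x ⟨c, a⟩ * (x ⟨c, b⟩)ᴴ * (x ⟨c, b⟩ * (x ⟨c, d⟩)ᴴ) = x ⟨c, a⟩ * (x ⟨c, d⟩)ᴴ := by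
          rw [Matrix.mul_assoc, ← Matrix.mul_assoc (x ⟨c, b⟩)ᴴ, hx1 ⟨c, b⟩, ← Matrix.mul_assoc,
            hx2 ⟨c, a⟩]
        have := congrFun (congrFun this 0) 0
        rwa [Matrix.mul_apply, Fin.sum_univ_one] at this
      mul_ne := by
        intro c a b b' d hb
        have : x ⟨c, a⟩ * (x ⟨c, b⟩)ᴴ * (x ⟨c, b'⟩ * (x ⟨c, d⟩)ᴴ) = 0 := by
          rw [Matrix.mul_assoc, ← Matrix.mul_assoc (x ⟨c, b⟩)ᴴ,
            hx3 ⟨c, b⟩ ⟨c, b'⟩ (by simpa using hb)]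
          simp
        have := congrFun (congrFun this 0) 0
        rwa [Matrix.mul_apply, Fin.sum_univ_one] at this
      mul_blk_ne := by
        intro c c' hc a b a' b'
        have : x ⟨c, a⟩ * (x ⟨c, b⟩)ᴴ * (x ⟨c', a'⟩ * (x ⟨c', b'⟩)ᴴ) = 0 := by
          rw [Matrix.mul_assoc, ← Matrix.mul_assoc (x ⟨c, b⟩)ᴴ,
            hx3 ⟨c, b⟩ ⟨c', a'⟩ (fun h => hc (congrArg Sigma.fst h))]
          simp
        have := congrFun (congrFun this 0) 0
        rwa [Matrix.mul_apply, Fin.sum_univ_one] at this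
      star_eq := by
        intro c a b
        rw [← Matrix.conjTranspose_apply, Matrix.conjTranspose_mul,
          Matrix.conjTranspose_conjTranspose]
      sum_eq_one := by
        have := congrFun (congrFun hx4 0) 0
        rw [Matrix.sum_apply, Fintype.sum_sigma] at this
        exact this }
  refine ⟨U.toHom, fun c => ?_⟩
  rw [U.toHom_e, ← hpc c, ← vcls_mul_conjTranspose (hp c) (hx1 ⟨c, S.base c⟩) (hx2 ⟨c, S.base c⟩),
    ecls]
  congr 1
  ext i j
  rw [Subsingleton.elim i 0, Subsingleton.elim j 0]
  rfl

/-- The intertwiner of `ψ` and `φ` built from elements `w c` that intertwine the base points. -/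
def intertwiner (φ ψ : S.Alg →⋆ₐ[ℂ] C) (w : S.Blk → C) : C :=
  ∑ s : (Σ c, S.Idx c), φ (e s.1 s.2 (S.base s.1)) * w s.1 * ψ (e s.1 (S.base s.1) s.2)

theorem star_intertwiner (φ ψ : S.Alg →⋆ₐ[ℂ] C) (w : S.Blk → C) :
    star (intertwiner φ ψ w) = intertwiner ψ φ fun c => star (w c) := by
  simp only [intertwiner, star_sum, star_mul, ← map_star, star_e, mul_assoc]

/-- Orthogonality of the matrix units kills the cross terms. Each diagonal term collapses to `φ (e c
a a)`, and these add up to `φ 1`. -/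
theorem intertwiner_mul_star (φ ψ : S.Alg →⋆ₐ[ℂ] C) (w : S.Blk → C)
    (h1 : ∀ c, w c * star (w c) = φ (e c (S.base c) (S.base c)))
    (h2 : ∀ c, star (w c) * w c = ψ (e c (S.base c) (S.base c))) :
    intertwiner φ ψ w * star (intertwiner φ ψ w) = 1 := by
  rw [star_intertwiner, intertwiner, intertwiner, Finset.sum_mul_sum]
  have key : ∀ s t : (Σ c, S.Idx c),
      φ (e s.1 s.2 (S.base s.1)) * w s.1 * ψ (e s.1 (S.base s.1) s.2) *
        (ψ (e t.1 t.2 (S.base t.1)) * star (w t.1) * φ (e t.1 (S.base t.1) t.2)) =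
      if s = t then φ (e s.1 s.2 s.2) else 0 := by
    rintro ⟨c, a⟩ ⟨c', a'⟩
    have h3 : ∀ x y z u v t : C, x * y * z * (u * v * t) = x * y * (z * u) * v * t := by
      intros; noncomm_ring
    rw [h3, ← map_mul]
    split_ifs with h
    · obtain ⟨rfl, h⟩ := Sigma.mk.inj_iff.1 h
      obtain rfl := eq_of_heq h
      dsimp only
      have h4 : ∀ x y v v' : C, x * v * (v' * v) * v' * y = x * (v * v') * (v * v') * y := by
        intros; noncomm_ring
      rw [e_mul_e, ← h2, h4, h1, ← map_mul, ← map_mul, ← map_mul, e_mul_e, e_mul_e, e_mul_e]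
    · by_cases hc : c = c'
      · subst hc
        dsimp only
        rw [e_mul_e_of_ne _ _ _ _ _ (by rintro rfl; exact h rfl)]
        simp
      · dsimp only
        rw [e_mul_e_of_blk_ne hc]
        simp
  simp only [key, Finset.sum_ite_eq, Finset.mem_univ, if_true]
  rw [Fintype.sum_sigma]
  simp only [← map_sum]
  rw [sum_e, map_one]

theorem intertwiner_mul_map (φ ψ : S.Alg →⋆ₐ[ℂ] C) (w : S.Blk → C) (z : S.Alg) :
    intertwiner φ ψ w * ψ z = φ z * intertwiner φ ψ w := by
  have key : ∀ c a b, intertwiner φ ψ w * ψ (e c a b) = φ (e c a b) * intertwiner φ ψ w := by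
    intro c a b
    rw [intertwiner, Finset.sum_mul, Finset.mul_sum, Finset.sum_eq_single ⟨c, a⟩,
      Finset.sum_eq_single ⟨c, b⟩]
    · dsimp only
      rw [mul_assoc, ← map_mul, e_mul_e, ← mul_assoc, ← mul_assoc, ← map_mul, e_mul_e]
    · rintro ⟨c', a'⟩ - h
      rw [← mul_assoc, ← mul_assoc, ← map_mul]
      by_cases hc : c' = c
      · subst hc
        rw [e_mul_e_of_ne _ _ _ _ _ (by rintro rfl; exact h rfl)]
        simp
      · rw [e_mul_e_of_blk_ne (Ne.symm hc)]
        simp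
    · simp
    · rintro ⟨c', a'⟩ - h
      rw [mul_assoc, ← map_mul]
      by_cases hc : c' = c
      · subst hc
        rw [e_mul_e_of_ne _ _ _ _ _ (by rintro rfl; exact h rfl)]
        simp
      · rw [e_mul_e_of_blk_ne hc]
        simp
    · simp
  rw [← sum_smul_e z]
  simp only [map_sum, map_smul, Finset.mul_sum, Finset.sum_mul, mul_smul_comm, smul_mul_assoc, key]

/-- Two homomorphisms with the same effect on `V` are unitarily equivalent. -/
theorem exists_unitary_of_ecls_eq (φ ψ : S.Alg →⋆ₐ[ℂ] C)
    (h : ∀ c, ecls (φ (e c (S.base c) (S.base c))) = ecls (ψ (e c (S.base c) (S.base c)))) :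
    ∃ u ∈ unitary C, ∀ z, u * ψ z * star u = φ z := by
  have h' := fun c => (ecls_eq_iff ((isStarProjection_e c (S.base c)).map φ)
    ((isStarProjection_e c (S.base c)).map ψ)).1 (h c)
  choose w h1 h2 using h'
  have hu := intertwiner_mul_star φ ψ w h1 h2
  refine ⟨intertwiner φ ψ w, ⟨?_, hu⟩, fun z => ?_⟩
  -- The adjoint is the intertwiner with `φ` and `ψ` exchanged, so the same computation gives the
  -- other unitarity relation.
  · have := intertwiner_mul_star ψ φ (fun c => star (w c)) (by simpa using h2) (by simpa using h1)
    rwa [← star_intertwiner, star_star] at this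
  · rw [intertwiner_mul_map, mul_assoc, hu, mul_one]

end BlockShape
end

/-! ### The monoid `V` of a direct sum of matrix algebras -/

noncomputable section

/-- A projection has eigenvalues `0` and `1`; `v` consists of the columns of a diagonalizing unitary
with eigenvalue `1`. -/
theorem exists_isometry_of_isStarProjection {n : Type*} [Fintype n]
    {p : Matrix n n ℂ} (hp : IsStarProjection p) :
    ∃ (m : ℕ) (v : Matrix n (Fin m) ℂ), v * vᴴ = p ∧ vᴴ * v = 1 := by
  classical
  have hp' := KZero.isStarProjection_matrix_iff.1 hp
  have hH : p.IsHermitian := hp'.2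
  set U : Matrix n n ℂ := (hH.eigenvectorUnitary : Matrix n n ℂ) with hU
  set l : n → ℂ := (RCLike.ofReal ∘ hH.eigenvalues : n → ℂ) with hl
  have hUU : Uᴴ * U = 1 := Unitary.coe_star_mul_self hH.eigenvectorUnitary
  have hs : p = U * Matrix.diagonal l * Uᴴ := by
    conv_lhs => rw [hH.spectral_theorem]
    rw [Unitary.conjStarAlgAut_apply]
    rfl
  have hd : Matrix.diagonal l = Uᴴ * p * U := by
    rw [hs]
    have : Uᴴ * (U * Matrix.diagonal l * Uᴴ) * U = (Uᴴ * U) * Matrix.diagonal l * (Uᴴ * U) := by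
      noncomm_ring
    rw [this, hUU, one_mul, mul_one]
  have hUU' : U * Uᴴ = 1 := Unitary.coe_mul_star_self hH.eigenvectorUnitary
  have hdd : Matrix.diagonal l * Matrix.diagonal l = Matrix.diagonal l := by
    rw [hd]
    have : Uᴴ * p * U * (Uᴴ * p * U) = Uᴴ * (p * (U * Uᴴ) * p) * U := by noncomm_ring
    rw [this, hUU', mul_one, hp'.1]
  have hll : ∀ i, l i = 0 ∨ l i = 1 := by
    intro i
    rw [Matrix.diagonal_mul_diagonal] at hdd
    have := congrFun (Matrix.diagonal_injective hdd) i
    have h2 : l i * (l i - 1) = 0 := by linear_combination this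
    rcases mul_eq_zero.1 h2 with h | h
    · exact Or.inl h
    · exact Or.inr (by linear_combination h)
  let f : Fin (Fintype.card {i // l i = 1}) ≃ {i // l i = 1} := (Fintype.equivFin _).symm
  refine ⟨_, U.submatrix id (fun j => (f j).1), ?_, ?_⟩
  · ext i j
    rw [hs, Matrix.mul_apply, Matrix.mul_apply]
    simp only [Matrix.mul_diagonal, Matrix.conjTranspose_apply, Matrix.submatrix_apply, id]
    rw [f.sum_comp (fun k => U i k.1 * star (U j k.1))]
    rw [← Finset.sum_subtype (Finset.univ.filter fun k => l k = 1) (by simp)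
      (fun k => U i k * star (U j k)), Finset.sum_filter]
    refine Finset.sum_congr rfl fun k _ => ?_
    rcases hll k with h | h <;> simp [h]
  · rw [Matrix.conjTranspose_submatrix]
    rw [← Matrix.submatrix_mul _ _ _ id _ Function.bijective_id, hUU]
    ext i j
    simp [Matrix.one_apply, Subtype.coe_inj]

namespace BlockShape

open KZero

variable {S : BlockShape} {ι κ μ : Type*}

/-- The `c`-th block of a matrix over `S.Alg`, as a complex matrix. -/
def flat (c : S.Blk) (M : Matrix ι κ S.Alg) : Matrix (ι × S.Idx c) (κ × S.Idx c) ℂ :=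
  Matrix.of fun p q => M p.1 q.1 c p.2 q.2

theorem flat_apply (c : S.Blk) (M : Matrix ι κ S.Alg) (p : ι × S.Idx c) (q : κ × S.Idx c) :
    flat c M p q = M p.1 q.1 c p.2 q.2 := rfl

theorem flat_mul [Fintype κ] (c : S.Blk) (M : Matrix ι κ S.Alg) (N : Matrix κ μ S.Alg) :
    flat c (M * N) = flat c M * flat c N := by
  ext p q
  rw [flat_apply, Matrix.mul_apply, Matrix.mul_apply, Fintype.sum_prod_type, Finset.sum_apply,
    Matrix.sum_apply]
  refine Finset.sum_congr rfl fun k _ => ?_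
  rw [Pi.mul_apply, Matrix.mul_apply]
  rfl

theorem flat_conjTranspose (c : S.Blk) (M : Matrix ι κ S.Alg) : flat c Mᴴ = (flat c M)ᴴ := rfl

variable [Fintype ι]

theorem isStarProjection_flat (c : S.Blk) {p : Matrix ι ι S.Alg} (hp : IsStarProjection p) :
    IsStarProjection (flat c p) := by
  rw [isStarProjection_matrix_iff] at *
  rw [← flat_mul, ← flat_conjTranspose, hp.1, hp.2]
  exact ⟨rfl, rfl⟩

/-- The element of `S.Alg` concentrated in the base column of the block `c`. -/
def col (c : S.Blk) (f : S.Idx c → ℂ) : S.Alg :=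
  Pi.single c (Matrix.of fun a b => if b = S.base c then f a else 0)

theorem star_col (c : S.Blk) (f : S.Idx c → ℂ) :
    star (col c f) = Pi.single c (Matrix.of fun a b => if a = S.base c then star (f b) else 0) := by
  rw [col, Pi.star_single]
  congr 1
  ext a b
  simp only [Matrix.star_apply, Matrix.of_apply]
  split_ifs <;> simp

theorem star_col_mul_col (c : S.Blk) (f g : S.Idx c → ℂ) :
    star (col c f) * col c g = (∑ a, star (f a) * g a) • e c (S.base c) (S.base c) := by
  rw [star_col, col, ← Pi.single_mul, e, ← Pi.single_smul]
  congr 1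
  ext a b
  simp only [Matrix.mul_apply, Matrix.of_apply, Matrix.smul_apply, Matrix.single_apply]
  by_cases ha : a = S.base c <;> by_cases hb : b = S.base c <;> 
    simp [ha, hb, eq_comm (a := S.base c)]

theorem col_mul_star_col (c : S.Blk) (f g : S.Idx c → ℂ) :
    col c f * star (col c g) = Pi.single c (Matrix.of fun a b => f a * star (g b)) := by
  rw [star_col, col, ← Pi.single_mul]
  congr 1
  ext a b
  simp [Matrix.mul_apply]

theorem star_col_mul_col_of_ne {c c' : S.Blk} (h : c ≠ c') (f : S.Idx c → ℂ)
    (g : S.Idx c' → ℂ) : star (col c f) * col c' g = 0 := by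
  rw [star_col, col]
  funext k
  by_cases hk : k = c
  · subst hk
    simp [h]
  · simp [hk]

theorem col_mul_e (c : S.Blk) (f : S.Idx c → ℂ) :
    col c f * e c (S.base c) (S.base c) = col c f := by
  rw [col, e, ← Pi.single_mul]
  congr 1
  ext a b
  by_cases hb : b = S.base c <;> simp [Matrix.mul_apply, Matrix.single_apply, hb,
    eq_comm (a := S.base c)]

/-- Each block of `p`, flattened to a complex matrix, is `v v*` for an isometry `v` with `m c`
columns. A column placed in the base column of block `c` is a partial isometry with source `e c base
base`, and the range projections of all of them add up to `p`. -/
theorem vcls_eq_sum_ecls_e {p : Matrix ι ι S.Alg}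
    (hp : IsStarProjection p) :
    ∃ m : S.Blk → ℕ, vcls p = ∑ c, m c • ecls (e c (S.base c) (S.base c)) := by
  classical
  choose m v hv1 hv2 using fun c =>
    exists_isometry_of_isStarProjection (isStarProjection_flat c hp)
  refine ⟨m, ?_⟩
  let x : ∀ _ : (Σ c, Fin (m c)), Matrix ι (Fin 1) S.Alg := fun s =>
    Matrix.of fun k _ => col s.1 fun a => v s.1 (k, a) s.2
  let q : ∀ _ : (Σ c, Fin (m c)), Matrix (Fin 1) (Fin 1) S.Alg := fun s =>
    Matrix.of fun _ _ => e s.1 (S.base s.1) (S.base s.1)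
  have hq : ∀ s, IsStarProjection (q s) := fun s => isStarProjection_of (isStarProjection_e _ _)
  have hx0 : ∀ (c : S.Blk) (i j : Fin (m c)), (x ⟨c, i⟩)ᴴ * x ⟨c, j⟩ =
      if i = j then q ⟨c, i⟩ else 0 := by
    intro c i j
    have h := congrFun (congrFun (hv2 c) i) j
    rw [Matrix.mul_apply, Fintype.sum_prod_type] at h
    refine Matrix.ext fun a b => ?_
    rw [Matrix.mul_apply]
    simp only [Matrix.conjTranspose_apply, x, Matrix.of_apply, star_col_mul_col]
    rw [← Finset.sum_smul]
    simp only [Matrix.conjTranspose_apply] at h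
    rw [h, Matrix.one_apply]
    split_ifs <;> simp [q]
  have hx1 : ∀ s, (x s)ᴴ * x s = q s := fun s => by
    obtain ⟨c, i⟩ := s
    rw [hx0, if_pos rfl]
  have hx3 : ∀ s t, s ≠ t → (x s)ᴴ * x t = 0 := by
    rintro ⟨c, i⟩ ⟨c', j⟩ h
    by_cases hc : c = c'
    · subst hc
      rw [hx0, if_neg]
      rintro rfl
      exact h rfl
    · refine Matrix.ext fun a b => ?_
      rw [Matrix.mul_apply, Matrix.zero_apply]
      exact Finset.sum_eq_zero fun k _ => star_col_mul_col_of_ne hc _ _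
  have hx2 : ∀ s, x s * q s = x s := by
    intro s
    refine Matrix.ext fun k a => ?_
    rw [Matrix.mul_apply, Fin.sum_univ_one]
    exact col_mul_e _ _
  have hsum : ∑ s, x s * (x s)ᴴ = p := by
    refine Matrix.ext fun k l => ?_
    rw [Matrix.sum_apply]
    simp only [Matrix.mul_apply, Fin.sum_univ_one, Matrix.conjTranspose_apply, x, Matrix.of_apply,
      col_mul_star_col]
    rw [Fintype.sum_sigma]
    funext d
    ext a b
    have h := congrFun (congrFun (hv1 d) (k, a)) (l, b)
    rw [Matrix.mul_apply, flat_apply] at h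
    rw [← h, Finset.sum_apply, Matrix.sum_apply, Finset.sum_eq_single d]
    · simp [Finset.sum_apply, Matrix.sum_apply]
    · intro c _ hc
      simp [Finset.sum_apply, hc.symm]
    · simp
  rw [← hsum, (isStarProjection_sum_and_vcls_sum Finset.univ hq hx1 hx2 hx3).2,
    Fintype.sum_sigma]
  refine Finset.sum_congr rfl fun c _ => ?_
  simp only [q, ← ecls.eq_1, Finset.sum_const, Finset.card_univ, Fintype.card_fin]

theorem trace_flat (c : S.Blk) (p : Matrix ι ι S.Alg) :
    (flat c p).trace = ∑ i, (p i i c).trace := by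
  rw [Matrix.trace, Fintype.sum_prod_type]
  rfl

/-- The blockwise traces of the class of a projection. -/
def traceHom (S : BlockShape) : V S.Alg →+ (S.Blk → ℂ) where
  toFun := Quotient.lift (fun p c => (flat c p.mat).trace) (by
    rintro p q ⟨v, h1, h2⟩
    funext c
    rw [← h1, ← h2, flat_mul, flat_mul, Matrix.trace_mul_comm])
  map_zero' := by
    funext c
    change (flat c (Proj.zero S.Alg).mat).trace = 0
    rw [trace_flat]
    rfl
  map_add' := by
    rintro ⟨p⟩ ⟨q⟩
    funext c
    change (flat c (p.dsum q).mat).trace = (flat c p.mat).trace + (flat c q.mat).trace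
    rw [trace_flat, trace_flat, trace_flat]
    change ∑ i : Fin (p.size + q.size), _ = _
    rw [← finSumFinEquiv.sum_comp, Fintype.sum_sum_type]
    simp [Proj.dsum]

theorem traceHom_ecls (c d : S.Blk) :
    traceHom S (ecls (e c (S.base c) (S.base c))) d = if d = c then 1 else 0 := by
  obtain ⟨p, hp⟩ := (ecls (e c (S.base c) (S.base c))).exists_mk
  have h := (V.mk_eq_iff (p := ⟨1, _, isStarProjection_of (isStarProjection_e c (S.base c))⟩)).1
    ((vcls_mat _).symm.trans hp.symm)
  rw [← hp, ← V.mk_eq_iff.2 h]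
  change (flat d (Matrix.of fun (_ _ : Fin 1) => e c (S.base c) (S.base c))).trace = _
  rw [trace_flat, Fin.sum_univ_one, Matrix.of_apply, e]
  by_cases hd : d = c
  · subst hd
    simp
  · simp [hd]

theorem exists_eq_sum_ecls_e (x : V S.Alg) :
    ∃ m : S.Blk → ℕ, x = ∑ c, m c • ecls (e c (S.base c) (S.base c)) := by
  obtain ⟨n, p, hp, rfl⟩ := exists_vcls x
  exact vcls_eq_sum_ecls_e hp

theorem traceHom_sum (m : S.Blk → ℕ) (d : S.Blk) :
    traceHom S (∑ c, m c • ecls (e c (S.base c) (S.base c))) d = m d := by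
  simp [map_sum, traceHom_ecls]

/-- The minimal projections generate `V` and the traces read off their multiplicities, so `V` is the
free commutative monoid on the blocks. Being inside a group, it is cancellative. -/
theorem traceHom_injective : Function.Injective (traceHom S) := by
  intro x y h
  obtain ⟨m, rfl⟩ := exists_eq_sum_ecls_e x
  obtain ⟨m', rfl⟩ := exists_eq_sum_ecls_e y
  congr 1
  funext c
  have := congrFun h c
  rw [traceHom_sum, traceHom_sum] at this
  rw [Nat.cast_injective this]

theorem V_add_right_cancel {x y z : V S.Alg} (h : x + z = y + z) : x = y := by
  apply traceHom_injective
  have := congrArg (traceHom S) h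
  rw [map_add, map_add] at this
  exact add_right_cancel this

instance countable_V : Countable (V S.Alg) := by
  have : Function.Surjective fun m : S.Blk → ℕ =>
      (∑ c, m c • ecls (e c (S.base c) (S.base c)) : V S.Alg) := fun x => by
    obtain ⟨m, hm⟩ := exists_eq_sum_ecls_e x
    exact ⟨m, hm.symm⟩
  exact this.countable

end BlockShape
end

/-! ### Minimal projections and the structure of finite-dimensional C*-algebras -/

noncomputable section

section MinimalProjections

variable {E : Type*} [CStarAlgebra E]

/-- The spectrum consists of roots of the minimal polynomial. Every function is continuous on a
finite set, so the functional calculus applies to indicator functions. -/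
theorem finite_real_spectrum [FiniteDimensional ℂ E] (a : E) : (spectrum ℝ a).Finite := by
  have : FiniteDimensional ℝ E := FiniteDimensional.complexToReal E
  have hint : IsIntegral ℝ a := Algebra.IsIntegral.isIntegral a
  refine ((minpoly ℝ a).rootSet_finite ℝ).subset fun r hr => ?_
  rw [Polynomial.mem_rootSet]
  refine ⟨minpoly.ne_zero hint, ?_⟩
  have h := spectrum.subset_polynomial_aeval a (minpoly ℝ a) ⟨r, hr, rfl⟩
  rw [minpoly.aeval] at h
  rcases subsingleton_or_nontrivial E with hE | hE
  · simp at h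
  · rw [spectrum.zero_eq] at h
    simpa using h

theorem mul_eq_of_mul_star_eq {p v : E} (hp : IsStarProjection p) (h : v * star v = p) :
    p * v = v := by
  rw [isStarProjection_iff'] at hp
  rw [← sub_eq_zero, ← CStarRing.mul_star_self_eq_zero_iff]
  have : (p * v - v) * star (p * v - v) =
      p * (v * star v) * star p - p * (v * star v) - (v * star v) * star p + v * star v := by
    rw [star_sub, star_mul]; noncomm_ring
  rw [this, h, hp.2, hp.1, hp.1]
  simp

theorem mul_eq_of_star_mul_eq {p v : E} (hp : IsStarProjection p) (h : star v * v = p) :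
    v * p = v := by
  have := mul_eq_of_mul_star_eq hp (v := star v) (by rwa [star_star])
  have h2 := congrArg star this
  rwa [star_mul, star_star, hp.isSelfAdjoint.star_eq] at h2

/-- A projection is minimal if it is nonzero and has no proper nonzero subprojections. -/
def IsMinimalProjection (p : E) : Prop :=
  IsStarProjection p ∧ p ≠ 0 ∧ ∀ q, IsStarProjection q → p * q = q → q = 0 ∨ q = p

/-- The spectral projections `q r` of `a` commute with `p`, so each `p * q r` is `0` or `p`. They
sum to `p`, so some `p * q r` equals `p`, and on `q r` the element `a` acts as `r`. -/
theorem IsMinimalProjection.exists_smul_of_isSelfAdjoint [FiniteDimensional ℂ E] {p : E}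
    (hp : IsMinimalProjection p) {a : E} (ha : IsSelfAdjoint a) (hpa : p * a = a) :
    ∃ r : ℝ, a = r • p := by
  obtain ⟨hp1, hp0, hpm⟩ := hp
  have hpp := isStarProjection_iff'.1 hp1
  have hap : a * p = a := by
    have := congrArg star hpa
    rwa [star_mul, ha.star_eq, hpp.2] at this
  have hfin := finite_real_spectrum a
  have hcont : ∀ f : ℝ → ℝ, ContinuousOn f (spectrum ℝ a) := fun f => hfin.continuousOn f
  let χ : ℝ → ℝ → ℝ := fun r t => if t = r then 1 else 0
  let q : ℝ → E := fun r => cfc (χ r) a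
  have hcomm : ∀ r, Commute (q r) p := fun r =>
    Commute.cfc (show a * p = p * a by rw [hap, hpa])
      (show star a * p = p * star a by rw [ha.star_eq, hap, hpa]) _
  have hqq : ∀ r, IsStarProjection (q r) := by
    intro r
    refine ⟨?_, cfc_predicate _ _⟩
    change cfc (χ r) a * cfc (χ r) a = cfc (χ r) a
    rw [← cfc_mul _ _ a (hcont _) (hcont _)]
    congr 1
    funext t
    simp only [χ]
    split_ifs <;> simp
  have hqa : ∀ r, a * q r = r • q r := by
    intro r
    have h1 : a * q r = cfc (fun t : ℝ => t * χ r t) a := by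
      rw [cfc_mul _ _ a (hcont _) (hcont _), cfc_id' ℝ a]
    rw [h1, ← cfc_smul r _ a (hcont _)]
    congr 1
    funext t
    simp only [χ, smul_eq_mul]
    split_ifs with h
    · rw [h]
    · simp
  have hsum : ∑ r ∈ hfin.toFinset, q r = 1 := by
    rw [← cfc_sum _ _ _ (fun _ _ => hcont _), ← cfc_one ℝ a]
    refine cfc_congr fun t ht => ?_
    simp [χ, Finset.sum_apply, ht]
  have hpq : ∀ r, IsStarProjection (p * q r) := by
    intro r
    have h1 := isStarProjection_iff'.1 (hqq r)
    have h2 : q r * p = p * q r := hcomm r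
    rw [isStarProjection_iff']
    constructor
    · rw [mul_assoc, ← mul_assoc (q r), h2, mul_assoc, h1.1, ← mul_assoc, hpp.1]
    · rw [star_mul, h1.2, hpp.2, h2]
  by_contra! hne
  have hz : ∀ r, p * q r = 0 := by
    intro r
    rcases hpm _ (hpq r) (by rw [← mul_assoc, hpp.1]) with h | h
    · exact h
    · exfalso
      refine hne r ?_
      calc a = a * (p * q r) := by rw [h, hap]
        _ = p * (a * q r) := by rw [← mul_assoc, hap, ← mul_assoc, hpa]
        _ = r • (p * q r) := by rw [hqa, mul_smul_comm]
        _ = r • p := by rw [h]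
  apply hp0
  rw [← mul_one p, ← hsum, Finset.mul_sum]
  exact Finset.sum_eq_zero fun r _ => hz r

theorem IsMinimalProjection.exists_smul [FiniteDimensional ℂ E] {p : E}
    (hp : IsMinimalProjection p) (x : E) : ∃ r : ℂ, p * x * p = r • p := by
  have hpp := isStarProjection_iff'.1 hp.1
  have key : ∀ a : E, IsSelfAdjoint a → ∃ r : ℝ, p * a * p = r • p := by
    intro a ha
    refine hp.exists_smul_of_isSelfAdjoint ?_ (by rw [← mul_assoc, ← mul_assoc, hpp.1])
    rw [isSelfAdjoint_iff, star_mul, star_mul, ha.star_eq, hpp.2, mul_assoc]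
  obtain ⟨r, hr⟩ := key _ (realPart x).2
  obtain ⟨s, hs⟩ := key _ (imaginaryPart x).2
  refine ⟨r + s * Complex.I, ?_⟩
  conv_lhs => rw [← realPart_add_I_smul_imaginaryPart x]
  rw [mul_add, add_mul, mul_smul_comm, smul_mul_assoc, hr, hs, add_smul, mul_comm (s : ℂ),
    mul_smul, Complex.coe_smul, Complex.coe_smul]

/-- Minimal projections that are not disjoint are equivalent. -/
theorem IsMinimalProjection.exists_partialIsometry [FiniteDimensional ℂ E] {p q : E}
    (hp : IsMinimalProjection p) (hq : IsMinimalProjection q) {x : E} (hx : p * x * q ≠ 0) :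
    ∃ v : E, v * star v = p ∧ star v * v = q := by
  have hpp := isStarProjection_iff'.1 hp.1
  have hqq := isStarProjection_iff'.1 hq.1
  set y := p * x * q with hy
  have hys : star y = q * star x * p := by
    rw [hy, star_mul, star_mul, hpp.2, hqq.2, mul_assoc]
  obtain ⟨c, hc⟩ : ∃ c : ℂ, y * star y = c • p := by
    obtain ⟨c, hc⟩ := hp.exists_smul (x * q * q * star x)
    refine ⟨c, ?_⟩
    rw [← hc, hys, hy]
    noncomm_ring
  obtain ⟨d, hd⟩ : ∃ d : ℂ, star y * y = d • q := by
    obtain ⟨d, hd⟩ := hq.exists_smul (star x * p * p * x)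
    refine ⟨d, ?_⟩
    rw [← hd, hys, hy]
    noncomm_ring
  have hpy : p * y = y := by rw [hy, ← mul_assoc, ← mul_assoc, hpp.1]
  have hyq : y * q = y := by rw [hy, mul_assoc, hqq.1]
  -- Evaluate `y y* y` in two ways.
  have hcd : c = d := by
    have h1 : y * star y * y = c • y := by rw [hc, smul_mul_assoc, hpy]
    have h2 : y * star y * y = d • y := by rw [mul_assoc, hd, mul_smul_comm, hyq]
    exact smul_left_injective ℂ hx (h1.symm.trans h2)
  subst hcd
  have hc0 : c ≠ 0 := by
    rintro rfl
    rw [zero_smul, CStarRing.mul_star_self_eq_zero_iff] at hc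
    exact hx hc
  obtain ⟨r, rfl⟩ : ∃ r : ℝ, c = r := by
    have h1 := congrArg star hc
    rw [star_mul, star_star, hc, star_smul, hpp.2] at h1
    have h2 : c = star c := smul_left_injective ℂ hp.2.1 h1
    exact ⟨c.re, (Complex.conj_eq_iff_re.1 h2.symm).symm⟩
  -- As `y* y = r q` with `q ≠ 0`, the element `r - y* y` annihilates `q`, so `r` is in the spectrum
  -- of `y* y`. Dividing `y` by `√r` then gives the partial isometry.
  have hr : 0 ≤ r := by
    apply spectrum_star_mul_self_nonneg (b := y)
    rw [hd, spectrum.mem_iff]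
    intro hu
    apply hq.2.1
    rw [← hu.mul_right_eq_zero, sub_mul, smul_mul_assoc, hqq.1, Algebra.algebraMap_eq_smul_one,
      smul_mul_assoc, one_mul, Complex.coe_smul, sub_self]
  have hr0 : r ≠ 0 := by rintro rfl; exact hc0 rfl
  have hrr : ((√r)⁻¹ : ℝ) * (√r)⁻¹ * r = 1 := by
    rw [← mul_inv, Real.mul_self_sqrt hr, inv_mul_cancel₀ hr0]
  refine ⟨(√r)⁻¹ • y, ?_, ?_⟩
  · rw [star_smul, star_trivial, smul_mul_smul_comm, hc, Complex.coe_smul, smul_smul, hrr,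
      one_smul]
  · rw [star_smul, star_trivial, smul_mul_smul_comm, hd, Complex.coe_smul, smul_smul, hrr,
      one_smul]

/-- Take a partition of `1` into non-zero orthogonal projections of maximal length. The length is
bounded because such projections are linearly independent, and a member that is not minimal could be
split further. -/
theorem exists_minimalProjections (E : Type*) [CStarAlgebra E] [FiniteDimensional ℂ E] :
    ∃ (n : ℕ) (p : Fin n → E), (∀ i, IsMinimalProjection (p i)) ∧
      (∀ i j, i ≠ j → p i * p j = 0) ∧ ∑ i, p i = 1 := by
  let P : ℕ → Prop := fun n => ∃ p : Fin n → E, (∀ i, IsStarProjection (p i)) ∧ (∀ i, p i ≠ 0) ∧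
    (∀ i j, i ≠ j → p i * p j = 0) ∧ ∑ i, p i = 1
  have hbound : ∀ n, P n → n ≤ Module.finrank ℂ E := by
    rintro n ⟨p, hp, hp0, hpo, -⟩
    have hli : LinearIndependent ℂ p := by
      rw [Fintype.linearIndependent_iff]
      intro g hg i
      have := congrArg (fun x => p i * x) hg
      simp only [Finset.mul_sum, mul_smul_comm, mul_zero] at this
      rw [Finset.sum_eq_single i (fun j _ hj => by rw [hpo i j hj.symm, smul_zero]) (by simp),
        (hp i).isIdempotentElem.eq] at this
      exact (smul_eq_zero.1 this).resolve_right (hp0 i)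
    simpa using hli.fintype_card_le_finrank
  have hex : ∃ n, P n := by
    rcases subsingleton_or_nontrivial E with h | h
    · exact ⟨0, Fin.elim0, fun i => i.elim0, fun i => i.elim0, fun i => i.elim0,
        Subsingleton.elim _ _⟩
    · exact ⟨1, fun _ => 1, fun _ => .one E, fun _ => one_ne_zero,
        fun i j hij => absurd (Subsingleton.elim i j) hij, by simp⟩
  classical
  obtain ⟨n0, hn0⟩ := hex
  set n := Nat.findGreatest P (Module.finrank ℂ E) with hn
  obtain ⟨p, hp, hp0, hpo, hps⟩ : P n := Nat.findGreatest_spec (hbound _ hn0) hn0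
  refine ⟨n, p, fun i => ⟨hp i, hp0 i, fun q hq hpq => ?_⟩, hpo, hps⟩
  by_contra! hne
  have hqp : q * p i = q := by
    have := congrArg star hpq
    rwa [star_mul, hq.isSelfAdjoint.star_eq, (hp i).isSelfAdjoint.star_eq] at this
  have hsub : IsStarProjection (p i - q) := by
    rw [isStarProjection_iff']
    constructor
    · rw [sub_mul, mul_sub, mul_sub, hpq, hqp, (hp i).isIdempotentElem.eq, hq.isIdempotentElem.eq]
      simp
    · rw [star_sub, hq.isSelfAdjoint.star_eq, (hp i).isSelfAdjoint.star_eq]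
  have hsucc : P (n + 1) := by
    have hj : ∀ j, j ≠ i → p j * q = 0 ∧ q * p j = 0 := by
      intro j hj
      constructor
      · rw [← hpq, ← mul_assoc, hpo j i hj, zero_mul]
      · rw [← hqp, mul_assoc, hpo i j hj.symm, mul_zero]
    have hqs : q * (p i - q) = 0 := by rw [mul_sub, hqp, hq.isIdempotentElem.eq, sub_self]
    have hsq : (p i - q) * q = 0 := by rw [sub_mul, hpq, hq.isIdempotentElem.eq, sub_self]
    have h1 : ∀ j, (p i - q) * Function.update p i q j = 0 := by
      intro j
      by_cases h : j = i
      · subst h; simpa using hsq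
      · rw [Function.update_of_ne h, sub_mul, hpo i j (Ne.symm h), (hj j h).2, sub_self]
    have h2 : ∀ j, Function.update p i q j * (p i - q) = 0 := by
      intro j
      by_cases h : j = i
      · subst h; simpa using hqs
      · rw [Function.update_of_ne h, mul_sub, hpo j i h, (hj j h).1, sub_self]
    -- Split `p i`: it is replaced by `q`, and `p i - q` is put in front.
    refine ⟨Fin.cons (p i - q) (Function.update p i q), ?_, ?_, ?_, ?_⟩
    · refine Fin.cases hsub fun j => ?_
      by_cases h : j = i
      · subst h; simpa using hq
      · simpa [h] using hp j
    · refine Fin.cases ?_ fun j => ?_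
      · simpa [sub_eq_zero] using fun h => hne.2 h.symm
      · by_cases h : j = i
        · subst h; simpa using hne.1
        · simpa [h] using hp0 j
    · refine Fin.cases ?_ fun j => ?_
      · refine Fin.cases (fun h => absurd rfl h) fun k _ => ?_
        simpa using h1 k
      · refine Fin.cases (fun _ => ?_) fun k hk => ?_
        · simpa using h2 j
        · rw [Fin.cons_succ, Fin.cons_succ]
          have hjk : j ≠ k := fun h => hk (congrArg _ h)
          by_cases h : j = i
          · subst h
            rw [Function.update_self, Function.update_of_ne hjk.symm, (hj k hjk.symm).2]
          · by_cases h' : k = i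
            · subst h'
              rw [Function.update_self, Function.update_of_ne h, (hj j h).1]
            · rw [Function.update_of_ne h, Function.update_of_ne h', hpo j k hjk]
    · rw [Fin.sum_univ_succ]
      simp only [Fin.cons_zero, Fin.cons_succ]
      rw [Finset.sum_update_of_mem (Finset.mem_univ i), ← hps,
        ← Finset.add_sum_erase _ _ (Finset.mem_univ i), Finset.sdiff_singleton_eq_erase]
      abel
  have := Nat.le_findGreatest (hbound _ hsucc) hsucc
  omega

end MinimalProjections

/-- Structure of finite-dimensional C*-algebras. -/
theorem exists_blockShape_equiv (E : Type*) [CStarAlgebra E] [FiniteDimensional ℂ E] :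
    ∃ (S : BlockShape) (φ : S.Alg →⋆ₐ[ℂ] E), Function.Bijective φ := by
  classical
  obtain ⟨n, p, hp, hpo, hps⟩ := exists_minimalProjections E
  have hpp : ∀ i, p i * p i = p i ∧ star (p i) = p i := fun i => isStarProjection_iff'.1 (hp i).1
  -- The blocks are the equivalence classes of the minimal projections. The `u i` chosen below leads
  -- from the representative of the class to `p i`, so the `u i * star (u j)` within a class are
  -- matrix units.
  let R : Setoid (Fin n) :=
    { r := fun i j => ∃ v : E, v * star v = p i ∧ star v * v = p j
      iseqv :=
        { refl := fun i => ⟨p i, by rw [(hpp i).2, (hpp i).1], by rw [(hpp i).2, (hpp i).1]⟩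
          symm := by
            rintro i j ⟨v, h1, h2⟩
            exact ⟨star v, by rwa [star_star], by rwa [star_star]⟩
          trans := by
            rintro i j k ⟨v, h1, h2⟩ ⟨w, h3, h4⟩
            refine ⟨v * w, ?_, ?_⟩
            · rw [star_mul, mul_assoc, ← mul_assoc w, h3, ← mul_assoc,
                mul_eq_of_star_mul_eq (hp j).1 h2, h1]
            · rw [star_mul, mul_assoc, ← mul_assoc (star v), h2,
                mul_eq_of_mul_star_eq (hp j).1 h3, h4] } }
  have hR : ∀ i, ∃ v : E, v * star v = p i ∧ star v * v = p (Quotient.mk R i).out := fun i =>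
    R.symm (Quotient.mk_out (s := R) i)
  choose u hu1 hu2 using hR
  have hu3 : ∀ i, p i * u i = u i := fun i => mul_eq_of_mul_star_eq (hp i).1 (hu1 i)
  have hu4 : ∀ i, u i * p (Quotient.mk R i).out = u i := fun i =>
    mul_eq_of_star_mul_eq (hp _).1 (hu2 i)
  have hu5 : ∀ i, star (u i) * p i = star (u i) := fun i => by
    have := congrArg star (hu3 i)
    rwa [star_mul, (hpp i).2] at this
  have huo : ∀ i j, i ≠ j → star (u i) * u j = 0 := fun i j hij => by
    rw [← hu5 i, ← hu3 j, mul_assoc, ← mul_assoc (p i), hpo i j hij, zero_mul, mul_zero]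
  have huu : ∀ i j k l, Quotient.mk R j = Quotient.mk R i → j = k →
      u i * star (u j) * (u k * star (u l)) = u i * star (u l) := by
    rintro i j k l h rfl
    rw [mul_assoc, ← mul_assoc (star (u j)), hu2, ← mul_assoc, h, hu4]
  have huu0 : ∀ i j k l, j ≠ k → u i * star (u j) * (u k * star (u l)) = 0 := by
    intro i j k l h
    rw [mul_assoc, ← mul_assoc (star (u j)), huo j k h, zero_mul, mul_zero]
  let S : BlockShape :=
    { Blk := Quotient R
      Idx := fun c => {i : Fin n // Quotient.mk R i = c}
      base := fun c => ⟨c.out, Quotient.out_eq c⟩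
      fintypeBlk := inferInstanceAs (Fintype (Quotient R))
      decEqBlk := Classical.decEq _
      fintypeIdx := fun c => Fintype.ofFinite _
      decEqIdx := fun c => Classical.decEq _ }
  have hsum : ∑ c : S.Blk, ∑ a : S.Idx c, u a.1 * star (u a.1) = 1 := by
    let f : (Σ c : S.Blk, S.Idx c) ≃ Fin n := Equiv.sigmaFiberEquiv (Quotient.mk R)
    rw [← hps, ← f.sum_comp, Fintype.sum_sigma]
    exact Fintype.sum_congr _ _ fun c => Fintype.sum_congr _ _ fun a => hu1 a.1
  let U : S.Units E :=
    { E := fun c a b => u a.1 * star (u b.1)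
      mul_same := fun c a b d => huu _ _ _ _ (b.2.trans a.2.symm) rfl
      mul_ne := fun c a b b' d h => huu0 _ _ _ _ fun h' => h (Subtype.ext h')
      mul_blk_ne := fun c c' h a b a' b' => huu0 _ _ _ _ fun h' => h (by
        rw [← b.2, ← a'.2, h'])
      star_eq := fun c a b => by rw [star_mul, star_star]
      sum_eq_one := by convert hsum }
  refine ⟨S, U.toHom, ?_, ?_⟩
  · rw [injective_iff_map_eq_zero]
    intro z hz
    funext c
    ext a b
    -- Compressing by matrix units isolates the entry `z c a b`.
    have h1 : U.E c (S.base c) a * U.lin z * U.E c b (S.base c) = 0 := by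
      rw [show U.lin z = 0 from hz]; simp
    rw [U.E_mul_lin, Finset.sum_mul, Finset.sum_eq_single b] at h1
    · rw [smul_mul_assoc, U.mul_same] at h1
      refine (smul_eq_zero.1 h1).resolve_right ?_
      change u c.out * star (u c.out) ≠ 0
      rw [hu1]
      exact (hp _).2.1
    · intro d _ hd
      rw [smul_mul_assoc, U.mul_ne c _ _ _ _ hd, smul_zero]
    · simp
  · intro x
    have hx : x = ∑ i, ∑ j, p i * x * p j := by
      simp_rw [← Finset.mul_sum, hps, mul_one, ← Finset.sum_mul, hps, one_mul]
    -- A non-zero corner `p i * x * p j` forces `i` and `j` into one block. Multiplying it by `u j *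
    -- star (u i)` moves it into `p i E p i = ℂ p i`, so it is a multiple of a matrix unit.
    suffices h : ∀ i j, ∃ z, U.toHom z = p i * x * p j by
      choose z hz using h
      refine ⟨∑ i, ∑ j, z i j, ?_⟩
      simp only [map_sum, hz]
      exact hx.symm
    intro i j
    by_cases hne : p i * x * p j = 0
    · exact ⟨0, by rw [map_zero, hne]⟩
    · have hij : Quotient.mk R i = Quotient.mk R j :=
        Quotient.sound ((hp i).exists_partialIsometry (hp j) hne)
      obtain ⟨r, hr⟩ := (hp i).exists_smul (x * (u j * star (u i)))
      refine ⟨r • BlockShape.e (S := S) (Quotient.mk R j) ⟨i, hij⟩ ⟨j, rfl⟩, ?_⟩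
      refine (U.lin_smul r _).trans ?_
      rw [show U.lin _ = U.toHom _ from rfl, U.toHom_e]
      change r • (u i * star (u j)) = _
      have h1 : p i * (u i * star (u j)) = u i * star (u j) := by rw [← mul_assoc, hu3]
      rw [← h1, ← smul_mul_assoc, ← hr]
      have h2 : u j * star (u i) * p i * (u i * star (u j)) = p j := by
        rw [mul_assoc _ (p i), h1, huu _ _ _ _ hij rfl, hu1]
      calc p i * (x * (u j * star (u i))) * p i * (u i * star (u j))
          = p i * x * (u j * star (u i) * p i * (u i * star (u j))) := by noncomm_ring
        _ = p i * x * p j := by rw [h2]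
end

/-! ### Perturbation of projections, partial isometries and unitaries -/

noncomputable section

section Perturbation

variable {E : Type*} [CStarAlgebra E]

theorem isUnit_of_norm_sub_one_lt {y : E} (h : ‖y - 1‖ < 1) : IsUnit y := by
  rw [norm_sub_rev] at h
  have := (Units.oneSub (1 - y) h).isUnit
  rwa [Units.val_oneSub, sub_sub_cancel] at this

theorem abs_sub_one_le_of_mem_spectrum {y : E} (hy : IsSelfAdjoint y) {t : ℝ}
    (ht : t ∈ spectrum ℝ y) : |t - 1| ≤ ‖y - 1‖ := by
  have h := norm_apply_le_norm_cfc (fun t : ℝ => t - 1) y ht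
  rw [cfc_sub (fun t : ℝ => t) (fun _ => 1) y, cfc_id' ℝ y, cfc_const_one ℝ y] at h
  exact h

/-- The inverse square root of a self-adjoint element close to `1`. -/
theorem exists_inv_sqrt {y : E} (hy : IsSelfAdjoint y) (h : ‖y - 1‖ < 1) :
    ∃ c : E, IsSelfAdjoint c ∧ c * c * y = 1 ∧ (∀ z, Commute y z → Commute c z) ∧
      (‖y - 1‖ ≤ 1 / 2 → ‖c - 1‖ ≤ ‖y - 1‖) := by
  have hpos : ∀ t ∈ spectrum ℝ y, 0 < t := by
    intro t ht
    have := (abs_sub_one_le_of_mem_spectrum hy ht).trans_lt h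
    linarith [(abs_lt.1 this).1]
  have hc : ContinuousOn (fun t : ℝ => (√t)⁻¹) (spectrum ℝ y) :=
    Real.continuous_sqrt.continuousOn.inv₀ fun t ht => (Real.sqrt_pos.2 (hpos t ht)).ne'
  refine ⟨cfc (fun t : ℝ => (√t)⁻¹) y, cfc_predicate _ _, ?_, fun z hz => ?_, fun h2 => ?_⟩
  · conv_lhs => rw [← cfc_mul _ _ y hc hc]; rhs; rw [← cfc_id' ℝ y]
    rw [← cfc_mul (fun t : ℝ => (√t)⁻¹ * (√t)⁻¹) (fun t => t) y (hc.mul hc), ← cfc_one ℝ y]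
    refine cfc_congr fun t ht => ?_
    have := hpos t ht
    simp only [Pi.one_apply]
    rw [← mul_inv, Real.mul_self_sqrt this.le, inv_mul_cancel₀ this.ne']
  · exact Commute.cfc hz (by rwa [hy.star_eq]) _
  · rw [← cfc_const_one ℝ y, ← cfc_sub _ _ y hc, cfc_const_one ℝ y,
      norm_cfc_le_iff (fun t : ℝ => (√t)⁻¹ - 1) y (norm_nonneg _) (hc.sub continuousOn_const)]
    intro t ht
    have ht1 := abs_sub_one_le_of_mem_spectrum hy ht
    refine le_trans ?_ ht1
    have ht2 : (1 / 2 : ℝ) ≤ t := by linarith [(abs_le.1 (ht1.trans h2)).1]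
    have hs : (1 / 2 : ℝ) ≤ √t := Real.le_sqrt_of_sq_le (by linarith)
    have hss : √t * √t = t := Real.mul_self_sqrt (by linarith)
    -- The denominator is at least `1`, because `t` and `√t` are both at least `1/2`.
    have h3 : (√t)⁻¹ - 1 = -(t - 1) / (√t + t) := by
      have : √t + t ≠ 0 := by positivity
      field_simp
      nlinarith
    rw [Real.norm_eq_abs, h3, abs_div, abs_neg]
    refine div_le_self (abs_nonneg _) ?_
    rw [abs_of_nonneg (by positivity)]
    linarith

/-- Polar decomposition inside the corner: `y = x x* + (1 - p)` is near `1`, and `w = y^(-1/2) x`.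
-/
theorem exists_partialIsometry_of_approx {p q x : E} (hp : IsStarProjection p)
    (hq : IsStarProjection q) (hpx : p * x = x) (hxq : x * q = x)
    (h1 : ‖x * star x - p‖ < 1) (h2 : ‖star x * x - q‖ < 1) :
    ∃ w : E, w * star w = p ∧ star w * w = q := by
  have hpp := isStarProjection_iff'.1 hp
  have hqq := isStarProjection_iff'.1 hq
  have hxp : star x * p = star x := by
    have := congrArg star hpx
    rwa [star_mul, hpp.2] at this
  have hqx : q * star x = star x := by
    have := congrArg star hxq
    rwa [star_mul, hqq.2] at this
  set y := x * star x + (1 - p) with hy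
  have hysa : IsSelfAdjoint y := by
    rw [isSelfAdjoint_iff, hy, star_add, star_sub, star_mul, star_star, star_one, hpp.2]
  have hyp : y * p = x * star x := by
    rw [hy, add_mul, mul_assoc, hxp, sub_mul, one_mul, hpp.1, sub_self, add_zero]
  have hpy : p * y = x * star x := by
    rw [hy, mul_add, ← mul_assoc, hpx, mul_sub, mul_one, hpp.1, sub_self, add_zero]
  have hy1 : y - 1 = x * star x - p := by rw [hy]; abel
  obtain ⟨c, hc, hccy, hcomm, -⟩ := exists_inv_sqrt hysa (by rwa [hy1])
  have hcp : c * p = p * c := hcomm p (hyp.trans hpy.symm)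
  have hcy : c * y = y * c := hcomm y rfl
  have hsw : star (c * x) = star x * c := by rw [star_mul, hc.star_eq]
  have hww : star (c * x) * (c * x) = star x * (c * c) * x := by rw [hsw]; noncomm_ring
  refine ⟨c * x, ?_, ?_⟩
  · calc c * x * star (c * x) = c * (x * star x) * c := by rw [hsw]; noncomm_ring
      _ = c * (p * (y * c)) := by rw [← hpy]; noncomm_ring
      _ = (c * p) * (c * y) := by rw [← hcy]; noncomm_ring
      _ = p * (c * c * y) := by rw [hcp]; noncomm_ring
      _ = p := by rw [hccy, mul_one]
  -- Both `w* w` and `q` give `x* x` when multiplied by the invertible element `x* x + (1 - q)`.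
  · have hunit : IsUnit (star x * x + (1 - q)) := by
      apply isUnit_of_norm_sub_one_lt
      convert h2 using 2
      abel
    have e1 : star (c * x) * (c * x) * (star x * x) = star x * x := by
      calc star (c * x) * (c * x) * (star x * x) = star x * (c * c) * (x * star x) * x := by
            rw [hww]; noncomm_ring
        _ = star x * (c * c * y) * (p * x) := by rw [← hyp]; noncomm_ring
        _ = star x * x := by rw [hccy, mul_one, hpx]
    have e2 : star (c * x) * (c * x) * q = star (c * x) * (c * x) := by
      rw [mul_assoc, mul_assoc, hxq]
    have e3 : q * (star x * x) = star x * x := by rw [← mul_assoc, hqx]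
    refine hunit.mul_right_cancel ?_
    rw [mul_add, mul_add, e1, e3, mul_sub, mul_sub, e2, mul_one, mul_one, hqq.1, sub_self, sub_self]

theorem IsStarProjection.norm_le_one {p : E} (hp : IsStarProjection p) : ‖p‖ ≤ 1 := hp.norm_le

theorem norm_le_one_of_mul_star_eq {p v : E} (hp : IsStarProjection p) (h : v * star v = p) :
    ‖v‖ ≤ 1 := by
  have := CStarRing.norm_self_mul_star (x := v)
  rw [h] at this
  nlinarith [hp.norm_le_one, norm_nonneg v]

theorem norm_mul_mul_le {p q x : E} (hp : ‖p‖ ≤ 1) (hq : ‖q‖ ≤ 1) : ‖p * x * q‖ ≤ ‖x‖ := by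
  refine (norm_mul_le _ _).trans ?_
  have h1 := norm_mul_le p x
  have h2 : ‖p‖ * ‖x‖ ≤ 1 * ‖x‖ := by gcongr
  calc ‖p * x‖ * ‖q‖ ≤ ‖x‖ * 1 := by gcongr; linarith
    _ = ‖x‖ := mul_one _

theorem exists_partialIsometry_of_norm_sub_lt {p q : E} (hp : IsStarProjection p)
    (hq : IsStarProjection q) (h : ‖p - q‖ < 1) : ∃ w : E, w * star w = p ∧ star w * w = q := by
  have hpp := isStarProjection_iff'.1 hp
  have hqq := isStarProjection_iff'.1 hq
  refine exists_partialIsometry_of_approx (x := p * q) hp hq (by rw [← mul_assoc, hpp.1])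
    (by rw [mul_assoc, hqq.1]) ?_ ?_
  · have : p * q * star (p * q) - p = p * (q - p) * p := by
      rw [star_mul, hpp.2, hqq.2]
      calc p * q * (q * p) - p = p * (q * q) * p - p * p * p := by
            rw [hpp.1, hpp.1]; noncomm_ring
        _ = _ := by rw [hqq.1]; noncomm_ring
    rw [this]
    refine (norm_mul_mul_le hp.norm_le_one hp.norm_le_one).trans_lt ?_
    rwa [norm_sub_rev]
  · have : star (p * q) * (p * q) - q = q * (p - q) * q := by
      rw [star_mul, hpp.2, hqq.2]
      calc q * p * (p * q) - q = q * (p * p) * q - q * q * q := by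
            rw [hqq.1, hqq.1]; noncomm_ring
        _ = _ := by rw [hpp.1]; noncomm_ring
    rw [this]
    exact (norm_mul_mul_le hq.norm_le_one hq.norm_le_one).trans_lt h

/-- The bound `1/4` keeps `1/2` out of the spectrum, so the cut-off at `1/2` is continuous there. Of
`|t|` and `|t - 1|` one is `|f t - t|` and the other is at least `1/2`, whence the factor `2`. -/
theorem exists_isStarProjection_near {a : E} (ha : IsSelfAdjoint a) (h : ‖a * a - a‖ < 1 / 4) :
    ∃ q : E, IsStarProjection q ∧ ‖q - a‖ ≤ 2 * ‖a * a - a‖ := by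
  have hsp : ∀ t ∈ spectrum ℝ a, |t * t - t| ≤ ‖a * a - a‖ := by
    intro t ht
    have h := norm_apply_le_norm_cfc (fun t : ℝ => t * t - t) a ht
    rw [cfc_sub (fun t : ℝ => t * t) (fun t => t) a, cfc_mul (fun t : ℝ => t) (fun t => t) a,
      cfc_id' ℝ a] at h
    exact h
  have hne : ∀ t ∈ spectrum ℝ a, t ≠ 1 / 2 := by
    rintro t ht rfl
    have := (hsp _ ht).trans_lt h
    norm_num [abs_lt] at this
  let f : ℝ → ℝ := fun t => if t < 1 / 2 then 0 else 1
  have hf : ContinuousOn f (spectrum ℝ a) := by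
    intro t ht
    refine ContinuousAt.continuousWithinAt ?_
    rcases lt_or_gt_of_ne (hne t ht) with hlt | hgt
    · refine (continuousAt_const (y := (0 : ℝ))).congr ?_
      filter_upwards [gt_mem_nhds hlt] with s hs
      simp only [f, if_pos hs]
    · refine (continuousAt_const (y := (1 : ℝ))).congr ?_
      filter_upwards [lt_mem_nhds hgt] with s hs
      simp only [f, if_neg (not_lt.2 hs.le)]
  refine ⟨cfc f a, ⟨?_, cfc_predicate _ _⟩, ?_⟩
  · change cfc f a * cfc f a = cfc f a
    rw [← cfc_mul _ _ a hf hf]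
    congr 1
    funext t
    simp only [f]
    split_ifs <;> simp
  · have : cfc f a - a = cfc (fun t => f t - t) a := by
      rw [cfc_sub f (fun t => t) a hf, cfc_id' ℝ a]
    rw [this, norm_cfc_le_iff (fun t => f t - t) a (by positivity) (hf.sub continuousOn_id)]
    intro t ht
    refine le_trans ?_ (mul_le_mul_of_nonneg_left (hsp t ht) (by norm_num))
    rw [Real.norm_eq_abs, show t * t - t = t * (t - 1) by ring, abs_mul]
    simp only [f]
    split_ifs with h3
    · rw [zero_sub, abs_neg]
      have : 1 / 2 ≤ |t - 1| := by rw [abs_of_neg (by linarith)]; linarith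
      nlinarith [abs_nonneg t]
    · rw [abs_sub_comm]
      have : 1 / 2 ≤ |t| := (not_lt.1 h3).trans (le_abs_self t)
      nlinarith [abs_nonneg (t - 1)]

theorem norm_mul_star_sub_le {x v : E} {δ : ℝ} (h : ‖x - v‖ ≤ δ) (hv : ‖v‖ ≤ 1) :
    ‖x * star x - v * star v‖ ≤ δ * (1 + δ) + δ := by
  have hδ : 0 ≤ δ := (norm_nonneg _).trans h
  have hx : ‖x‖ ≤ 1 + δ := by
    calc ‖x‖ = ‖v + (x - v)‖ := by rw [add_sub_cancel]
      _ ≤ _ := (norm_add_le _ _).trans (add_le_add hv h)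
  have : x * star x - v * star v = (x - v) * star x + v * star (x - v) := by
    rw [star_sub]; noncomm_ring
  rw [this]
  refine (norm_add_le _ _).trans (add_le_add ((norm_mul_le _ _).trans ?_)
    ((norm_mul_le _ _).trans ?_))
  · rw [norm_star]; gcongr
  · rw [norm_star]
    calc ‖v‖ * ‖x - v‖ ≤ 1 * δ := by gcongr
      _ = δ := one_mul _

theorem norm_star_mul_sub_le {x v : E} {δ : ℝ} (h : ‖x - v‖ ≤ δ) (hv : ‖v‖ ≤ 1) :
    ‖star x * x - star v * v‖ ≤ δ * (1 + δ) + δ := by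
  have := norm_mul_star_sub_le (x := star x) (v := star v) (δ := δ) (by rwa [← star_sub, norm_star])
    (by rwa [norm_star])
  simpa using this

variable {E' : Type*} [CStarAlgebra E'] (j : E' →⋆ₙₐ[ℂ] E) (hj : Function.Injective j)

include hj

/-- The compression `p u q` is still within `1/8` of `v`, and its products with its adjoint are
within `17/64` of `p` and `q`. Injective `*`-homomorphisms are isometric, so these estimates hold in
`E'`. -/
theorem exists_partialIsometry_lift {p q u : E'} {v : E} (hp : IsStarProjection p)
    (hq : IsStarProjection q) (h1 : v * star v = j p) (h2 : star v * v = j q)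
    (h : ‖j u - v‖ ≤ 1 / 8) : ∃ w : E', w * star w = p ∧ star w * w = q := by
  have hpp := isStarProjection_iff'.1 hp
  have hqq := isStarProjection_iff'.1 hq
  have hv := norm_le_one_of_mul_star_eq (hp.map j) h1
  have hx : ‖j (p * u * q) - v‖ ≤ 1 / 8 := by
    have : j (p * u * q) - v = j p * (j u - v) * j q := by
      rw [map_mul, map_mul, mul_sub, sub_mul, mul_eq_of_mul_star_eq (hp.map j) h1,
        mul_eq_of_star_mul_eq (hq.map j) h2]
    rw [this]
    exact (norm_mul_mul_le (hp.map j).norm_le_one (hq.map j).norm_le_one).trans h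
  refine exists_partialIsometry_of_approx (x := p * u * q) hp hq
    (by rw [← mul_assoc, ← mul_assoc, hpp.1]) (by rw [mul_assoc, hqq.1]) ?_ ?_
  · rw [← NonUnitalStarAlgHom.norm_map j hj, map_sub, map_mul, map_star, ← h1]
    exact (norm_mul_star_sub_le hx hv).trans_lt (by norm_num)
  · rw [← NonUnitalStarAlgHom.norm_map j hj, map_sub, map_mul, map_star, ← h2]
    exact (norm_star_mul_sub_le hx hv).trans_lt (by norm_num)

/-- The self-adjoint part `a` of `u` satisfies `‖a² - a‖ ≤ 1/8`, so a projection lies within `1/4`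
of it, and `1/4 + 1/32 < 1`. -/
theorem exists_isStarProjection_lift {p : E} {u : E'} (hp : IsStarProjection p)
    (h : ‖j u - p‖ ≤ 1 / 32) : ∃ q : E', IsStarProjection q ∧ ‖j q - p‖ < 1 := by
  have hpp := isStarProjection_iff'.1 hp
  set a : E' := (1 / 2 : ℝ) • (u + star u) with ha
  have hasa : IsSelfAdjoint a := by
    rw [isSelfAdjoint_iff, ha, star_smul, star_add, star_star, star_trivial, add_comm]
  have hap : ‖j a - p‖ ≤ 1 / 32 := by
    have : j a - p = (1 / 2 : ℝ) • ((j u - p) + star (j u - p)) := by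
      have h1 : j a = (1 / 2 : ℝ) • (j u + star (j u)) := by
        rw [ha, ← Complex.coe_smul, ← Complex.coe_smul, map_smul, map_add, map_star]
      rw [h1, star_sub, hpp.2]
      module
    rw [this, norm_smul]
    have h2 := norm_add_le (j u - p) (star (j u - p))
    rw [norm_star] at h2
    rw [Real.norm_of_nonneg (by norm_num)]
    linarith
  have haa : ‖a * a - a‖ ≤ 1 / 8 := by
    rw [← NonUnitalStarAlgHom.norm_map j hj, map_sub, map_mul]
    have h1 := norm_mul_star_sub_le hap hp.norm_le_one
    rw [(hasa.map j).star_eq, hpp.2, hpp.1] at h1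
    have : j a * j a - j a = (j a * j a - p) - (j a - p) := by abel
    rw [this]
    refine (norm_sub_le _ _).trans ?_
    norm_num at h1 hap ⊢
    linarith
  obtain ⟨q, hq, hqa⟩ := exists_isStarProjection_near hasa (haa.trans_lt (by norm_num))
  refine ⟨q, hq, ?_⟩
  have : j q - p = j (q - a) + (j a - p) := by rw [map_sub]; abel
  rw [this]
  refine (norm_add_le _ _).trans_lt ?_
  rw [NonUnitalStarAlgHom.norm_map j hj]
  linarith

/-- Take the polar part `c u` with `c = (u u*)^(-1/2)`. The element `u u*` is within `3δ` of `1`,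
hence so is `c`, and `3δ(1 + δ) + δ ≤ 8δ`. -/
theorem exists_unitary_lift (h1 : j 1 = 1) {v : E} {u : E'} (hv : v ∈ unitary E) {δ : ℝ}
    (hδ : δ ≤ 1 / 8) (h : ‖j u - v‖ ≤ δ) : ∃ w ∈ unitary E', ‖j w - v‖ ≤ 8 * δ := by
  have hδ0 : 0 ≤ δ := (norm_nonneg _).trans h
  rw [Unitary.mem_iff] at hv
  have hv1 := norm_le_one_of_mul_star_eq (.one E) hv.2
  have hb : δ * (1 + δ) + δ ≤ 3 * δ := by nlinarith
  have e1 : ‖u * star u - 1‖ ≤ 3 * δ := by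
    rw [← NonUnitalStarAlgHom.norm_map j hj, map_sub, map_mul, map_star, h1, ← hv.2]
    exact (norm_mul_star_sub_le h hv1).trans hb
  have e2 : ‖star u * u - 1‖ ≤ 3 * δ := by
    rw [← NonUnitalStarAlgHom.norm_map j hj, map_sub, map_mul, map_star, h1]
    conv_lhs => rw [← hv.1]
    exact (norm_star_mul_sub_le h hv1).trans hb
  have hu : ‖u‖ ≤ 1 + δ := by
    rw [← NonUnitalStarAlgHom.norm_map j hj]
    calc ‖j u‖ = ‖v + (j u - v)‖ := by rw [add_sub_cancel]
      _ ≤ _ := (norm_add_le _ _).trans (add_le_add hv1 h)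
  have hsa : IsSelfAdjoint (u * star u) := IsSelfAdjoint.mul_star_self u
  obtain ⟨c, hc, hccy, hcomm, hc1⟩ := exists_inv_sqrt hsa (e1.trans_lt (by linarith))
  have hc2 : ‖c - 1‖ ≤ 3 * δ := (hc1 (e1.trans (by linarith))).trans e1
  have hcy : c * (u * star u) = u * star u * c := hcomm _ rfl
  have hww : c * u * star (c * u) = 1 := by
    rw [star_mul, hc.star_eq]
    calc c * u * (star u * c) = c * (u * star u * c) := by noncomm_ring
      _ = 1 := by rw [← hcy, ← mul_assoc, hccy]
  -- So far `c u` is only a co-isometry; invertibility of `u* u` supplies a left inverse, and its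
  -- adjoint is then its inverse.
  have hunit : IsUnit (c * u) := by
    have hu1 : IsUnit (star u * u) := isUnit_of_norm_sub_one_lt (e2.trans_lt (by linarith))
    obtain ⟨l, hl⟩ := hu1.exists_left_inv
    refine isUnit_iff_exists_and_exists.2 ⟨⟨star (c * u), hww⟩, l * star u * (u * star u) * c, ?_⟩
    calc l * star u * (u * star u) * c * (c * u) = l * star u * (u * star u * c) * c * u := by
          noncomm_ring
      _ = l * star u * (c * (u * star u) * c) * u := by rw [← hcy]; noncomm_ring
      _ = l * star u * (c * (c * (u * star u))) * u := by rw [mul_assoc c, ← hcy]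
      _ = l * (star u * u) := by rw [← mul_assoc c c, hccy]; noncomm_ring
      _ = 1 := hl
  refine ⟨c * u, Unitary.mem_iff.2 ⟨?_, hww⟩, ?_⟩
  · obtain ⟨w, hw⟩ := hunit
    have : star (c * u) = (↑w⁻¹ : E') := by
      rw [← hw] at hww ⊢
      exact (Units.inv_eq_of_mul_eq_one_right hww).symm
    rw [this, ← hw, Units.inv_mul]
  · have : j (c * u) - v = j ((c - 1) * u) + (j u - v) := by
      rw [sub_mul, one_mul, map_sub]; abel
    rw [this]
    refine (norm_add_le _ _).trans ?_
    rw [NonUnitalStarAlgHom.norm_map j hj]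
    have h5 : ‖(c - 1) * u‖ ≤ 3 * δ * (1 + δ) := (norm_mul_le _ _).trans (by gcongr)
    nlinarith

end Perturbation
end

/-! ### AF-algebras: `V(A)` as a direct limit -/

noncomputable section

open KZero

/-- An increasing sequence of finite-dimensional unital `*`-subalgebras with dense union. -/
structure AFChain (A : Type*) [CStarAlgebra A] where
  F : ℕ → StarSubalgebra ℂ A
  mono : Monotone F
  finDim : ∀ n, FiniteDimensional ℂ (F n)
  dense : Dense (⋃ n, (F n : Set A))

/-- The unital `*`-subalgebra `F + ℂ1`. -/
def NonUnitalStarSubalgebra.addOne {A : Type*} [CStarAlgebra A]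
    (F : NonUnitalStarSubalgebra ℂ A) : StarSubalgebra ℂ A where
  carrier := {x | ∃ r : ℂ, ∃ y ∈ F, x = r • 1 + y}
  mul_mem' := by
    rintro _ _ ⟨r, y, hy, rfl⟩ ⟨s, z, hz, rfl⟩
    refine ⟨r * s, r • z + s • y + y * z,
      add_mem (add_mem (F.smul_mem' r hz) (F.smul_mem' s hy)) (mul_mem hy hz), ?_⟩
    simp only [add_mul, mul_add, one_mul, smul_mul_assoc, mul_smul_comm, mul_one, smul_add,
      smul_smul, mul_comm s r]
    abel
  add_mem' := by
    rintro _ _ ⟨r, y, hy, rfl⟩ ⟨s, z, hz, rfl⟩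
    exact ⟨r + s, y + z, add_mem hy hz, by rw [add_smul]; abel⟩
  algebraMap_mem' r := ⟨r, 0, zero_mem F, by rw [Algebra.algebraMap_eq_smul_one, add_zero]⟩
  star_mem' := by
    rintro _ ⟨r, y, hy, rfl⟩
    exact ⟨star r, star y, star_mem hy, by rw [star_add, star_smul, star_one]⟩

theorem IsAFAlgebra.nonempty_afChain {A : Type*} [CStarAlgebra A] (h : IsAFAlgebra A) :
    Nonempty (AFChain A) := by
  obtain ⟨-, F, hm, hf, hd⟩ := h
  refine ⟨⟨fun n => (F n).addOne, ?_, fun n => ?_, ?_⟩⟩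
  · rintro m n hmn _ ⟨r, y, hy, rfl⟩
    exact ⟨r, y, hm hmn hy, rfl⟩
  · let W : Submodule ℂ A := Submodule.span ℂ {1} ⊔ (F n).toSubmodule
    have h1 : FiniteDimensional ℂ (F n).toSubmodule := hf n
    have h2 : FiniteDimensional ℂ W := inferInstance
    have h3 : Subalgebra.toSubmodule (F n).addOne.toSubalgebra ≤ W := by
      rintro _ ⟨r, y, hy, rfl⟩
      exact Submodule.add_mem_sup (Submodule.smul_mem _ _ (Submodule.mem_span_singleton_self 1)) hy
    exact Submodule.finiteDimensional_of_le h3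
  · rw [dense_iff_closure_eq, ← Set.univ_subset_iff, ← hd]
    refine closure_mono (Set.iUnion_mono fun n y hy => ⟨0, y, hy, by simp⟩)

section FiniteDimensional

variable {E : Type*} [CStarAlgebra E] [FiniteDimensional ℂ E]

theorem KZero.V.map_bijective {C C' : Type*} [Ring C] [StarRing C] [Algebra ℂ C] [Ring C']
    [StarRing C'] [Algebra ℂ C'] (e : C ≃⋆ₐ[ℂ] C') : Function.Bijective (V.map (e : C →⋆ₐ[ℂ] C')) := by
  refine Function.bijective_iff_has_inverse.2 ⟨V.map (e.symm : C' →⋆ₐ[ℂ] C), fun x => ?_, fun x => ?_⟩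
  · rw [V.map_map]
    convert V.map_id x
    ext y
    simp
  · rw [V.map_map]
    convert V.map_id x
    ext y
    simp

theorem exists_blockShape_starAlgEquiv (E : Type*) [CStarAlgebra E] [FiniteDimensional ℂ E] :
    ∃ S : BlockShape, Nonempty (S.Alg ≃⋆ₐ[ℂ] E) := by
  obtain ⟨S, φ, hφ⟩ := exists_blockShape_equiv E
  exact ⟨S, ⟨StarAlgEquiv.ofBijective φ hφ⟩⟩

theorem V_add_right_cancel_of_finiteDimensional {x y z : V E} (h : x + z = y + z) : x = y := by
  obtain ⟨S, ⟨f⟩⟩ := exists_blockShape_starAlgEquiv E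
  apply (V.map_bijective f.symm).1
  have := congrArg (V.map (f.symm : E →⋆ₐ[ℂ] S.Alg)) h
  rw [map_add, map_add] at this
  exact BlockShape.V_add_right_cancel this

theorem countable_V_of_finiteDimensional : Countable (V E) := by
  obtain ⟨S, ⟨f⟩⟩ := exists_blockShape_starAlgEquiv E
  exact (V.map_bijective f).2.countable

end FiniteDimensional

/-- Representatives are padded with zeros to a common size, so that both lie in one matrix
C*-algebra. -/
theorem KZero.exists_vcls_pair {C : Type*} [Ring C] [StarRing C] (x y : V C) :
    ∃ (n : ℕ) (p q : Matrix (Fin n) (Fin n) C), IsStarProjection p ∧ IsStarProjection q ∧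
      vcls p = x ∧ vcls q = y := by
  obtain ⟨a, p, hp, rfl⟩ := exists_vcls x
  obtain ⟨b, q, hq, rfl⟩ := exists_vcls y
  have h1 := isStarProjection_blocks hp (IsStarProjection.zero (Matrix (Fin b) (Fin b) C))
  have h2 := isStarProjection_blocks (IsStarProjection.zero (Matrix (Fin a) (Fin a) C)) hq
  have h1' := isStarProjection_submatrix h1 finSumFinEquiv.symm
  have h2' := isStarProjection_submatrix h2 finSumFinEquiv.symm
  refine ⟨a + b, _, _, h1', h2', ?_, ?_⟩
  · rw [← (vcls_eq_iff h1 h1').2 ((MvN.refl h1).submatrix_right _), vcls_blocks hp (.zero _),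
      vcls_zero, add_zero]
  · rw [← (vcls_eq_iff h2 h2').2 ((MvN.refl h2).submatrix_right _), vcls_blocks (.zero _) hq,
      vcls_zero, zero_add]

section Matrices

attribute [local instance] CStarAlgebra.spectralOrder CStarAlgebra.spectralOrderedRing

variable {n : Type} [Fintype n] {C D : Type*} [CStarAlgebra C] [CStarAlgebra D]

theorem isStarProjection_ofMatrix_iff {p : Matrix n n C} :
    IsStarProjection (CStarMatrix.ofMatrix p) ↔ IsStarProjection p := by
  rw [isStarProjection_iff', isStarProjection_iff']
  exact Iff.rfl

theorem mvn_iff_exists_cstarMatrix {p q : Matrix n n C} : MvN p q ↔ ∃ w : CStarMatrix n n C,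
      w * star w = CStarMatrix.ofMatrix p ∧ star w * w = CStarMatrix.ofMatrix q := by
  constructor
  · rintro ⟨w, h1, h2⟩
    exact ⟨CStarMatrix.ofMatrix w, h1, h2⟩
  · rintro ⟨w, h1, h2⟩
    exact ⟨CStarMatrix.ofMatrix.symm w, h1, h2⟩

/-- A `*`-homomorphism acting entrywise on matrices. -/
def matHom (n : Type) [Fintype n] (f : D →⋆ₐ[ℂ] C) :
    CStarMatrix n n D →⋆ₙₐ[ℂ] CStarMatrix n n C :=
  CStarMatrix.mapₙₐ (f : D →⋆ₙₐ[ℂ] C)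

theorem matHom_injective {f : D →⋆ₐ[ℂ] C} (hf : Function.Injective f) :
    Function.Injective (matHom n f) :=
  CStarMatrix.map_injective hf

variable [DecidableEq n]

theorem mvn_lift {f : D →⋆ₐ[ℂ] C} (hf : Function.Injective f) {p q u : Matrix n n D}
    (hp : IsStarProjection p) (hq : IsStarProjection q) {v : Matrix n n C}
    (h1 : v * vᴴ = p.map f) (h2 : vᴴ * v = q.map f)
    (h : ‖CStarMatrix.ofMatrix (u.map f) - CStarMatrix.ofMatrix v‖ ≤ 1 / 8) : MvN p q :=
  mvn_iff_exists_cstarMatrix.2 <| exists_partialIsometry_lift (matHom n f) (matHom_injective hf)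
    (isStarProjection_ofMatrix_iff.2 hp) (isStarProjection_ofMatrix_iff.2 hq)
    (v := CStarMatrix.ofMatrix v) h1 h2 (u := CStarMatrix.ofMatrix u) h

theorem isStarProjection_lift {f : D →⋆ₐ[ℂ] C} (hf : Function.Injective f) {p : Matrix n n C}
    (hp : IsStarProjection p) {u : Matrix n n D}
    (h : ‖CStarMatrix.ofMatrix (u.map f) - CStarMatrix.ofMatrix p‖ ≤ 1 / 32) :
    ∃ q : Matrix n n D, IsStarProjection q ∧ MvN (q.map f) p := by
  have hp' := isStarProjection_ofMatrix_iff.2 hp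
  obtain ⟨q, hq, hqp⟩ := exists_isStarProjection_lift (matHom n f) (matHom_injective hf)
    hp' (u := CStarMatrix.ofMatrix u) h
  exact ⟨CStarMatrix.ofMatrix.symm q, isStarProjection_ofMatrix_iff.1 hq,
    mvn_iff_exists_cstarMatrix.2 (exists_partialIsometry_of_norm_sub_lt (hq.map (matHom n f))
      hp' hqp)⟩

end Matrices

namespace AFChain

variable {A : Type*} [CStarAlgebra A] (T : AFChain A)

instance isClosed_F (m : ℕ) : IsClosed (T.F m : Set A) :=
  have := T.finDim m
  Submodule.closed_of_finiteDimensional (Subalgebra.toSubmodule (T.F m).toSubalgebra)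

instance finDim_F (m : ℕ) : FiniteDimensional ℂ (T.F m) := T.finDim m

/-- The inclusion of a member of the chain. -/
def sub (m : ℕ) : T.F m →⋆ₐ[ℂ] A := (T.F m).subtype

/-- The inclusions along the chain. -/
def incl {m n : ℕ} (h : m ≤ n) : T.F m →⋆ₐ[ℂ] T.F n := StarSubalgebra.inclusion (T.mono h)

theorem sub_comp_incl {m n : ℕ} (h : m ≤ n) : (T.sub n).comp (T.incl h) = T.sub m := rfl

theorem map_sub_map_incl {m n : ℕ} (h : m ≤ n) (x : V (T.F m)) :
    V.map (T.sub n) (V.map (T.incl h) x) = V.map (T.sub m) x := by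
  rw [V.map_map, sub_comp_incl]

theorem sub_injective (m : ℕ) : Function.Injective (T.sub m) := Subtype.val_injective

theorem exists_near (m₀ : ℕ) (y : A) {δ : ℝ} (hδ : 0 < δ) :
    ∃ m, m₀ ≤ m ∧ ∃ u : T.F m, ‖T.sub m u - y‖ ≤ δ := by
  obtain ⟨z, hz, hzy⟩ := T.dense.exists_dist_lt y hδ
  obtain ⟨m, hm⟩ := Set.mem_iUnion.1 hz
  refine ⟨max m₀ m, le_max_left _ _, ⟨z, T.mono (le_max_right _ _) hm⟩, ?_⟩
  rw [dist_comm, dist_eq_norm] at hzy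
  exact hzy.le

section Matrices

attribute [local instance] CStarAlgebra.spectralOrder CStarAlgebra.spectralOrderedRing

variable {n : Type} [Fintype n] [DecidableEq n]

/-- Entrywise approximation suffices for the C*-norm on matrices, since its topology is the product
one; the finitely many entries then lie in one stage. -/
theorem exists_matrix_near (m₀ : ℕ) (v : CStarMatrix n n A) {δ : ℝ} (hδ : 0 < δ) :
    ∃ m, m₀ ≤ m ∧ ∃ u : Matrix n n (T.F m),
      ‖CStarMatrix.ofMatrix (u.map (T.sub m)) - v‖ ≤ δ := by
  have hd : Dense (Set.univ.pi fun _ : n => Set.univ.pi fun _ : n => ⋃ m, (T.F m : Set A)) :=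
    dense_pi _ fun _ _ => dense_pi _ fun _ _ => T.dense
  have hd' : Dense ((CStarMatrix.ofMatrixL (m := n) (n := n) (A := A)) ''
      (Set.univ.pi fun _ : n => Set.univ.pi fun _ : n => ⋃ m, (T.F m : Set A))) :=
    (CStarMatrix.ofMatrixL (m := n) (n := n) (A := A)).surjective.denseRange.dense_image
      (CStarMatrix.ofMatrixL (m := n) (n := n) (A := A)).continuous hd
  obtain ⟨z, ⟨w, hw, rfl⟩, hz⟩ := hd'.exists_dist_lt v hδ
  have hw' : ∀ i j, ∃ m, w i j ∈ T.F m := fun i j =>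
    Set.mem_iUnion.1 (hw i trivial j trivial)
  choose k hk using hw'
  let m := max m₀ (Finset.univ.sup fun i => Finset.univ.sup fun j => k i j)
  have hm : ∀ i j, w i j ∈ T.F m := fun i j => T.mono
    (((Finset.le_sup (f := fun j => k i j) (Finset.mem_univ j)).trans
      (Finset.le_sup (f := fun i => Finset.univ.sup fun j => k i j) (Finset.mem_univ i))).trans
      (le_max_right _ _)) (hk i j)
  refine ⟨m, le_max_left _ _, Matrix.of fun i j => ⟨w i j, hm i j⟩, ?_⟩
  rw [dist_comm, dist_eq_norm] at hz
  exact hz.le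

/-- The injectivity half of the limit: a partial isometry over `A` is approximated within `1/8` at a
later stage and corrected there. -/
theorem exists_map_incl_eq {m : ℕ} {x y : V (T.F m)}
    (h : V.map (T.sub m) x = V.map (T.sub m) y) :
    ∃ (m' : ℕ) (hm : m ≤ m'), V.map (T.incl hm) x = V.map (T.incl hm) y := by
  obtain ⟨n, p, q, hp, hq, rfl, rfl⟩ := exists_vcls_pair x y
  rw [V.map_vcls _ hp, V.map_vcls _ hq,
    vcls_eq_iff (isStarProjection_map _ hp) (isStarProjection_map _ hq)] at h
  obtain ⟨v, h1, h2⟩ := h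
  obtain ⟨m', hm, u, hu⟩ := T.exists_matrix_near m (CStarMatrix.ofMatrix v)
    (show (0 : ℝ) < 1 / 8 by norm_num)
  refine ⟨m', hm, ?_⟩
  have hp' := isStarProjection_map (T.incl hm) hp
  have hq' := isStarProjection_map (T.incl hm) hq
  rw [V.map_vcls _ hp, V.map_vcls _ hq, vcls_eq_iff hp' hq']
  exact mvn_lift (T.sub_injective m') hp' hq' h1 h2 hu

/-- The surjectivity half of the limit: a projection over `A` is approximated within `1/32` at some
stage and corrected to an equivalent projection. -/
theorem exists_map_sub_eq (x : V A) : ∃ (m : ℕ) (y : V (T.F m)), V.map (T.sub m) y = x := by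
  obtain ⟨n, p, hp, rfl⟩ := exists_vcls x
  obtain ⟨m, -, u, hu⟩ := T.exists_matrix_near 0 (CStarMatrix.ofMatrix p)
    (show (0 : ℝ) < 1 / 32 by norm_num)
  obtain ⟨q, hq, hqp⟩ := isStarProjection_lift (T.sub_injective m) hp hu
  refine ⟨m, vcls q, ?_⟩
  rwa [V.map_vcls _ hq, vcls_eq_iff (isStarProjection_map _ hq) hp]

end Matrices

theorem exists_map_sub_eq_of_le (x : V A) :
    ∃ m₀ : ℕ, ∀ m, m₀ ≤ m → ∃ y : V (T.F m), V.map (T.sub m) y = x := by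
  obtain ⟨m, y, hy⟩ := T.exists_map_sub_eq x
  exact ⟨m, fun n hn => ⟨V.map (T.incl hn) y, by rw [map_sub_map_incl, hy]⟩⟩

include T in
-- The equation already holds at a finite stage, where `V` is cancellative.
theorem V_isCancelAdd : IsCancelAdd (V A) := by
  have : IsRightCancelAdd (V A) := by
    refine ⟨fun z x y h => ?_⟩
    obtain ⟨a, ha⟩ := T.exists_map_sub_eq_of_le x
    obtain ⟨b, hb⟩ := T.exists_map_sub_eq_of_le y
    obtain ⟨c, hc⟩ := T.exists_map_sub_eq_of_le z
    obtain ⟨x', rfl⟩ := ha (max a (max b c)) (by simp)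
    obtain ⟨y', rfl⟩ := hb (max a (max b c)) (by simp)
    obtain ⟨z', rfl⟩ := hc (max a (max b c)) (by simp)
    simp only [← map_add] at h
    obtain ⟨m', hm, h'⟩ := T.exists_map_incl_eq h
    rw [map_add, map_add] at h'
    rw [← T.map_sub_map_incl hm x', V_add_right_cancel_of_finiteDimensional h',
      map_sub_map_incl]
  have : IsLeftCancelAdd (V A) := ⟨fun z x y h => by
    simp only [add_comm z] at h
    exact add_right_cancel h⟩
  exact ⟨⟩

include T in
theorem countable_V : Countable (V A) := by
  have h : ∀ m, Countable (V (T.F m)) := fun m => countable_V_of_finiteDimensional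
  have hs : Function.Surjective fun s : (Σ m, V (T.F m)) => V.map (T.sub s.1) s.2 := fun x => by
    obtain ⟨m, y, hy⟩ := T.exists_map_sub_eq x
    exact ⟨⟨m, y⟩, hy⟩
  exact hs.countable

end AFChain
end

/-! ### Approximation of homomorphisms into an AF-algebra -/

noncomputable section

open KZero

namespace BlockShape

variable {S : BlockShape}

/-- The minimal projection at the base point of a block. -/
def e₀ (c : S.Blk) : S.Alg := e c (S.base c) (S.base c)

theorem isStarProjection_e₀ (c : S.Blk) : IsStarProjection (e₀ c) := isStarProjection_e c _

theorem traceHom_ecls_one (d : S.Blk) :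
    traceHom S (ecls 1) d = Fintype.card (S.Idx d) := by
  rw [ecls_one]
  change (flat d (Proj.one S.Alg).mat).trace = _
  rw [trace_flat]
  change ∑ i : Fin 1, _ = _
  rw [Fin.sum_univ_one]
  simp [Proj.one, Matrix.trace_one]

theorem sum_card_smul_ecls_e₀ :
    ∑ c, Fintype.card (S.Idx c) • ecls (e₀ c) = (ecls 1 : V S.Alg) := by
  apply traceHom_injective
  funext d
  rw [traceHom_ecls_one]
  exact traceHom_sum _ d

/-- The hypothesis of `exists_hom_of_sum_eq` is also necessary; this is the relation to be
transferred from `K₀(A)` to `K₀(B)`. -/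
theorem sum_card_smul_ecls_map {C : Type*} [Ring C] [StarRing C] [Algebra ℂ C]
    (φ : S.Alg →⋆ₐ[ℂ] C) :
    ∑ c, Fintype.card (S.Idx c) • ecls (φ (e₀ c)) = ecls 1 := by
  have h := congrArg (V.map φ) (sum_card_smul_ecls_e₀ (S := S))
  rw [V.map_ecls φ (.one _), map_one, map_sum] at h
  rw [← h]
  refine Finset.sum_congr rfl fun c _ => ?_
  rw [map_nsmul, V.map_ecls φ (isStarProjection_e₀ c)]

end BlockShape

open BlockShape

theorem KZero.ecls_conj {C : Type*} [Ring C] [StarRing C] {u p : C} (hu : u ∈ unitary C)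
    (hp : IsStarProjection p) : ecls (u * p * star u) = ecls p := by
  have hpp := isStarProjection_iff'.1 hp
  rw [Unitary.mem_iff] at hu
  have h1 : u * p * star u * (u * p * star u) = u * p * star u := by
    calc u * p * star u * (u * p * star u) = u * p * (star u * u) * p * star u := by noncomm_ring
      _ = u * (p * p) * star u := by rw [hu.1]; noncomm_ring
      _ = u * p * star u := by rw [hpp.1]
  rw [ecls_eq_iff (isStarProjection_iff'.2 ⟨h1, by simp [hpp.2, mul_assoc]⟩) hp]
  refine ⟨u * p, ?_, ?_⟩
  · calc u * p * star (u * p) = u * (p * p) * star u := by rw [star_mul, hpp.2]; noncomm_ring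
      _ = u * p * star u := by rw [hpp.1]
  · calc star (u * p) * (u * p) = p * (star u * u) * p := by rw [star_mul, hpp.2]; noncomm_ring
      _ = p := by rw [hu.1, mul_one, hpp.1]

/-- Conjugation of a homomorphism by a unitary. -/
def conjHom {D C : Type*} [Ring D] [StarRing D] [Algebra ℂ D] [Ring C] [StarRing C] [Algebra ℂ C]
    {u : C} (hu : u ∈ unitary C) (φ : D →⋆ₐ[ℂ] C) : D →⋆ₐ[ℂ] C :=
  ((Unitary.conjStarAlgAut ℂ C ⟨u, hu⟩ : C ≃⋆ₐ[ℂ] C) : C →⋆ₐ[ℂ] C).comp φ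

theorem conjHom_apply {D C : Type*} [Ring D] [StarRing D] [Algebra ℂ D] [Ring C] [StarRing C]
    [Algebra ℂ C] {u : C} (hu : u ∈ unitary C) (φ : D →⋆ₐ[ℂ] C) (z : D) :
    conjHom hu φ z = u * φ z * star u := by
  simp [conjHom, Unitary.conjStarAlgAut_apply]

/-- Keeps approximants inside the ball over which a quantifier ranges. The factor `r / (r + ε)`
moves elements of norm at most `r + ε` by at most `ε`. -/
theorem exists_rescale {A : Type*} [CStarAlgebra A] {y : A} {r ε : ℝ} (hr : 0 ≤ r) (hy : ‖y‖ ≤ r)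
    (hε : 0 < ε) : ∃ t : ℝ, ∀ z : A, ‖z - y‖ ≤ ε → ‖t • z‖ ≤ r ∧ ‖t • z - y‖ ≤ 2 * ε := by
  have hp : 0 < r + ε := by linarith
  refine ⟨r / (r + ε), fun z hz => ?_⟩
  have hzr : ‖z‖ ≤ r + ε := by
    calc ‖z‖ = ‖y + (z - y)‖ := by rw [add_sub_cancel]
      _ ≤ _ := (norm_add_le _ _).trans (add_le_add hy hz)
  constructor
  · rw [norm_smul, Real.norm_of_nonneg (by positivity)]
    calc r / (r + ε) * ‖z‖ ≤ r / (r + ε) * (r + ε) := by gcongr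
      _ = r := div_mul_cancel₀ _ hp.ne'
  · have h1 : (r / (r + ε)) • z - y = (z - y) - (ε / (r + ε)) • z := by
      have : r / (r + ε) = 1 - ε / (r + ε) := by field_simp; ring
      rw [this, sub_smul, one_smul]
      abel
    rw [h1]
    refine (norm_sub_le _ _).trans ?_
    rw [norm_smul, Real.norm_of_nonneg (by positivity)]
    have : ε / (r + ε) * ‖z‖ ≤ ε := by
      calc ε / (r + ε) * ‖z‖ ≤ ε / (r + ε) * (r + ε) := by gcongr
        _ = ε := div_mul_cancel₀ _ hp.ne'
    linarith

namespace AFChain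

variable {A : Type*} [CStarAlgebra A] (T : AFChain A)

/-- Up to unitary equivalence, homomorphisms land in the chain. -/
theorem exists_unitary_conj {S : BlockShape} (φ : S.Alg →⋆ₐ[ℂ] A) :
    ∃ (m : ℕ) (ψ : S.Alg →⋆ₐ[ℂ] T.F m), ∃ u ∈ unitary A,
      ∀ z, u * T.sub m (ψ z) * star u = φ z := by
  choose k hk using fun c => T.exists_map_sub_eq_of_le (ecls (φ (e₀ c)))
  have hk' : ∀ c, k c ≤ Finset.univ.sup k := fun c => Finset.le_sup (Finset.mem_univ c)
  choose h hh using fun c => hk c _ (hk' c)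
  have hsum : V.map (T.sub (Finset.univ.sup k)) (∑ c, Fintype.card (S.Idx c) • h c) =
      V.map (T.sub (Finset.univ.sup k)) (ecls 1) := by
    rw [V.map_ecls _ (.one _), map_one, ← sum_card_smul_ecls_map φ, map_sum]
    exact Finset.sum_congr rfl fun c _ => by rw [map_nsmul, hh]
  -- The relation for `1` is known only in `V(A)`, but it holds at a later stage, where it yields
  -- `ψ`.
  obtain ⟨m, hm, hsum'⟩ := T.exists_map_incl_eq hsum
  rw [V.map_ecls _ (.one _), map_one, map_sum] at hsum'
  simp only [map_nsmul] at hsum'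
  obtain ⟨ψ, hψ⟩ := exists_hom_of_sum_eq _ hsum'
  obtain ⟨u, hu, huz⟩ := exists_unitary_of_ecls_eq φ ((T.sub m).comp ψ) fun c => by
    have key : ecls (φ (e₀ c)) = ecls (T.sub m (ψ (e₀ c))) := by
      rw [← V.map_ecls _ ((isStarProjection_e₀ c).map ψ), ← hh c, ← T.map_sub_map_incl hm,
        show ecls (ψ (e₀ c)) = _ from hψ c]
    exact key
  exact ⟨m, ψ, u, hu, huz⟩

include T in
/-- Any homomorphism and any further element can be approximated within one member of the chain,
preserving the classes of the minimal projections. -/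
theorem exists_approx {S : BlockShape} (φ : S.Alg →⋆ₐ[ℂ] A) {n : ℕ} (x : Fin n → S.Alg) {y : A}
    {r : ℝ} (hr : 0 ≤ r) (hy : ‖y‖ ≤ r) {δ : ℝ} (hδ : 0 < δ) :
    ∃ (S' : BlockShape) (φ' : S'.Alg →⋆ₐ[ℂ] A) (j : S.Alg →⋆ₐ[ℂ] S'.Alg) (y' : S'.Alg),
      (∀ i, ‖φ' (j (x i)) - φ (x i)‖ ≤ δ) ∧ ‖φ' y' - y‖ ≤ δ ∧ ‖φ' y'‖ ≤ r ∧
      ∀ c, ecls (φ' (j (e₀ c))) = ecls (φ (e₀ c)) := by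
  -- Up to conjugation by `u`, the map `φ` takes values in a stage. As `u` need not lie in the
  -- chain, it is replaced by a nearby unitary `w` of a later stage that also approximates `y`.
  obtain ⟨m, ψ, u, hu, huz⟩ := T.exists_unitary_conj φ
  let X : Fin n → A := fun i => T.sub m (ψ (x i))
  let M : ℝ := 1 + ∑ i, ‖X i‖
  have hM1 : 1 ≤ M := le_add_of_nonneg_right (Finset.sum_nonneg fun _ _ => norm_nonneg _)
  have hM : ∀ i, ‖X i‖ ≤ M := fun i =>
    (Finset.single_le_sum (f := fun i => ‖X i‖) (fun _ _ => norm_nonneg _)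
      (Finset.mem_univ i)).trans (le_add_of_nonneg_left zero_le_one)
  have hM0 : 0 < M := by linarith
  obtain ⟨t, ht⟩ := exists_rescale hr hy (half_pos hδ)
  obtain ⟨m₁, hm₁, v, hv⟩ := T.exists_near m u
    -- Lifting the unitary multiplies the error by `8`, leaving `δ / (2M)`; conjugating elements of
    -- norm at most `M` then costs `δ / 2` on each side.
    (show (0 : ℝ) < min (1 / 8) (δ / (16 * M)) by positivity)
  obtain ⟨m₂, hm₂, y₀, hy₀⟩ := T.exists_near m₁ y (half_pos hδ)
  have hv' : ‖(T.sub m₂ : T.F m₂ →⋆ₙₐ[ℂ] A) (T.incl hm₂ v) - u‖ ≤ min (1 / 8) (δ / (16 * M)) := hv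
  obtain ⟨w, hw, hwu⟩ := exists_unitary_lift (T.sub m₂ : T.F m₂ →⋆ₙₐ[ℂ] A) (T.sub_injective m₂)
    (map_one (T.sub m₂)) hu (min_le_left _ _) hv'
  have hwu' : ‖T.sub m₂ w - u‖ ≤ δ / (2 * M) := by
    refine hwu.trans ?_
    have : 8 * min (1 / 8) (δ / (16 * M)) ≤ 8 * (δ / (16 * M)) := by
      gcongr
      exact min_le_right _ _
    refine this.trans (le_of_eq ?_)
    field_simp
    norm_num
  let ψ' : S.Alg →⋆ₐ[ℂ] T.F m₂ := conjHom hw ((T.incl (hm₁.trans hm₂)).comp ψ)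
  have hψ' : ∀ z, T.sub m₂ (ψ' z) = T.sub m₂ w * T.sub m (ψ z) * star (T.sub m₂ w) := by
    intro z
    change T.sub m₂ (conjHom hw _ z) = _
    rw [conjHom_apply, map_mul, map_mul, map_star]
    rfl
  obtain ⟨S', ⟨f⟩⟩ := exists_blockShape_starAlgEquiv (T.F m₂)
  refine ⟨S', (T.sub m₂).comp (f : S'.Alg →⋆ₐ[ℂ] T.F m₂),
    (f.symm : T.F m₂ →⋆ₐ[ℂ] S'.Alg).comp ψ', f.symm ((t : ℂ) • y₀), ?_, ?_, ?_, ?_⟩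
  · intro i
    have h1 : ((T.sub m₂).comp (f : S'.Alg →⋆ₐ[ℂ] T.F m₂))
        (((f.symm : T.F m₂ →⋆ₐ[ℂ] S'.Alg).comp ψ') (x i)) = T.sub m₂ (ψ' (x i)) := by simp
    rw [h1, hψ', ← huz]
    change ‖T.sub m₂ w * X i * star (T.sub m₂ w) - u * X i * star u‖ ≤ δ
    set W := T.sub m₂ w
    have hW1 : ‖W‖ ≤ 1 := norm_le_one_of_mul_star_eq (.one A) (by
      rw [← map_star, ← map_mul, (Unitary.mem_iff.1 hw).2, map_one])
    have hu1 : ‖u‖ ≤ 1 := norm_le_one_of_mul_star_eq (.one A) (Unitary.mem_iff.1 hu).2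
    have h2 : W * X i * star W - u * X i * star u =
        (W - u) * X i * star W + u * X i * star (W - u) := by
      rw [star_sub]; noncomm_ring
    rw [h2]
    have h3 : ‖(W - u) * X i * star W‖ ≤ δ / (2 * M) * M * 1 := by
      refine (norm_mul_le _ _).trans ?_
      rw [norm_star]
      have h4 : ‖(W - u) * X i‖ ≤ δ / (2 * M) * M := (norm_mul_le _ _).trans
        (mul_le_mul hwu' (hM i) (norm_nonneg _) (by positivity))
      exact mul_le_mul h4 hW1 (norm_nonneg _) (by positivity)
    have h5 : ‖u * X i * star (W - u)‖ ≤ 1 * M * (δ / (2 * M)) := by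
      refine (norm_mul_le _ _).trans ?_
      rw [norm_star]
      have h4 : ‖u * X i‖ ≤ 1 * M := (norm_mul_le _ _).trans
        (mul_le_mul hu1 (hM i) (norm_nonneg _) (by positivity))
      exact mul_le_mul h4 hwu' (norm_nonneg _) (by positivity)
    have h6 : δ / (2 * M) * M = δ / 2 := by field_simp
    refine (norm_add_le _ _).trans ?_
    have h7 : 1 * M * (δ / (2 * M)) = δ / 2 := by rw [one_mul, mul_comm, h6]
    rw [h6] at h3
    rw [h7] at h5
    linarith
  · have h1 : ((T.sub m₂).comp (f : S'.Alg →⋆ₐ[ℂ] T.F m₂)) (f.symm ((t : ℂ) • y₀)) =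
        t • T.sub m₂ y₀ := by
      simp
      rfl
    rw [h1]
    have := (ht _ hy₀).2
    linarith
  · have h1 : ((T.sub m₂).comp (f : S'.Alg →⋆ₐ[ℂ] T.F m₂)) (f.symm ((t : ℂ) • y₀)) =
        t • T.sub m₂ y₀ := by
      simp
      rfl
    rw [h1]
    exact (ht _ hy₀).1
  · intro c
    have h1 : ((T.sub m₂).comp (f : S'.Alg →⋆ₐ[ℂ] T.F m₂))
        (((f.symm : T.F m₂ →⋆ₐ[ℂ] S'.Alg).comp ψ') (e₀ c)) = T.sub m₂ (ψ' (e₀ c)) := by simp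
    have hW : T.sub m₂ w ∈ unitary A := by
      rw [Unitary.mem_iff, ← map_star, ← map_mul, ← map_mul, (Unitary.mem_iff.1 hw).1,
        (Unitary.mem_iff.1 hw).2, map_one]
      exact ⟨rfl, rfl⟩
    have hp : IsStarProjection (T.sub m (ψ (e₀ c))) :=
      ((isStarProjection_e₀ c).map ψ).map (T.sub m)
    -- The classes agree exactly, not approximately: both projections are unitary conjugates of one
    -- projection.
    rw [h1, hψ', ecls_conj hW hp, ← huz, ecls_conj hu hp]

include T in
theorem of_injective : Function.Injective (Algebra.GrothendieckAddGroup.of (M := V A)) :=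
  have := T.V_isCancelAdd
  Algebra.GrothendieckAddGroup.of_injective

include T in
theorem countable_K0 : Countable (K0 A) := by
  have := T.countable_V
  have hs : Function.Surjective fun s : V A × (⊤ : AddSubmonoid (V A)) =>
      (AddLocalization.mk s.1 s.2 : K0 A) := fun x => by
    induction x using AddLocalization.ind with
    | _ y => exact ⟨y, rfl⟩
  exact hs.countable

end AFChain
end

/-! ### Positions and the game on `K₀` -/

noncomputable section

open KZero BlockShape InfLogic FirstOrder.Language

namespace KZero

/-- The unit term. -/
def unitTerm {α : Type} : language.Term α :=
  Term.func (l := 0) (Fun.unit : language.Functions 0) Fin.elim0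

/-- The sum of two terms. -/
def addTerm {α : Type} (t s : language.Term α) : language.Term α :=
  Term.func (l := 2) (Fun.add : language.Functions 2) ![t, s]

/-- The sum of a list of terms and the unit. -/
def sumTerm {α : Type} : List (language.Term α) → language.Term α
  | [] => unitTerm
  | t :: l => addTerm t (sumTerm l)

variable {A : Type*} [Ring A] [StarRing A] {α : Type}

theorem realize_unitTerm (v : α → K0 A) : (unitTerm : language.Term α).realize v = unitClass A :=
  rfl

theorem realize_addTerm (v : α → K0 A) (t s : language.Term α) :
    (addTerm t s).realize v = t.realize v + s.realize v := rfl

theorem realize_sumTerm (v : α → K0 A) (l : List (language.Term α)) :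
    (sumTerm l).realize v = (l.map fun t => t.realize v).sum + unitClass A := by
  induction l with
  | nil => simp [sumTerm, realize_unitTerm]
  | cons t l ih => rw [sumTerm, realize_addTerm, ih, List.map_cons, List.sum_cons, add_assoc]

/-- The list in which `s c` occurs `m c` times. -/
def multList {κ : Type} [Fintype κ] (m : κ → ℕ) (s : κ → language.Term α) :
    List (language.Term α) :=
  Finset.univ.toList.flatMap fun c => List.replicate (m c) (s c)

theorem sum_map_multList {κ : Type} [Fintype κ] (m : κ → ℕ) (s : κ → language.Term α)
    (v : α → K0 A) :
    ((multList m s).map fun t => t.realize v).sum = ∑ c, m c • (s c).realize v := by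
  rw [multList, List.map_flatMap, List.flatMap, List.sum_flatten, List.map_map,
    ← Finset.sum_map_toList]
  congr 2
  funext c
  simp

variable {B : Type*} [Ring B] [StarRing B] {β : Ordinal.{0}} {k : ℕ} {v : Fin k → K0 A}
  {w : Fin k → K0 B}

theorem TupleEquiv.realize_eq_iff (h : TupleEquiv (L := language) β v w)
    (t s : language.Term (Fin k)) :
    t.realize v = s.realize v ↔ t.realize w = s.realize w :=
  h (.equal t s) (by simp [Formula.qr])

theorem TupleEquiv.realize_sub_mem_iff (h : TupleEquiv (L := language) β v w)
    (t s : language.Term (Fin k)) :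
    s.realize v - t.realize v ∈ posCone A ↔ s.realize w - t.realize w ∈ posCone B :=
  h (.rel (l := 2) (Rel.le : language.Relations 2) ![t, s]) (by simp [Formula.qr])

/-- The language has no symbol for `0`, so positivity of `t` is written as `u ≤ t + u`. -/
theorem TupleEquiv.realize_mem_iff (h : TupleEquiv (L := language) β v w)
    (t : language.Term (Fin k)) : t.realize v ∈ posCone A ↔ t.realize w ∈ posCone B := by
  have := TupleEquiv.realize_sub_mem_iff h unitTerm (addTerm t unitTerm)
  simpa [realize_addTerm, realize_unitTerm] using this

/-- The sum may be empty and there is no term for `0`; adding `u` to both sides makes the equation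
expressible, and `u` cancels in the group. -/
theorem TupleEquiv.sum_eq_iff (h : TupleEquiv (L := language) β v w) {κ : Type} [Fintype κ]
    (m : κ → ℕ) (s : κ → language.Term (Fin k)) (t : language.Term (Fin k)) :
    ∑ c, m c • (s c).realize v = t.realize v ↔ ∑ c, m c • (s c).realize w = t.realize w := by
  have := TupleEquiv.realize_eq_iff h (sumTerm (multList m s)) (addTerm t unitTerm)
  simpa [realize_addTerm, realize_unitTerm, realize_sumTerm, sum_map_multList] using this

end KZero

section Kernel

variable {S : BlockShape} {A B : Type*} [CStarAlgebra A] [CStarAlgebra B]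

/-- The kernel is an ideal, hence a sum of blocks, and it contains the block `c` as soon as it
contains `e₀ c`. -/
theorem map_eq_zero_iff_e₀ {C : Type*} [Ring C] [StarRing C] [Algebra ℂ C] (φ : S.Alg →⋆ₐ[ℂ] C)
    (z : S.Alg) : φ z = 0 ↔ ∀ c, φ (e₀ c) = 0 ∨ z c = 0 := by
  constructor
  · intro h c
    by_contra! hne
    apply hne.2
    ext a b
    have h1 : e c (S.base c) a * z * e c b (S.base c) = z c a b • e₀ c := by
      funext d
      by_cases hd : d = c
      · subst hd
        ext i j
        by_cases hi : i = S.base d <;> by_cases hj : j = S.base d <;>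
          simp [e, e₀, hi, hj, eq_comm (a := S.base d)]
      · simp [e, e₀, hd]
    have h2 := congrArg φ h1
    rw [map_mul, map_mul, h, mul_zero, zero_mul, map_smul] at h2
    exact (smul_eq_zero.1 h2.symm).resolve_right hne.1
  · intro h
    rw [← sum_smul_e z]
    simp only [map_sum, map_smul]
    refine Finset.sum_eq_zero fun c _ => Finset.sum_eq_zero fun a _ => Finset.sum_eq_zero
      fun b _ => ?_
    rcases h c with h | h
    · have : φ (e c a b) = φ (e c a (S.base c)) * φ (e₀ c) * φ (e c (S.base c) b) := by
        rw [← map_mul, ← map_mul, e₀, e_mul_e, e_mul_e]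
      rw [this, h, mul_zero, zero_mul, smul_zero]
    · rw [h, Matrix.zero_apply, zero_smul]

/-- The range of `(φ, ψ)` in `A × B` is a C*-algebra that projects injectively, hence isometrically,
to both factors. -/
theorem norm_map_eq_of_ker_eq (φ : S.Alg →⋆ₐ[ℂ] A) (ψ : S.Alg →⋆ₐ[ℂ] B)
    (h : ∀ z, φ z = 0 ↔ ψ z = 0) (z : S.Alg) : ‖φ z‖ = ‖ψ z‖ := by
  let Φ : S.Alg →⋆ₐ[ℂ] A × B := φ.prod ψ
  let R := Φ.range
  have hfd : FiniteDimensional ℂ R := by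
    have : FiniteDimensional ℂ (LinearMap.range (Φ.toAlgHom.toLinearMap)) := inferInstance
    exact this
  have hcl : IsClosed (R : Set (A × B)) :=
    Submodule.closed_of_finiteDimensional (Subalgebra.toSubmodule R.toSubalgebra)
  let p : R →⋆ₐ[ℂ] A := (StarAlgHom.fst ℂ A B).comp R.subtype
  let q : R →⋆ₐ[ℂ] B := (StarAlgHom.snd ℂ A B).comp R.subtype
  have hp : Function.Injective p := by
    rw [injective_iff_map_eq_zero]
    rintro ⟨_, y, rfl⟩ hy
    have h1 : φ y = 0 := hy
    exact Subtype.ext (Prod.ext h1 ((h y).1 h1))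
  have hq : Function.Injective q := by
    rw [injective_iff_map_eq_zero]
    rintro ⟨_, y, rfl⟩ hy
    have h1 : ψ y = 0 := hy
    exact Subtype.ext (Prod.ext ((h y).2 h1) h1)
  have h1 := NonUnitalStarAlgHom.norm_map p hp ⟨Φ z, z, rfl⟩
  have h2 := NonUnitalStarAlgHom.norm_map q hq ⟨Φ z, z, rfl⟩
  exact h1.trans h2.symm

end Kernel

theorem ecls_map_eq_sum {S : BlockShape} {C : Type*} [Ring C] [StarRing C] [Algebra ℂ C]
    {p : S.Alg} (hp : IsStarProjection p) {m : S.Blk → ℕ} (hm : ecls p = ∑ c, m c • ecls (e₀ c))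
    (χ : S.Alg →⋆ₐ[ℂ] C) : ecls (χ p) = ∑ c, m c • ecls (χ (e₀ c)) := by
  rw [← V.map_ecls χ hp, hm, map_sum]
  exact Finset.sum_congr rfl fun c _ => by rw [map_nsmul, V.map_ecls χ (isStarProjection_e₀ c)]

/-- Homomorphisms `φ` and `ψ` into `A` and `B` form a position of rank `β` if their values on
`K₀` occur as values of terms at tuples that are equivalent up to rank `ω * β`. -/
def IsPosition (β : Ordinal.{0}) {S : BlockShape} {A B : Type*} [CStarAlgebra A] [CStarAlgebra B]
    (φ : S.Alg →⋆ₐ[ℂ] A) (ψ : S.Alg →⋆ₐ[ℂ] B) : Prop :=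
  ∃ (k : ℕ) (v : Fin k → K0 A) (w : Fin k → K0 B) (s : S.Blk → language.Term (Fin k)),
    TupleEquiv (L := language) (ω * β) v w ∧
    (∀ c, (s c).realize v = Algebra.GrothendieckAddGroup.of (ecls (φ (e₀ c)))) ∧
    ∀ c, (s c).realize w = Algebra.GrothendieckAddGroup.of (ecls (ψ (e₀ c)))

namespace IsPosition

variable {β : Ordinal.{0}} {S : BlockShape} {A B : Type*} [CStarAlgebra A] [CStarAlgebra B]
  {φ : S.Alg →⋆ₐ[ℂ] A} {ψ : S.Alg →⋆ₐ[ℂ] B}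

theorem symm (h : IsPosition β φ ψ) : IsPosition β ψ φ := by
  obtain ⟨k, v, w, s, h1, h2, h3⟩ := h
  exact ⟨k, w, v, s, h1.symm, h3, h2⟩

theorem mono (h : IsPosition β φ ψ) {γ : Ordinal.{0}} (hγ : γ ≤ β) : IsPosition γ φ ψ := by
  obtain ⟨k, v, w, s, h1, h2, h3⟩ := h
  exact ⟨k, v, w, s, h1.mono (by gcongr), h2, h3⟩

/-- Expresses vanishing of a projection as the equation `x + x = x`, which needs no symbol for `0`.
-/
theorem of_ecls_add_self_iff (T : AFChain A) {p : A} (hp : IsStarProjection p) :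
    (Algebra.GrothendieckAddGroup.of (ecls p) + Algebra.GrothendieckAddGroup.of (ecls p) : K0 A) =
      Algebra.GrothendieckAddGroup.of (ecls p) ↔ p = 0 := by
  rw [add_eq_left]
  constructor
  · intro h
    rw [← map_zero (Algebra.GrothendieckAddGroup.of (M := V A))] at h
    exact eq_zero_of_ecls_eq_zero hp (T.of_injective h)
  · rintro rfl
    rw [ecls_zero, map_zero]

/-- Atomic formulas detect which `e₀ c` are killed, so `φ` and `ψ` have the same kernel. -/
theorem norm_eq (TA : AFChain A) (TB : AFChain B) (h : IsPosition β φ ψ) (z : S.Alg) :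
    ‖φ z‖ = ‖ψ z‖ := by
  obtain ⟨k, v, w, s, h1, h2, h3⟩ := h
  have key : ∀ c, φ (e₀ c) = 0 ↔ ψ (e₀ c) = 0 := by
    intro c
    have := TupleEquiv.realize_eq_iff h1 (addTerm (s c) (s c)) (s c)
    rwa [realize_addTerm, realize_addTerm, h2, h3,
      of_ecls_add_self_iff TA ((isStarProjection_e₀ c).map φ),
      of_ecls_add_self_iff TB ((isStarProjection_e₀ c).map ψ)] at this
  refine norm_map_eq_of_ker_eq φ ψ (fun y => ?_) z
  rw [map_eq_zero_iff_e₀, map_eq_zero_iff_e₀]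
  simp only [key]

/-- One side of a position can be replaced by an extension, at the cost of lowering the rank. -/
theorem extend (TB : AFChain B) {S' : BlockShape} {φ' : S'.Alg →⋆ₐ[ℂ] A}
    {j : S.Alg →⋆ₐ[ℂ] S'.Alg} (h : IsPosition (β + 1) φ ψ)
    (hj : ∀ c, ecls (φ' (j (e₀ c))) = ecls (φ (e₀ c))) :
    ∃ ψ' : S'.Alg →⋆ₐ[ℂ] B, IsPosition β φ' ψ' ∧ ∀ z, ψ' (j z) = ψ z := by
  obtain ⟨k, v, w, s, h1, h2, h3⟩ := h
  have := TB.countable_K0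
  let K := Fintype.card S'.Blk
  let f : Fin K ≃ S'.Blk := (Fintype.equivFin S'.Blk).symm
  let g : S'.Blk → K0 A := fun c => Algebra.GrothendieckAddGroup.of (ecls (φ' (e₀ c)))
  -- One move for each block of `S'`. Their number `K` is finite, so `ω * β + K ≤ ω * β + ω = ω * (β
  -- + 1)`.
  obtain ⟨d, hd⟩ := TupleEquiv.exists_append (γ := ω * β) (k := K) (h1.mono (by
    rw [mul_add, mul_one]
    gcongr
    exact (Ordinal.natCast_lt_omega0 K).le)) (fun i => g (f i))
  let s' : S'.Blk → language.Term (Fin (k + K)) := fun c => .var (Fin.natAdd k (f.symm c))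
  let t : S.Blk → language.Term (Fin (k + K)) := fun c => (s c).relabel (Fin.castAdd K)
  have hsv : ∀ c, (s' c).realize (Fin.append v fun i => g (f i)) = g c := fun c => by
    simp [s']
  have hsw : ∀ c, (s' c).realize (Fin.append w d) = d (f.symm c) := fun c => by simp [s']
  have htv : ∀ c, (t c).realize (Fin.append v fun i => g (f i)) =
      Algebra.GrothendieckAddGroup.of (ecls (φ (e₀ c))) := fun c => by
    rw [← h2, Term.realize_relabel]
    congr 1
    funext i
    simp
  have htw : ∀ c, (t c).realize (Fin.append w d) =
      Algebra.GrothendieckAddGroup.of (ecls (ψ (e₀ c))) := fun c => by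
    rw [← h3, Term.realize_relabel]
    congr 1
    funext i
    simp
  -- Positivity of the answers and the relation with `u` are atomic, so the answers are classes
  -- realized by a homomorphism `ψ₀`.
  have hpos : ∀ c, ∃ x : V B, Algebra.GrothendieckAddGroup.of x = d (f.symm c) := fun c => by
    have := (TupleEquiv.realize_mem_iff hd (s' c)).1 (by rw [hsv]; exact ⟨_, rfl⟩)
    rw [hsw] at this
    exact this
  choose x hx using hpos
  have hsum : ∑ c, Fintype.card (S'.Idx c) • x c = ecls 1 := by
    apply TB.of_injective
    have := (TupleEquiv.sum_eq_iff hd (fun c => Fintype.card (S'.Idx c)) s' unitTerm).1 (by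
      simp only [hsv, g, realize_unitTerm]
      simp only [← map_nsmul]
      rw [← map_sum, sum_card_smul_ecls_map, ecls_one]
      rfl)
    simp only [hsw, ← hx, ← map_nsmul, realize_unitTerm] at this
    rw [← map_sum] at this
    rw [this, ecls_one]
    rfl
  obtain ⟨ψ₀, hψ₀⟩ := exists_hom_of_sum_eq x hsum
  have hψ₀' : ∀ c, ecls (ψ₀ (e₀ c)) = x c := hψ₀
  -- The equations expressing the classes of `j (e₀ c)` through those of `S'` are atomic too. Hence
  -- `ψ` and `ψ₀ ∘ j` agree on `V`, and a unitary conjugate of `ψ₀` extends `ψ` exactly without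
  -- changing the classes.
  have hcls : ∀ c, ecls (ψ (e₀ c)) = ecls (ψ₀ (j (e₀ c))) := by
    intro c
    obtain ⟨m, hm⟩ := exists_eq_sum_ecls_e (ecls (j (e₀ c)))
    have hm' : ecls (j (e₀ c)) = ∑ c, m c • ecls (e₀ c) := hm
    apply TB.of_injective
    rw [ecls_map_eq_sum ((isStarProjection_e₀ c).map j) hm' ψ₀]
    have := (TupleEquiv.sum_eq_iff hd m s' (t c)).1 (by
      simp only [hsv, htv, g, ← map_nsmul]
      rw [← map_sum, ← hj c, ecls_map_eq_sum ((isStarProjection_e₀ c).map j) hm' φ'])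
    simp only [hsw, htw, ← hx, ← map_nsmul] at this
    rw [← map_sum] at this
    simp only [hψ₀']
    exact this.symm
  obtain ⟨u, hu, huz⟩ := exists_unitary_of_ecls_eq ψ (ψ₀.comp j) hcls
  refine ⟨conjHom hu ψ₀, ⟨k + K, _, _, s', hd, hsv, fun c => ?_⟩, fun z => ?_⟩
  · rw [hsw, ← hx, ← hψ₀', conjHom_apply, ecls_conj hu ((isStarProjection_e₀ c).map ψ₀)]
  · rw [conjHom_apply]
    exact huz z

end IsPosition
end

/-! ### Transfer to continuous formulas -/

noncomputable section

section Approximation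

variable {ι κ : Type*} {f : ι → ℝ} {g : κ → ℝ}

theorem ciInf_le_ciInf_of_approx [Nonempty κ] (hf : BddBelow (Set.range f))
    (h : ∀ b, ∀ ε > 0, ∃ a, |g b - f a| < ε) : ⨅ a, f a ≤ ⨅ b, g b := by
  refine le_ciInf fun b => le_of_forall_pos_le_add fun ε hε => ?_
  obtain ⟨a, ha⟩ := h b ε hε
  linarith [ciInf_le hf a, (abs_lt.1 ha).1]

theorem ciSup_le_ciSup_of_approx [Nonempty ι] (hg : BddAbove (Set.range g))
    (h : ∀ a, ∀ ε > 0, ∃ b, |f a - g b| < ε) : ⨆ a, f a ≤ ⨆ b, g b := by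
  refine ciSup_le fun a => le_of_forall_pos_le_add fun ε hε => ?_
  obtain ⟨b, hb⟩ := h a ε hε
  linarith [le_ciSup hg b, (abs_lt.1 hb).2]

end Approximation

namespace MetricLogic

variable {A B : Type*} [CStarAlgebra A] [CStarAlgebra B] {S : BlockShape} {n : ℕ}

/-- Evaluation of a term in the finite-dimensional algebra of a shape. -/
def CTerm.evalAlg (x : Fin n → S.Alg) : CTerm n → S.Alg
  | .var i => x i
  | .zero => 0
  | .one => 1
  | .add t s => t.evalAlg x + s.evalAlg x
  | .mul t s => t.evalAlg x * s.evalAlg x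
  | .star t => Star.star (t.evalAlg x)
  | .smul c t => c • t.evalAlg x

theorem CTerm.map_evalAlg (φ : S.Alg →⋆ₐ[ℂ] A) (x : Fin n → S.Alg) (t : CTerm n) :
    φ (t.evalAlg x) = t.eval fun i => φ (x i) := by
  induction t with
  | var i => rfl
  | zero => exact map_zero φ
  | one => exact map_one φ
  | add t s ht hs => rw [evalAlg, eval, map_add, ht, hs]
  | mul t s ht hs => rw [evalAlg, eval, map_mul, ht, hs]
  | star t ht => rw [evalAlg, eval, map_star, ht]
  | smul c t ht => rw [evalAlg, eval, map_smul, ht]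

namespace MFormula

/-- The formula `χ` does not distinguish tuples in a common position of its rank. -/
def Respects (A B : Type*) [CStarAlgebra A] [CStarAlgebra B] (χ : MFormula n) (N : Fin n → ℕ) :
    Prop :=
  ∀ (S : BlockShape) (φ : S.Alg →⋆ₐ[ℂ] A) (ψ : S.Alg →⋆ₐ[ℂ] B), IsPosition χ.qr φ ψ →
    ∀ x : Fin n → S.Alg, (∀ i, ‖φ (x i)‖₊ ≤ N i) →
      χ.eval A (fun i => φ (x i)) = χ.eval B fun i => ψ (x i)

theorem nnnorm_map_le (TA : AFChain A) (TB : AFChain B) {β : Ordinal.{0}} {φ : S.Alg →⋆ₐ[ℂ] A}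
    {ψ : S.Alg →⋆ₐ[ℂ] B} (hp : IsPosition β φ ψ) {x : Fin n → S.Alg} {N : Fin n → ℕ}
    (hx : ∀ i, ‖φ (x i)‖₊ ≤ N i) (i : Fin n) : ‖ψ (x i)‖₊ ≤ N i := by
  have := hx i
  rwa [show ‖φ (x i)‖₊ = ‖ψ (x i)‖₊ from NNReal.eq (hp.norm_eq TA TB (x i))] at this

theorem Respects.symm (TA : AFChain A) (TB : AFChain B) {χ : MFormula n} {N : Fin n → ℕ}
    (h : χ.Respects A B N) : χ.Respects B A N := fun S φ ψ hp x hx =>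
  (h S ψ φ hp.symm x (nnnorm_map_le TB TA hp hx)).symm

theorem map_snoc {C : Type*} [CStarAlgebra C] (φ : S.Alg →⋆ₐ[ℂ] C) (x : Fin n → S.Alg)
    (y : S.Alg) : (fun i => φ ((Fin.snoc x y : Fin (n + 1) → S.Alg) i)) =
      (Fin.snoc (fun i => φ (x i)) (φ y) : Fin (n + 1) → C) := by
  funext i
  refine Fin.lastCases ?_ (fun i => ?_) i <;> simp

/-- The quantifier step. The tuple and `y` are moved by `δ` on the side of `A` only; the extension
on the side of `B` leaves `ψ (x i)` fixed. The values agree at the moved tuple, and uniform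
continuity in `A` bounds the effect of moving. -/
theorem Respects.exists_match (TA : AFChain A) (TB : AFChain B) {χ : MFormula (n + 1)}
    {N : Fin n → ℕ} {m : ℕ} {Γ : Control (n + 1)}
    (hχ : χ.Controlled (Fin.snoc N m) Γ) (hr : χ.Respects A B (Fin.snoc N m))
    {φ : S.Alg →⋆ₐ[ℂ] A} {ψ : S.Alg →⋆ₐ[ℂ] B} (hp : IsPosition (χ.qr + 1) φ ψ)
    {x : Fin n → S.Alg} (hx : ∀ i, ‖φ (x i)‖₊ ≤ N i) (y : {y : A // ‖y‖ ≤ m}) {ε : ℝ}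
    (hε : 0 < ε) : ∃ y' : {y : B // ‖y‖ ≤ m},
      |χ.eval A (Fin.snoc (fun i => φ (x i)) y.1) - χ.eval B (Fin.snoc (fun i => ψ (x i)) y'.1)|
        < ε := by
  obtain ⟨δ, hδ, hd⟩ := hχ.exists_delta (A := A) hε
  obtain ⟨S', φ', j, y', h1, h2, h3, h4⟩ := TA.exists_approx φ x m.cast_nonneg y.2 hδ
  obtain ⟨ψ', hp', hj⟩ := hp.extend TB h4
  -- The moved tuple stays in the balls: positions preserve norms, and both `φ' (j (x i))` and `φ (x
  -- i)` are matched with `ψ (x i)`.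
  have hx' : ∀ i, ‖φ' (j (x i))‖₊ ≤ N i := fun i => by
    refine le_trans (le_of_eq (NNReal.eq ?_)) (hx i)
    change ‖φ' (j (x i))‖ = ‖φ (x i)‖
    rw [hp'.norm_eq TA TB, hj, hp.norm_eq TA TB]
  have hy' : ‖ψ' y'‖ ≤ m := by rwa [← hp'.norm_eq TA TB]
  have hsn := nnnorm_snoc_le hx' h3
  have key := hr S' φ' ψ' hp' (Fin.snoc (fun i => j (x i)) y') (by
    intro i
    have := hsn i
    rwa [← map_snoc φ' (fun i => j (x i))] at this)
  rw [map_snoc, map_snoc] at key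
  simp only [hj] at key
  refine ⟨⟨ψ' y', hy'⟩, ?_⟩
  rw [← key]
  refine hd _ _ (nnnorm_snoc_le hx y.2) hsn fun i => ?_
  rw [norm_sub_rev]
  refine Fin.lastCases ?_ (fun i => ?_) i
  · simpa using h2
  · simpa using h1 i

/-- Controlled formulas do not distinguish tuples in a common position of their rank. -/
theorem Controlled.respects (TA : AFChain A) (TB : AFChain B) {χ : MFormula n} :
    ∀ {N : Fin n → ℕ} {Δ : Control n}, χ.Controlled N Δ → χ.Respects A B N := by
  induction χ with
  | dist t s =>
    intro N Δ _ S φ ψ hp x hx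
    rw [eval, eval, ← CTerm.map_evalAlg, ← CTerm.map_evalAlg, ← CTerm.map_evalAlg,
      ← CTerm.map_evalAlg, ← map_sub, ← map_sub, hp.norm_eq TA TB]
  | conn f χ ih =>
    rintro N Δ ⟨Γ, hΓ, -⟩ S φ ψ hp x hx
    rw [eval, eval]
    congr 1
    funext i
    exact ih i (hΓ i) S φ ψ (hp.mono (Ordinal.le_iSup (fun i => (χ i).qr) i)) x hx
  | conj χ ih =>
    intro N Δ h S φ ψ hp x hx
    rw [eval, eval]
    congr 1
    funext i
    exact ih i (h i) S φ ψ (hp.mono (Ordinal.le_iSup (fun i => (χ i).qr) i)) x hx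
  | disj χ ih =>
    intro N Δ h S φ ψ hp x hx
    rw [eval, eval]
    congr 1
    funext i
    exact ih i (h i) S φ ψ (hp.mono (Ordinal.le_iSup (fun i => (χ i).qr) i)) x hx
  | inf m χ ih =>
    rintro N Δ ⟨Γ, hΓ, -⟩ S φ ψ hp x hx
    have hr := ih hΓ
    have hx' := nnnorm_map_le TA TB hp hx
    rw [eval, eval]
    -- Each inequality answers a challenge from one algebra in the other, so one of them uses the
    -- reversed position.
    refine le_antisymm (ciInf_le_ciInf_of_approx (Controlled.bddBelow_range (fun _ => hΓ) fun y => nnnorm_snoc_le hx y.2)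
        fun y ε hε => ?_)
      (ciInf_le_ciInf_of_approx (Controlled.bddBelow_range (fun _ => hΓ) fun y => nnnorm_snoc_le hx' y.2)
        fun y ε hε => ?_)
    · exact (hr.symm TA TB).exists_match TB TA hΓ hp.symm hx' y hε
    · exact hr.exists_match TA TB hΓ hp hx y hε
  | sup m χ ih =>
    rintro N Δ ⟨Γ, hΓ, -⟩ S φ ψ hp x hx
    have hr := ih hΓ
    have hx' := nnnorm_map_le TA TB hp hx
    rw [eval, eval]
    refine le_antisymm (ciSup_le_ciSup_of_approx (Controlled.bddAbove_range (fun _ => hΓ) fun y => nnnorm_snoc_le hx' y.2)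
        fun y ε hε => ?_)
      (ciSup_le_ciSup_of_approx (Controlled.bddAbove_range (fun _ => hΓ) fun y => nnnorm_snoc_le hx y.2)
        fun y ε hε => ?_)
    · exact hr.exists_match TA TB hΓ hp hx y hε
    · exact (hr.symm TA TB).exists_match TB TA hΓ hp.symm hx' y hε

end MFormula

end MetricLogic

/-- The shape of `ℂ`. -/
def BlockShape.point : BlockShape where
  Blk := Unit
  Idx _ := Unit
  base _ := ()

/-- The initial position: `ℂ` has a single minimal projection, its unit, whose class is the value of
the term `u`. Empty tuples suffice, and their equivalence is the hypothesis on `K₀`. -/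
theorem exists_isPosition_point {A B : Type*} [CStarAlgebra A] [CStarAlgebra B] {α : Ordinal.{0}}
    (hK : InfLogic.Equiv KZero.language (ω * α) (KZero.K0 A) (KZero.K0 B)) :
    ∃ (φ : BlockShape.point.Alg →⋆ₐ[ℂ] A) (ψ : BlockShape.point.Alg →⋆ₐ[ℂ] B),
      IsPosition α φ ψ := by
  have hc : ∀ c : BlockShape.point.Blk, Fintype.card (BlockShape.point.Idx c) = 1 :=
    fun _ => Fintype.card_unit
  have hb : Fintype.card BlockShape.point.Blk = 1 := Fintype.card_unit
  obtain ⟨φ, hφ⟩ := BlockShape.exists_hom_of_sum_eq (C := A) (S := BlockShape.point)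
    (fun _ => KZero.ecls 1) (by simp [hc, hb])
  obtain ⟨ψ, hψ⟩ := BlockShape.exists_hom_of_sum_eq (C := B) (S := BlockShape.point)
    (fun _ => KZero.ecls 1) (by simp [hc, hb])
  refine ⟨φ, ψ, 0, Fin.elim0, Fin.elim0, fun _ => KZero.unitTerm, hK, fun c => ?_, fun c => ?_⟩
  · rw [KZero.realize_unitTerm, BlockShape.e₀, hφ, KZero.ecls_one]
    rfl
  · rw [KZero.realize_unitTerm, BlockShape.e₀, hψ, KZero.ecls_one]
    rfl

end

theorem corollary3p2 (A : Type*) (B : Type*) [CStarAlgebra A] [CStarAlgebra B]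
    (hA : IsAFAlgebra A) (hB : IsAFAlgebra B) (α : Ordinal.{0}) (hα : α < ω₁)
    (hK : InfLogic.Equiv KZero.language (ω * α) (KZero.K0 A) (KZero.K0 B)) :
    MetricLogic.Equiv α A B := by
  obtain ⟨TA⟩ := hA.nonempty_afChain
  obtain ⟨TB⟩ := hB.nonempty_afChain
  obtain ⟨φ, ψ, hp⟩ := exists_isPosition_point hK
  rintro χ ⟨Δ, hΔ⟩ hχ
  have := hΔ.respects TA TB _ φ ψ (hp.mono hχ) Fin.elim0 fun i => i.elim0
  convert this using 2
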